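/- A Lempel-Ziv (LZ) parse of size $n\ge 1$ of a string $t$ of length $N$ is a sequence of triples $(start_i,len_i,next_i)$, $i=1,\dots,n$, where $start_i,len_i$ are nonnegative integers and $next_i$ is a letter, such that, with $L_i=\sum_{j<i}(len_j+1)$, we have $N=L_{n+1}$ and $$t[L_i+1\,..\,L_i+len_i+1]=t[start_i\,..\,start_i+len_i-1]\;next_i ,$$ and $1\le start_i\le L_i$ whenever $len_i>0$. The parse may be self-referential: the fragment $t[start_i\,..\,start_i+len_i-1]$ may extend beyond position $L_i$. A straight-line program (SLP) is a context-free grammar in Chomsky normal form whose nonterminals can be ordered as $X_1,\dots,X_s$ so that each $X_i$ is the left side of exactly one production and $X_i\to X_jX_k$ implies $j,k<i$; one nonterminal is designated as the start symbol, and the size of the SLP is $s$. Let $|X|$ be the length of the unique string derived from $X$. For $0<\alpha<\frac12$ the SLP is $\alpha$-balanced if every production $X\to YZ$ satisfies $\frac{\alpha}{1-\alpha}\le\frac{|Y|}{|Z|}\le\frac{1-\alpha}{\alpha}$. The model of computation is the word RAM: memory cells hold words of $w$ bits, and direct and indirect addressing, addition and subtraction (modulo $2^w$), integer division, and (conditional)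 jumps take unit time; there is no multiplication. **Statement.** For every real constant $0<\alpha\le 1-\frac{\sqrt2}{2}$ there are a RAM program and constants $C,K$, depending only on $\alpha$, such that the following holds for every word size $w$ and every (potentially self-referential) LZ parse of size $n\ge1$ of a string $t$ of length $N$ such that $KN\le 2^w$ and every $start_i$ and every letter $next_i$ is a $w$-bit word. Started on the parse, the program halts and outputs an $\alpha$-balanced SLP whose start symbol derives $t$ and whose size $s$ satisfies $$s\le C\,n\Bigl(1+\log\frac Nn\Bigr),$$ and its running time is at most $C\,s$, that is, proportional to the size of the output. (In particular $s$ and the running time are $\mathcal O(n\log\frac Nn)$ when $N\ge 2n$.) -/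

import Mathlib

/-! ### Lempel-Ziv parses -/

/-- A triple `(start, len, next)` of a Lempel-Ziv parse. Letters are natural numbers, and positions
in the text are counted from `1`, so `start` is a 1-based position. -/
structure LZTriple where
  start : ℕ
  len : ℕ
  next : ℕ

/-- The length of the text described by a parse: the `i`-th triple describes `len_i + 1` letters. -/
def lzLength (p : List LZTriple) : ℕ := (p.map fun q => q.len + 1).sum

/-- `IsLZParse p t`: the sequence `p` of triples is a (potentially self-referential) Lempel-Ziv
parse of the string `t`. If `L` letters precede the part of the text described by the `i`-th triple,
then that part is `t[start_i .. start_i + len_i - 1] next_i`, and the fragment referred to has to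
begin in (but may stick out of) `t[1 .. L]`. Lists are 0-based, whence `start - 1`. -/
structure IsLZParse (p : List LZTriple) (t : List ℕ) : Prop where
  length_eq : t.length = lzLength p
  start_le : ∀ (i : ℕ) (h : i < p.length), 0 < p[i].len →
    1 ≤ p[i].start ∧ p[i].start ≤ lzLength (p.take i)
  copy : ∀ (i : ℕ) (h : i < p.length) (k : ℕ), k < p[i].len →
    t[lzLength (p.take i) + k]? = t[p[i].start - 1 + k]?
  next : ∀ (i : ℕ) (h : i < p.length),
    t[lzLength (p.take i) + p[i].len]? = some p[i].next

/-! ### Straight-line programs -/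

/-- The right side of a production in Chomsky normal form: a letter, or two nonterminals (given by
their indices). -/
inductive SLPRule where
  | letter (a : ℕ)
  | pair (j k : ℕ)

/-- A straight-line program with nonterminals `X_0, …, X_{s-1}`: the right side of the only
production of `X_i` is `rules[i]`, and `X_i → X_j X_k` implies `j, k < i`. -/
structure SLP where
  rules : List SLPRule
  start : ℕ
  start_lt : start < rules.length
  lt_of_pair : ∀ i j k : ℕ, rules[i]? = some (SLPRule.pair j k) → j < i ∧ k < i

namespace SLP

/-- The size of a straight-line program is the number of its nonterminals (i.e. productions). -/
def size (G : SLP) : ℕ := G.rules.length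

/-- `G.Derives i u`: the nonterminal `X_i` derives the string `u`. -/
inductive Derives (G : SLP) : ℕ → List ℕ → Prop
  | letter {i a : ℕ} (h : G.rules[i]? = some (SLPRule.letter a)) : Derives G i [a]
  | pair {i j k : ℕ} {u v : List ℕ} (h : G.rules[i]? = some (SLPRule.pair j k))
      (hu : Derives G j u) (hv : Derives G k v) : Derives G i (u ++ v)

theorem Derives.unique {G : SLP} {i : ℕ} {u v : List ℕ} (hu : G.Derives i u)
    (hv : G.Derives i v) : u = v := by
  induction hu generalizing v with
  | letter h =>
    cases hv with
    | letter h' => simp_all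
    | pair h' _ _ => simp_all
  | pair h _ _ ih₁ ih₂ =>
    cases hv with
    | letter h' => simp_all
    | pair h' h₁ h₂ =>
      rw [h] at h'
      cases h'
      rw [ih₁ h₁, ih₂ h₂]

/-- Every nonterminal derives exactly one string. -/
theorem existsUnique_derives (G : SLP) (i : ℕ) (hi : i < G.size) : ∃! u, G.Derives i u := by
  suffices h : ∃ u, G.Derives i u by
    obtain ⟨u, hu⟩ := h
    exact ⟨u, hu, fun v hv => hv.unique hu⟩
  induction i using Nat.strong_induction_on with
  | _ i ih =>
    have hget : G.rules[i]? = some (G.rules[i]'hi) := List.getElem?_eq_getElem hi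
    cases hr : G.rules[i]'hi with
    | letter a => exact ⟨[a], .letter (by rw [hget, hr])⟩
    | pair j k =>
      rw [hr] at hget
      obtain ⟨hj, hk⟩ := G.lt_of_pair i j k hget
      obtain ⟨u, hu⟩ := ih j hj (hj.trans hi)
      obtain ⟨v, hv⟩ := ih k hk (hk.trans hi)
      exact ⟨u ++ v, .pair hget hu hv⟩

/-- `G` is `α`-balanced: every production `X → Y Z` satisfies
`α / (1 - α) ≤ |Y| / |Z| ≤ (1 - α) / α`. -/
def IsBalanced (G : SLP) (α : ℝ) : Prop :=
  ∀ (i j k : ℕ) (u v : List ℕ), G.rules[i]? = some (SLPRule.pair j k) →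
    G.Derives j u → G.Derives k v →
      α / (1 - α) ≤ (u.length : ℝ) / (v.length : ℝ) ∧
        (u.length : ℝ) / (v.length : ℝ) ≤ (1 - α) / α

end SLP

/-! ### The word RAM

A machine with word size `w` has registers (cells with direct addressing) and a memory of `2 ^ w`
words that is addressed indirectly. There is no multiplication. -/

/-- The instructions of the RAM. `d`, `a`, `b` are register numbers. -/
inductive RAMInstr where
  /-- `R[d] := c` -/
  | const (d c : ℕ)
  /-- `R[d] := R[a]` -/
  | move (d a : ℕ)
  /-- `R[d] := M[R[a]]` -/
  | load (d a : ℕ)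
  /-- `M[R[d]] := R[a]` -/
  | store (d a : ℕ)
  /-- `R[d] := R[a] + R[b]` modulo `2 ^ w` -/
  | add (d a b : ℕ)
  /-- `R[d] := R[a] - R[b]` modulo `2 ^ w` -/
  | sub (d a b : ℕ)
  /-- `R[d] := ⌊R[a] / R[b]⌋` -/
  | div (d a b : ℕ)
  /-- go to instruction `l` -/
  | jump (l : ℕ)
  /-- go to instruction `l` if `R[a] < R[b]` (as unsigned integers) -/
  | jumpLt (a b l : ℕ)

/-- A program is a finite list of instructions, numbered from `0`. It does not depend on the word
size. -/
abbrev RAMProgram := List RAMInstr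

/-- A configuration of the RAM with word size `w`. -/
structure RAMState (w : ℕ) where
  pc : ℕ
  reg : ℕ → BitVec w
  mem : BitVec w → BitVec w

namespace RAMState

variable {w : ℕ}

/-- Write the word `x` to the register `d` and proceed to the next instruction. -/
def setReg (s : RAMState w) (d : ℕ) (x : BitVec w) : RAMState w :=
  { s with pc := s.pc + 1, reg := Function.update s.reg d x }

/-- The effect of one instruction. -/
def exec (s : RAMState w) : RAMInstr → RAMState w
  | .const d c => s.setReg d (BitVec.ofNat w c)
  | .move d a => s.setReg d (s.reg a)
  | .load d a => s.setReg d (s.mem (s.reg a))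
  | .store d a => { s with pc := s.pc + 1, mem := Function.update s.mem (s.reg d) (s.reg a) }
  | .add d a b => s.setReg d (s.reg a + s.reg b)
  | .sub d a b => s.setReg d (s.reg a - s.reg b)
  | .div d a b => s.setReg d (s.reg a / s.reg b)
  | .jump l => { s with pc := l }
  | .jumpLt a b l =>
    { s with pc := if (s.reg a).toNat < (s.reg b).toNat then l else s.pc + 1 }

/-- The machine halts when the program counter leaves the program. -/
def Halted (P : RAMProgram) (s : RAMState w) : Prop := P.length ≤ s.pc

/-- One step of the program `P`; a step takes one unit of time. -/
def step (P : RAMProgram) (s : RAMState w) : RAMState w :=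
  match P[s.pc]? with
  | some I => s.exec I
  | none => s

/-- The initial configuration on the input `p`: register `0` holds the number of triples, the memory
holds `start_0, len_0, next_0, start_1, len_1, next_1, …` from address `0` on, and all other
cells are zero. -/
def init (w : ℕ) (p : List LZTriple) : RAMState w where
  pc := 0
  reg r := if r = 0 then BitVec.ofNat w p.length else 0
  mem a := BitVec.ofNat w ((p.flatMap fun q => [q.start, q.len, q.next]).getD a.toNat 0)

/-- The configuration `s` holds the straight-line program `G` as its output: register `0` is the
address `b` of the output, register `1` the size of `G`, register `2` the index of its start symbol,
and the production of `X_i` is at the addresses `b + 3 i, b + 3 i + 1, b + 3 i + 2`, as `0, a, _` for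
`X_i → a` and as `1, j, k` for `X_i → X_j X_k`. -/
def Outputs (s : RAMState w) (G : SLP) : Prop :=
  (s.reg 0).toNat + 3 * G.size ≤ 2 ^ w ∧
  (s.reg 1).toNat = G.size ∧
  (s.reg 2).toNat = G.start ∧
  ∀ (i : ℕ) (r : SLPRule), G.rules[i]? = some r →
    match r with
    | .letter a =>
      (s.mem (s.reg 0 + BitVec.ofNat w (3 * i))).toNat = 0 ∧
      (s.mem (s.reg 0 + BitVec.ofNat w (3 * i + 1))).toNat = a
    | .pair j k =>
      (s.mem (s.reg 0 + BitVec.ofNat w (3 * i))).toNat = 1 ∧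
      (s.mem (s.reg 0 + BitVec.ofNat w (3 * i + 1))).toNat = j ∧
      (s.mem (s.reg 0 + BitVec.ofNat w (3 * i + 2))).toNat = k

end RAMState

/-!
Let `N = |t|`, let `n` be the number of triples, and let `B = ⌊N / n⌋ + 1`. The text is built from
left to right as a sequence of blocks of length `B`, each of them the text of one weight-balanced
tree whose nodes are nonterminals. Cutting the copied factors at the ends of the blocks leaves at
most `2 n` pieces, since `N / B ≤ n`. A piece has length at most `B`, so its source lies in at most
two consecutive blocks and is cut out of their trees, and the piece is joined to the last tree, with
`O(log B)` new nonterminals in time `O(log B)` (`extract_spec`, `append_spec`). If the piece overlaps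
its source, then it repeats the letters after its start with a fixed period; the available period is
doubled until it is long enough (`piece_spec`). Finally the blocks, of which all but the last have
the same weight, are joined like the digits of a binary counter, and the remaining trees are joined
from the top of the stack downwards (`tower_spec`); this costs `O(n + log N)`. All of this is
`O(n (1 + log (N / n)))`, see `log_bounds`.

Balance: siblings are kept within the ratio `1 + √2`. This suffices for all `α ≤ 1 - √2 / 2`, as
`(1 - α) / α ≥ 1 + √2` for these. It is also a ratio for which a single or a double rotation repairs
the balance after a join. The machine decides `(1 + √2) |X| < y` exactly: it computes a Pell
approximation `P / q` of `1 + √2` with `q > 4 N`, for which `⌊|X| P / q⌋ = ⌊(1 + √2) |X|⌋`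
(`rho_mul_lt_iff`), and it maintains the quotient and the remainder of `|X| P` by `q` additively
along with each nonterminal, so that no multiplication is needed.

Cost: let `ell x = ⌊log₂ x²⌋`. A child whose weight is at most `1 + √2` times that of its sibling
has a smaller `ell` than its parent (`ell_child`), so depths are bounded by `ell`, and the cost of
joining a sequence of trees whose weights do not drop too much telescopes (`jc_le`).

The output may contain nonterminals that the start symbol does not reach; in particular `pad` adds
`n (⌊log₂ B⌋ + 1)` of them, so that the size of the output has the order of the bound, and the
running time is at most proportional to it.

The program is written in a small structured language with registers and arrays. `Ex` is its
semantics with costs, `Tri` expresses total correctness with a time bound, and `Ex.simulates` shows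
that the compiled program does the same on the word RAM in the same number of steps.
-/


/-! ### A structured language over the word RAM -/

/-- A state of the structured language: registers, and infinitely many arrays. -/
structure St where
  reg : ℕ → ℕ
  arr : ℕ → ℕ → ℕ

namespace St

/-- Writes `x` to the register `r`. -/
def set (s : St) (r x : ℕ) : St := ⟨Function.update s.reg r x, s.arr⟩

/-- Writes `x` to the cell `i` of the array `a`. -/
def setA (s : St) (a i x : ℕ) : St :=
  ⟨s.reg, Function.update s.arr a (Function.update (s.arr a) i x)⟩

@[simp] theorem set_reg (s : St) (r x r' : ℕ) :
    (s.set r x).reg r' = if r' = r then x else s.reg r' := by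
  simp [set, Function.update_apply]

@[simp] theorem set_arr (s : St) (r x : ℕ) : (s.set r x).arr = s.arr := rfl

@[simp] theorem setA_reg (s : St) (a i x : ℕ) : (s.setA a i x).reg = s.reg := rfl

@[simp] theorem setA_arr (s : St) (a i x a' j : ℕ) :
    (s.setA a i x).arr a' j = if a' = a ∧ j = i then x else s.arr a' j := by
  by_cases h : a' = a
  · subst h; simp [setA, Function.update_apply]
  · simp [setA, h]

theorem setA_arr_ne (s : St) (a i x a' : ℕ) (h : a' ≠ a) : (s.setA a i x).arr a' = s.arr a' := by
  simp [setA, h]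

end St

/-- The elementary operations: `ld d k a` reads `d := A_k[a]`, and `st k d a` writes
`A_k[d] := a`. -/
inductive Op where
  | const (d c : ℕ)
  | move (d a : ℕ)
  | ld (d k a : ℕ)
  | st (k d a : ℕ)
  | add (d a b : ℕ)
  | sub (d a b : ℕ)
  | div (d a b : ℕ)

/-- The resources of a machine: numbers are below `W`, there are `kx` arrays, each of length `M`. -/
structure Lim where
  W : ℕ
  M : ℕ
  kx : ℕ

namespace Op

/-- The effect of an operation, with natural numbers instead of words. -/
def run (s : St) : Op → St
  | const d c => s.set d c
  | move d a => s.set d (s.reg a)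
  | ld d k a => s.set d (s.arr k (s.reg a))
  | st k d a => s.setA k (s.reg d) (s.reg a)
  | add d a b => s.set d (s.reg a + s.reg b)
  | sub d a b => s.set d (s.reg a - s.reg b)
  | div d a b => s.set d (s.reg a / s.reg b)

/-- The operation neither overflows nor leaves the bounds of an array. -/
def ok (L : Lim) (s : St) : Op → Prop
  | const _ c => c < L.W
  | move _ _ => True
  | ld _ k a => k < L.kx ∧ s.reg a < L.M
  | st k d _ => k < L.kx ∧ s.reg d < L.M
  | add _ a b => s.reg a + s.reg b < L.W
  | sub _ a b => s.reg b ≤ s.reg a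
  | div _ _ _ => True

/-- The number of RAM instructions that realize the operation. -/
def cost : Op → ℕ
  | ld _ _ _ => 2
  | st _ _ _ => 2
  | _ => 1

/-- The realization on the RAM: registers are shifted by `20`, the base addresses of the arrays are
in the registers from `1` on, and register `19` is auxiliary. -/
def comp : Op → List RAMInstr
  | const d c => [.const (d + 20) c]
  | move d a => [.move (d + 20) (a + 20)]
  | ld d k a => [.add 19 (k + 1) (a + 20), .load (d + 20) 19]
  | st k d a => [.add 19 (k + 1) (d + 20), .store 19 (a + 20)]
  | add d a b => [.add (d + 20) (a + 20) (b + 20)]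
  | sub d a b => [.sub (d + 20) (a + 20) (b + 20)]
  | div d a b => [.div (d + 20) (a + 20) (b + 20)]

/-- All registers written by the operation are below `m`. -/
def regLt (m : ℕ) : Op → Bool
  | const d _ => d < m
  | move d _ => d < m
  | ld d _ _ => d < m
  | st _ _ _ => true
  | add d _ _ => d < m
  | sub d _ _ => d < m
  | div d _ _ => d < m

/-- The operation does not write the register `r`. -/
def keeps (r : ℕ) : Op → Bool
  | const d _ => d != r
  | move d _ => d != r
  | ld d _ _ => d != r
  | st _ _ _ => true
  | add d _ _ => d != r
  | sub d _ _ => d != r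
  | div d _ _ => d != r

/-- The operation does not write the array `k`. -/
def keepsA (k : ℕ) : Op → Bool
  | st k' _ _ => k' != k
  | _ => true

end Op

/-- Structured programs; the tests are of the form `R[a] < R[b]`. -/
inductive Cmd where
  | skip
  | op (o : Op)
  | seq (c₁ c₂ : Cmd)
  | ite (a b : ℕ) (c₁ c₂ : Cmd)
  | loop (a b : ℕ) (c : Cmd)

namespace Cmd

/-- A straight-line program. -/
def blk : List Op → Cmd
  | [] => skip
  | o :: os => seq (op o) (blk os)

/-- All registers written by the program are below `m`. -/
def regLt (m : ℕ) : Cmd → Bool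
  | skip => true
  | op o => o.regLt m
  | seq c₁ c₂ => c₁.regLt m && c₂.regLt m
  | ite _ _ c₁ c₂ => c₁.regLt m && c₂.regLt m
  | loop _ _ c => c.regLt m

/-- The program does not write the register `r`. -/
def keeps (r : ℕ) : Cmd → Bool
  | skip => true
  | op o => o.keeps r
  | seq c₁ c₂ => c₁.keeps r && c₂.keeps r
  | ite _ _ c₁ c₂ => c₁.keeps r && c₂.keeps r
  | loop _ _ c => c.keeps r

/-- The program does not write the array `k`. -/
def keepsA (k : ℕ) : Cmd → Bool
  | skip => true
  | op o => o.keepsA k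
  | seq c₁ c₂ => c₁.keepsA k && c₂.keepsA k
  | ite _ _ c₁ c₂ => c₁.keepsA k && c₂.keepsA k
  | loop _ _ c => c.keepsA k

/-- The number of RAM instructions of the compiled program. -/
def len : Cmd → ℕ
  | skip => 0
  | op o => o.cost
  | seq c₁ c₂ => c₁.len + c₂.len
  | ite _ _ c₁ c₂ => c₁.len + c₂.len + 2
  | loop _ _ c => c.len + 3

/-- The compiled program, to be placed at the address `o`. -/
def comp : ℕ → Cmd → List RAMInstr
  | _, skip => []
  | _, op p => p.comp
  | o, seq c₁ c₂ => c₁.comp o ++ c₂.comp (o + c₁.len)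
  | o, ite a b c₁ c₂ =>
    .jumpLt (a + 20) (b + 20) (o + c₂.len + 2) ::
      (c₂.comp (o + 1) ++ .jump (o + c₂.len + 2 + c₁.len) :: c₁.comp (o + c₂.len + 2))
  | o, loop a b c =>
    .jumpLt (a + 20) (b + 20) (o + 2) :: .jump (o + c.len + 3) ::
      (c.comp (o + 2) ++ [.jump o])

theorem length_comp (c : Cmd) (o : ℕ) : (c.comp o).length = c.len := by
  induction c generalizing o with
  | skip => rfl
  | op p => cases p <;> rfl
  | seq c₁ c₂ h₁ h₂ => simp [comp, len, h₁, h₂]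
  | ite a b c₁ c₂ h₁ h₂ => simp [comp, len, h₁, h₂]; omega
  | loop a b c h => simp [comp, len, h]

end Cmd

/-- `Ex L c s k s'`: within the limits `L`, the program `c` leads from `s` to `s'`, and its
compilation takes `k` steps. -/
inductive Ex (L : Lim) : Cmd → St → ℕ → St → Prop
  | skip (s : St) : Ex L .skip s 0 s
  | op (o : Op) (s : St) (h : o.ok L s) : Ex L (.op o) s o.cost (o.run s)
  | seq {c₁ c₂ : Cmd} {s s₁ s₂ : St} {k₁ k₂ : ℕ} (h₁ : Ex L c₁ s k₁ s₁) (h₂ : Ex L c₂ s₁ k₂ s₂) :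
      Ex L (.seq c₁ c₂) s (k₁ + k₂) s₂
  | iteTrue {a b : ℕ} {c₁ c₂ : Cmd} {s s' : St} {k : ℕ} (h : s.reg a < s.reg b)
      (h₁ : Ex L c₁ s k s') : Ex L (.ite a b c₁ c₂) s (k + 1) s'
  | iteFalse {a b : ℕ} {c₁ c₂ : Cmd} {s s' : St} {k : ℕ} (h : ¬ s.reg a < s.reg b)
      (h₁ : Ex L c₂ s k s') : Ex L (.ite a b c₁ c₂) s (k + 2) s'
  | loopTrue {a b : ℕ} {c : Cmd} {s s₁ s₂ : St} {k₁ k₂ : ℕ} (h : s.reg a < s.reg b)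
      (h₁ : Ex L c s k₁ s₁) (h₂ : Ex L (.loop a b c) s₁ k₂ s₂) :
      Ex L (.loop a b c) s (k₁ + k₂ + 2) s₂
  | loopFalse {a b : ℕ} {c : Cmd} {s : St} (h : ¬ s.reg a < s.reg b) : Ex L (.loop a b c) s 2 s

namespace Ex

variable {L : Lim}

theorem reg_eq_of_regLt {c : Cmd} {s s' : St} {k m : ℕ} (h : Ex L c s k s') (hm : c.regLt m)
    {r : ℕ} (hr : m ≤ r) : s'.reg r = s.reg r := by
  induction h with
  | skip => rfl
  | op o s _ =>
    cases o <;> simp [Cmd.regLt, Op.regLt] at hm <;> simp [Op.run] <;> omega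
  | seq _ _ h₁ h₂ =>
    simp [Cmd.regLt] at hm; rw [h₂ hm.2, h₁ hm.1]
  | iteTrue _ _ h₁ => simp [Cmd.regLt] at hm; rw [h₁ hm.1]
  | iteFalse _ _ h₁ => simp [Cmd.regLt] at hm; rw [h₁ hm.2]
  | loopTrue _ _ _ h₁ h₂ => rw [h₂ hm, h₁ (by simpa [Cmd.regLt] using hm)]
  | loopFalse => rfl

theorem reg_eq_of_keeps {c : Cmd} {s s' : St} {k r : ℕ} (h : Ex L c s k s') (hm : c.keeps r) :
    s'.reg r = s.reg r := by
  induction h with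
  | skip => rfl
  | op o s _ =>
    cases o <;> simp [Cmd.keeps, Op.keeps] at hm <;> simp [Op.run] <;> omega
  | seq _ _ h₁ h₂ =>
    simp [Cmd.keeps] at hm; rw [h₂ hm.2, h₁ hm.1]
  | iteTrue _ _ h₁ => simp [Cmd.keeps] at hm; rw [h₁ hm.1]
  | iteFalse _ _ h₁ => simp [Cmd.keeps] at hm; rw [h₁ hm.2]
  | loopTrue _ _ _ h₁ h₂ => rw [h₂ hm, h₁ (by simpa [Cmd.keeps] using hm)]
  | loopFalse => rfl

theorem arr_eq_of_keepsA {c : Cmd} {s s' : St} {k a : ℕ} (h : Ex L c s k s') (hm : c.keepsA a) :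
    s'.arr a = s.arr a := by
  induction h with
  | skip => rfl
  | op o s _ =>
    cases o <;> simp [Cmd.keepsA, Op.keepsA] at hm <;> simp [Op.run]
    rw [St.setA_arr_ne _ _ _ _ _ (Ne.symm hm)]
  | seq _ _ h₁ h₂ =>
    simp [Cmd.keepsA] at hm; rw [h₂ hm.2, h₁ hm.1]
  | iteTrue _ _ h₁ => simp [Cmd.keepsA] at hm; rw [h₁ hm.1]
  | iteFalse _ _ h₁ => simp [Cmd.keepsA] at hm; rw [h₁ hm.2]
  | loopTrue _ _ _ h₁ h₂ => rw [h₂ hm, h₁ (by simpa [Cmd.keepsA] using hm)]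
  | loopFalse => rfl

end Ex

/-- Total correctness with time: started in `s`, the program `c` takes some number `k` of steps and
ends in some state `s'`, such that `Q k s'` holds. -/
def Tri (L : Lim) (c : Cmd) (s : St) (Q : ℕ → St → Prop) : Prop :=
  ∃ k s', Ex L c s k s' ∧ Q k s'

namespace Tri

variable {L : Lim} {s : St} {Q Q' : ℕ → St → Prop}

theorem mono {c : Cmd} (h : Tri L c s Q) (hQ : ∀ k s', Q k s' → Q' k s') : Tri L c s Q' := by
  obtain ⟨k, s', h, hq⟩ := h
  exact ⟨k, s', h, hQ k s' hq⟩

/-- The consequence rule, with the information about what the program does not change. The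
hypotheses `c.regLt m`, `c.keeps r` and `c.keepsA a` hold by computation. -/
theorem mono_frame {c : Cmd} (m : ℕ) (hm : c.regLt m) (h : Tri L c s Q)
    (hQ : ∀ k s', (∀ r, m ≤ r → s'.reg r = s.reg r) → (∀ r, c.keeps r → s'.reg r = s.reg r) →
      (∀ a, c.keepsA a → s'.arr a = s.arr a) → Q k s' → Q' k s') : Tri L c s Q' := by
  obtain ⟨k, s', h, hq⟩ := h
  exact ⟨k, s', h, hQ k s' (fun r hr => h.reg_eq_of_regLt hm hr) (fun r hr => h.reg_eq_of_keeps hr)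
    (fun a ha => h.arr_eq_of_keepsA ha) hq⟩

@[simp] theorem skip_iff : Tri L .skip s Q ↔ Q 0 s := by
  constructor
  · rintro ⟨k, s', h, hq⟩; cases h; exact hq
  · intro h; exact ⟨0, s, .skip s, h⟩

@[simp] theorem op_iff {o : Op} : Tri L (.op o) s Q ↔ o.ok L s ∧ Q o.cost (o.run s) := by
  constructor
  · rintro ⟨k, s', h, hq⟩
    cases h with
    | op _ _ h => exact ⟨h, hq⟩
  · rintro ⟨h, hq⟩; exact ⟨_, _, .op o s h, hq⟩

@[simp] theorem seq_iff {c₁ c₂ : Cmd} : Tri L (.seq c₁ c₂) s Q ↔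
    Tri L c₁ s fun k₁ s₁ => Tri L c₂ s₁ fun k₂ s₂ => Q (k₁ + k₂) s₂ := by
  constructor
  · rintro ⟨k, s', h, hq⟩
    cases h with
    | seq h₁ h₂ => exact ⟨_, _, h₁, _, _, h₂, hq⟩
  · rintro ⟨_, _, h₁, _, _, h₂, hq⟩; exact ⟨_, _, .seq h₁ h₂, hq⟩

theorem ite_iff {a b : ℕ} {c₁ c₂ : Cmd} : Tri L (.ite a b c₁ c₂) s Q ↔
    if s.reg a < s.reg b then Tri L c₁ s fun k s' => Q (k + 1) s'
    else Tri L c₂ s fun k s' => Q (k + 2) s' := by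
  constructor
  · rintro ⟨k, s', h, hq⟩
    cases h with
    | iteTrue h h₁ => rw [if_pos h]; exact ⟨_, _, h₁, hq⟩
    | iteFalse h h₁ => rw [if_neg h]; exact ⟨_, _, h₁, hq⟩
  · intro h
    split_ifs at h with hc
    · obtain ⟨_, _, h₁, hq⟩ := h; exact ⟨_, _, .iteTrue hc h₁, hq⟩
    · obtain ⟨_, _, h₁, hq⟩ := h; exact ⟨_, _, .iteFalse hc h₁, hq⟩

theorem loop_true {a b : ℕ} {c : Cmd} (hc : s.reg a < s.reg b)
    (h : Tri L c s fun k₁ s₁ => Tri L (.loop a b c) s₁ fun k₂ s₂ => Q (k₁ + k₂ + 2) s₂) :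
    Tri L (.loop a b c) s Q := by
  obtain ⟨_, _, h₁, _, _, h₂, hq⟩ := h
  exact ⟨_, _, .loopTrue hc h₁ h₂, hq⟩

theorem loop_false {a b : ℕ} {c : Cmd} (hc : ¬ s.reg a < s.reg b) (h : Q 2 s) :
    Tri L (.loop a b c) s Q :=
  ⟨_, _, .loopFalse hc, h⟩

end Tri

/-! ### Correctness of the compilation -/

/-- The RAM state `rs` represents `s`: the array `k` starts at the address `k * M`. -/
structure Sim {w : ℕ} (M kx : ℕ) (rs : RAMState w) (s : St) : Prop where
  reg : ∀ r, (rs.reg (r + 20)).toNat = s.reg r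
  base : ∀ k < kx, (rs.reg (k + 1)).toNat = k * M
  mem : ∀ k < kx, ∀ i < M, (rs.mem (BitVec.ofNat w (k * M + i))).toNat = s.arr k i

/-- The code `l` is found at the address `o` of `P`. -/
def CodeAt (P : RAMProgram) (o : ℕ) (l : List RAMInstr) : Prop :=
  ∀ i (h : i < l.length), P[o + i]? = some l[i]

namespace CodeAt

variable {P : RAMProgram} {o : ℕ} {I : RAMInstr} {l l₁ l₂ : List RAMInstr}

theorem left (h : CodeAt P o (l₁ ++ l₂)) : CodeAt P o l₁ := fun i hi => by
  have := h i (by simp; omega)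
  rwa [List.getElem_append_left hi] at this

theorem right (h : CodeAt P o (l₁ ++ l₂)) : CodeAt P (o + l₁.length) l₂ := fun i hi => by
  have := h (l₁.length + i) (by simp; omega)
  simpa [List.getElem_append_right, Nat.add_assoc] using this

theorem head (h : CodeAt P o (I :: l)) : P[o]? = some I := by
  have := h 0 (by simp)
  simpa only [Nat.add_zero, List.getElem_cons_zero] using this

theorem tail (h : CodeAt P o (I :: l)) : CodeAt P (o + 1) l := fun i hi => by
  have := h (i + 1) (by simp; omega)
  simpa [Nat.add_assoc, Nat.add_comm 1 i] using this

end CodeAt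

namespace RAMState

variable {w : ℕ} {P : RAMProgram}

theorem step_of_eq {rs : RAMState w} {o : ℕ} {I : RAMInstr} (hpc : rs.pc = o)
    (h : P[o]? = some I) : step P rs = rs.exec I := by
  simp [step, hpc, h]

end RAMState

/-- Distinct array cells have distinct addresses. -/
theorem addr_eq_iff {w M kx k k' i i' : ℕ} (hW : kx * M ≤ 2 ^ w) (hk : k < kx) (hk' : k' < kx)
    (hi : i < M) (hi' : i' < M) :
    BitVec.ofNat w (k * M + i) = BitVec.ofNat w (k' * M + i') ↔ k = k' ∧ i = i' := by
  have h1 : ∀ k i, k < kx → i < M → k * M + i < 2 ^ w := fun k i hk hi => by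
    have : (k + 1) * M ≤ kx * M := Nat.mul_le_mul_right _ hk
    rw [Nat.succ_mul] at this; omega
  constructor
  · intro h
    have := congrArg BitVec.toNat h
    simp only [BitVec.toNat_ofNat, Nat.mod_eq_of_lt (h1 k i hk hi),
      Nat.mod_eq_of_lt (h1 k' i' hk' hi')] at this
    have hk : k = k' := by
      have h2 := congrArg (· / M) this
      simp only [Nat.mul_comm _ M, Nat.mul_add_div (show 0 < M by omega), Nat.div_eq_of_lt hi,
        Nat.div_eq_of_lt hi'] at h2
      omega
    subst hk
    exact ⟨rfl, by omega⟩
  · rintro ⟨rfl, rfl⟩; rfl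

theorem Op.simulates {w M kx : ℕ} (hW : kx * M ≤ 2 ^ w) (hkx : kx ≤ 18) {P : RAMProgram} {o : ℕ}
    (p : Op) {s : St} (hok : p.ok ⟨2 ^ w, M, kx⟩ s) {rs : RAMState w} (hpc : rs.pc = o)
    (hc : CodeAt P o p.comp) (hs : Sim M kx rs s) :
    ∃ rs', (RAMState.step P)^[p.cost] rs = rs' ∧ rs'.pc = o + p.cost ∧ Sim M kx rs' (p.run s) := by
  refine ⟨_, rfl, ?_⟩
  have hset : ∀ (rs : RAMState w) (_ : Sim M kx rs s) d (x : BitVec w) y, x.toNat = y →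
      Sim M kx (rs.setReg (d + 20) x) (s.set d y) := by
    intro rs hs d x y hxy
    refine ⟨fun r => ?_, fun k hk => ?_, fun k hk i hi => ?_⟩
    · by_cases h : r = d <;> simp [RAMState.setReg, h, hxy, hs.reg]
    · have : k ≠ d + 19 := by omega
      simp [RAMState.setReg, this, hs.base k hk]
    · simpa [RAMState.setReg] using hs.mem k hk i hi
  have haddr : ∀ k a, k < kx → s.reg a < M →
      rs.reg (k + 1) + rs.reg (a + 20) = BitVec.ofNat w (k * M + s.reg a) := by
    intro k a hk ha
    apply BitVec.eq_of_toNat_eq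
    simp [hs.base k hk, hs.reg]
  have haux : ∀ x : BitVec w, Sim M kx (rs.setReg 19 x) s := fun x =>
    ⟨fun r => by simp [RAMState.setReg, hs.reg],
      fun k hk => by
        have : k ≠ 18 := by omega
        simp [RAMState.setReg, this, hs.base k hk],
      fun k hk i hi => by simpa [RAMState.setReg] using hs.mem k hk i hi⟩
  cases p with
  | const d c =>
    have h1 := RAMState.step_of_eq hpc hc.head
    simp only [Op.cost, Function.iterate_one, h1, RAMState.exec]
    refine ⟨by simp [RAMState.setReg, hpc], hset _ hs _ _ _ ?_⟩
    simpa using Nat.mod_eq_of_lt hok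
  | move d a =>
    have h1 := RAMState.step_of_eq hpc hc.head
    simp only [Op.cost, Function.iterate_one, h1, RAMState.exec]
    exact ⟨by simp [RAMState.setReg, hpc], hset _ hs _ _ _ (hs.reg _)⟩
  | ld d k a =>
    have h1 := RAMState.step_of_eq hpc hc.head
    simp only [RAMState.exec] at h1
    have h2 : RAMState.step P (rs.setReg 19 (rs.reg (k + 1) + rs.reg (a + 20))) = _ :=
      RAMState.step_of_eq (by simp [RAMState.setReg, hpc]) hc.tail.head
    simp only [Op.cost, Function.iterate_succ, Function.iterate_zero, Function.comp_apply, h1, h2,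
      RAMState.exec, id]
    refine ⟨by simp [RAMState.setReg, hpc], hset _ (haux _) _ _ _ ?_⟩
    simp only [RAMState.setReg, Function.update_self]
    rw [haddr k a hok.1 hok.2, hs.mem k hok.1 _ hok.2]
  | st k d a =>
    have h1 := RAMState.step_of_eq hpc hc.head
    simp only [RAMState.exec] at h1
    have h2 : RAMState.step P (rs.setReg 19 (rs.reg (k + 1) + rs.reg (d + 20))) = _ :=
      RAMState.step_of_eq (by simp [RAMState.setReg, hpc]) hc.tail.head
    simp only [Op.cost, Function.iterate_succ, Function.iterate_zero, Function.comp_apply, h1, h2,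
      RAMState.exec, id]
    refine ⟨by simp [RAMState.setReg, hpc], fun r => ?_, fun k' hk' => ?_, fun k' hk' i hi => ?_⟩
    · exact (haux (rs.reg (k + 1) + rs.reg (d + 20))).reg r
    · exact (haux (rs.reg (k + 1) + rs.reg (d + 20))).base k' hk'
    · simp only [RAMState.setReg, Function.update_self]
      rw [haddr k d hok.1 hok.2]
      simp only [Function.update_apply, addr_eq_iff hW hk' hok.1 hi hok.2, Op.run, St.setA_arr]
      have : a + 20 ≠ 19 := by omega
      split_ifs <;> simp [hs.reg, hs.mem k' hk' i hi]
  | add d a b =>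
    have h1 := RAMState.step_of_eq hpc hc.head
    simp only [Op.cost, Function.iterate_one, h1, RAMState.exec]
    refine ⟨by simp [RAMState.setReg, hpc], hset _ hs _ _ _ ?_⟩
    rw [BitVec.toNat_add, hs.reg, hs.reg, Nat.mod_eq_of_lt hok]
  | sub d a b =>
    have h1 := RAMState.step_of_eq hpc hc.head
    simp only [Op.cost, Function.iterate_one, h1, RAMState.exec]
    refine ⟨by simp [RAMState.setReg, hpc], hset _ hs _ _ _ ?_⟩
    have hb := (rs.reg (a + 20)).isLt
    have hle : s.reg b ≤ s.reg a := hok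
    rw [BitVec.toNat_sub, hs.reg, hs.reg]
    rw [hs.reg] at hb
    rw [show 2 ^ w - s.reg b + s.reg a = (s.reg a - s.reg b) + 2 ^ w by omega, Nat.add_mod_right,
      Nat.mod_eq_of_lt (by omega)]
  | div d a b =>
    have h1 := RAMState.step_of_eq hpc hc.head
    simp only [Op.cost, Function.iterate_one, h1, RAMState.exec]
    refine ⟨by simp [RAMState.setReg, hpc], hset _ hs _ _ _ ?_⟩
    rw [BitVec.toNat_udiv, hs.reg, hs.reg]

theorem Sim.of_pc {w M kx : ℕ} {rs : RAMState w} {s : St} (h : Sim M kx rs s) (pc : ℕ) :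
    Sim M kx { rs with pc := pc } s :=
  ⟨h.reg, h.base, h.mem⟩

/-- The compiled program simulates the structured program step by step. -/
theorem Ex.simulates {w M kx : ℕ} (hW : kx * M ≤ 2 ^ w) (hkx : kx ≤ 18) {P : RAMProgram} {c : Cmd}
    {s s' : St} {k : ℕ} (h : Ex ⟨2 ^ w, M, kx⟩ c s k s') {o : ℕ} {rs : RAMState w}
    (hpc : rs.pc = o) (hc : CodeAt P o (c.comp o)) (hs : Sim M kx rs s) :
    ∃ rs', (RAMState.step P)^[k] rs = rs' ∧ rs'.pc = o + c.len ∧ Sim M kx rs' s' := by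
  induction h generalizing o rs with
  | skip s => exact ⟨rs, rfl, hpc, hs⟩
  | op p s hok => exact p.simulates hW hkx hok hpc hc hs
  | @seq c₁ c₂ _ _ _ k₁ k₂ _ _ ih₁ ih₂ =>
    obtain ⟨rs₁, h₁, hp₁, hs₁⟩ := ih₁ hpc hc.left hs
    have hr := hc.right
    rw [Cmd.length_comp] at hr
    obtain ⟨rs₂, h₂, hp₂, hs₂⟩ := ih₂ hp₁ hr hs₁
    refine ⟨rs₂, ?_, by simp [hp₂, Cmd.len, Nat.add_assoc], hs₂⟩
    rw [Nat.add_comm, Function.iterate_add_apply, h₁, h₂]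
  | @iteTrue a b c₁ c₂ s s' k hlt _ ih =>
    have h1 := RAMState.step_of_eq hpc hc.head
    simp only [RAMState.exec, hs.reg, if_pos hlt] at h1
    have hr := hc.tail.right.tail
    rw [Cmd.length_comp, show o + 1 + c₂.len + 1 = o + c₂.len + 2 by omega] at hr
    obtain ⟨rs', h', hp', hs'⟩ := ih (rs := { rs with pc := o + c₂.len + 2 }) rfl hr (hs.of_pc _)
    refine ⟨rs', ?_, by simp only [hp', Cmd.len]; omega, hs'⟩
    rw [Function.iterate_succ_apply, h1, h']
  | @iteFalse a b c₁ c₂ s s' k hlt _ ih =>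
    have h1 := RAMState.step_of_eq hpc hc.head
    simp only [RAMState.exec, hs.reg, if_neg hlt] at h1
    obtain ⟨rs', h', hp', hs'⟩ := ih (rs := { rs with pc := rs.pc + 1 }) (by simp [hpc])
      hc.tail.left (hs.of_pc _)
    have hr := hc.tail.right.head
    rw [Cmd.length_comp] at hr
    have h2 := RAMState.step_of_eq hp' hr
    refine ⟨{ rs' with pc := o + c₂.len + 2 + c₁.len }, ?_, by simp only [Cmd.len]; omega,
      hs'.of_pc _⟩
    rw [show k + 2 = 1 + (k + 1) by omega, Function.iterate_add_apply,
      Function.iterate_succ_apply (n := k), h1, h', Function.iterate_one, h2]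
    rfl
  | @loopTrue a b c s s₁ s₂ k₁ k₂ hlt _ _ ih₁ ih₂ =>
    have h1 := RAMState.step_of_eq hpc hc.head
    simp only [RAMState.exec, hs.reg, if_pos hlt] at h1
    have hb : CodeAt P (o + 2) (c.comp (o + 2) ++ [.jump o]) := hc.tail.tail
    obtain ⟨rs', h', hp', hs'⟩ := ih₁ (rs := { rs with pc := o + 2 }) rfl hb.left (hs.of_pc _)
    have hr := hb.right.head
    rw [Cmd.length_comp] at hr
    have h2 := RAMState.step_of_eq hp' hr
    obtain ⟨rs'', h'', hp'', hs''⟩ := ih₂ (rs := { rs' with pc := o }) rfl hc (hs'.of_pc _)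
    refine ⟨rs'', ?_, hp'', hs''⟩
    rw [show k₁ + k₂ + 2 = k₂ + (1 + (k₁ + 1)) by omega, Function.iterate_add_apply,
      Function.iterate_add_apply (m := 1), Function.iterate_succ_apply (n := k₁), h1, h',
      Function.iterate_one, h2]
    exact h''
  | @loopFalse a b c s hlt =>
    have h1 := RAMState.step_of_eq hpc hc.head
    simp only [RAMState.exec, hs.reg, if_neg hlt] at h1
    have hr := hc.tail.head
    have h2 : RAMState.step P { rs with pc := rs.pc + 1 } = _ :=
      RAMState.step_of_eq (by simp [hpc]) hr
    refine ⟨{ rs with pc := o + c.len + 3 }, ?_, by simp only [Cmd.len]; omega, hs.of_pc _⟩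
    rw [show (2 : ℕ) = 1 + 1 from rfl, Function.iterate_add_apply, Function.iterate_one, h1, h2]
    rfl


/-! ### The balance ratio and its exact approximation -/

/-- The ratio `1 + √2` between the weights of siblings that is tolerated. -/
noncomputable def rho : ℝ := 1 + Real.sqrt 2

theorem rho_sq : rho * rho = 2 * rho + 1 := by
  have h := Real.mul_self_sqrt (show (0 : ℝ) ≤ 2 by norm_num)
  unfold rho; nlinarith

theorem rho_gt : 2.414 < rho := by
  have : (1.414 : ℝ) < Real.sqrt 2 := by
    apply Real.lt_sqrt_of_sq_lt; norm_num
  unfold rho; linarith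

theorem rho_lt : rho < 2.415 := by
  have : Real.sqrt 2 < (1.415 : ℝ) := by
    rw [Real.sqrt_lt' (by norm_num)]; norm_num
  unfold rho; linarith

/-- If `P / q` is an upper Pell approximation of `1 + √2`, then `⌊x P / q⌋ = ⌊(1 + √2) x⌋` as long
as `x < q`: an integer `y` strictly between the two bounds would give a better approximation. -/
theorem rho_mul_lt_iff {P q x y g f : ℕ} (hP : P * P = 2 * P * q + q * q + 1) (hx : x < q)
    (hg : g * q + f = x * P) (hf : f < q) : g < y ↔ rho * x < y := by
  have hq0 : 0 < q := by omega
  have hPq : q < P := by nlinarith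
  have h1 : g < y ↔ x * P < y * q := by
    constructor
    · intro h
      have : (g + 1) * q ≤ y * q := Nat.mul_le_mul_right _ h
      nlinarith
    · intro h
      by_contra h'
      have : y * q ≤ g * q := Nat.mul_le_mul_right _ (by omega)
      omega
  rw [h1]
  have hρ := rho_gt
  have hPr : (P : ℝ) * P = 2 * P * q + q * q + 1 := by exact_mod_cast hP
  have hq0' : (0 : ℝ) < q := by exact_mod_cast hq0
  have hPρ : rho * q < P := by
    by_contra h
    push Not at h
    have hPq' : (q : ℝ) < P := by exact_mod_cast hPq
    nlinarith [rho_sq, mul_nonneg (sub_nonneg.2 h) (show (0 : ℝ) ≤ P + (rho - 2) * q by nlinarith)]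
  constructor
  · intro h
    have h' : (x : ℝ) * P < y * q := by exact_mod_cast h
    have hx0 : (0 : ℝ) ≤ x := by positivity
    have : rho * x * q < y * q := by nlinarith
    exact lt_of_mul_lt_mul_right this hq0'.le
  · intro h
    by_contra h'
    push Not at h'
    have hx0 : (0 : ℝ) ≤ x := by positivity
    have hxy : (x : ℝ) ≤ y := by nlinarith
    have hgt : x * x + 2 * x * y + 1 ≤ y * y := by
      have : (x : ℝ) * x + 2 * x * y < y * y := by
        nlinarith [rho_sq, mul_pos (sub_pos.2 h) (show (0 : ℝ) < y + (rho - 2) * x by nlinarith)]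
      exact_mod_cast this
    -- with `u = y / x ≤ P / q`: `u² - 2u - 1` is at most `1 / q²`, but at least `1 / x²`
    have hxy' : x ≤ y := by exact_mod_cast hxy
    zify at *
    have e1 : (y * q - x * q) * (y * q - x * q) ≤ (x * P - x * q) * ((x * P - x * q) : ℤ) := by
      have : (0 : ℤ) ≤ y * q - x * q := by nlinarith
      nlinarith
    have e2 : (x : ℤ) * x < q * q := by nlinarith
    nlinarith [mul_le_mul_of_nonneg_right hgt (show (0 : ℤ) ≤ q * q by positivity)]

/-! ### Balanced trees -/

/-- Derivation trees: binary trees with letters at the leaves. -/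
inductive Tr where
  | leaf (a : ℕ)
  | node (l r : Tr)

namespace Tr

def size : Tr → ℕ
  | leaf _ => 1
  | node l r => l.size + r.size

def toList : Tr → List ℕ
  | leaf a => [a]
  | node l r => l.toList ++ r.toList

theorem length_toList (T : Tr) : T.toList.length = T.size := by
  induction T with
  | leaf a => rfl
  | node l r hl hr => simp [toList, size, hl, hr]

theorem size_pos (T : Tr) : 0 < T.size := by
  induction T with
  | leaf a => simp [size]
  | node l r hl hr => simp [size]; omega

/-- Neither of two weights exceeds the other by a factor greater than `1 + √2`. -/
def Near (x y : ℕ) : Prop := (x : ℝ) ≤ rho * y ∧ (y : ℝ) ≤ rho * x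

theorem Near.symm {x y : ℕ} (h : Near x y) : Near y x := ⟨h.2, h.1⟩

theorem near_comm {x y : ℕ} : Near x y ↔ Near y x := ⟨.symm, .symm⟩

/-- All siblings have comparable weights. -/
def Bal : Tr → Prop
  | leaf _ => True
  | node l r => l.Bal ∧ r.Bal ∧ Near l.size r.size

/-- A node whose first child is on the left if `d` holds, and on the right otherwise. -/
def nd (d : Bool) (x y : Tr) : Tr := if d then node x y else node y x

/-- Concatenation in the order given by `d`. -/
def cat (d : Bool) (u v : List ℕ) : List ℕ := if d then u ++ v else v ++ u

theorem cat_assoc (d : Bool) (u v w : List ℕ) : cat d (cat d u v) w = cat d u (cat d v w) := by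
  cases d <;> simp [cat]

@[simp] theorem size_nd (d : Bool) (x y : Tr) : (nd d x y).size = x.size + y.size := by
  cases d <;> simp [nd, size, Nat.add_comm]

@[simp] theorem toList_nd (d : Bool) (x y : Tr) :
    (nd d x y).toList = cat d x.toList y.toList := by
  cases d <;> simp [nd, toList, cat]

theorem bal_nd {d : Bool} {x y : Tr} :
    (nd d x y).Bal ↔ x.Bal ∧ y.Bal ∧ Near x.size y.size := by
  cases d <;> simp [nd, Bal, near_comm (x := y.size)]
  tauto

theorem exists_eq_nd (d : Bool) {T : Tr} (h : 1 < T.size) : ∃ x y, T = nd d x y := by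
  cases T with
  | leaf a => simp [size] at h
  | node l r => cases d; exacts [⟨r, l, rfl⟩, ⟨l, r, rfl⟩]

end Tr

open Tr

/-! ### Rotations -/

section Rotations

variable {L X Y X₁ X₂ : ℕ}

/-- No rotation is needed. -/
theorem near_of_le (h1 : (L : ℝ) ≤ rho * X) (h : ¬ rho * L < X) : Near L X :=
  ⟨h1, not_lt.1 h⟩

/-- The case of a single rotation, from `L (X Y)` to `(L X) Y`. -/
theorem near_single (hXY : Near X Y) (hT : rho * L < X + Y) (h1 : ¬ rho * L < X)
    (h2 : ¬ rho * Y < L + X) : Near L X ∧ Near (L + X) Y := by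
  have hρ := rho_gt
  have hs := rho_sq
  obtain ⟨ha, hb⟩ := hXY
  have hY : (0 : ℝ) ≤ Y := by positivity
  have hL0 : (0 : ℝ) ≤ L := by positivity
  push_cast [Near]
  refine ⟨⟨?_, not_lt.1 h1⟩, not_lt.1 h2, ?_⟩
  · nlinarith
  · nlinarith

/-- The case of a double rotation. At `L = 1`, `X + Y = 1 + √2`, `X = √2` and `X₁ = √2 - 1` the
inequalities are tight: no larger balance parameter is possible here. -/
theorem near_double (hL : 0 < L) (hXY : Near (X₁ + X₂) Y) (hX : Near X₁ X₂)
    (hT : rho * L < X₁ + X₂ + Y) (hT' : ((X₁ + X₂ + Y : ℕ) : ℝ) ≤ (2 * rho - 1) * L)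
    (h : rho * L < X₁ + X₂ ∨ rho * Y < L + (X₁ + X₂)) :
    Near L X₁ ∧ Near X₂ Y ∧ Near (L + X₁) (X₂ + Y) := by
  have hρ := rho_gt
  have hρ' := rho_lt
  have hs := rho_sq
  obtain ⟨ha, hb⟩ := hXY
  obtain ⟨hc, hd⟩ := hX
  push_cast [Near] at *
  have hL0 : (0 : ℝ) < L := by exact_mod_cast hL
  generalize (L : ℝ) = l at *
  generalize (X₁ : ℝ) = a at *
  generalize (X₂ : ℝ) = b at *
  generalize (Y : ℝ) = y at *
  have hr0 : 0 < rho := by linarith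
  have hr2 : 0 < rho - 2 := by linarith
  have a0 : 0 < a := by nlinarith
  have b0 : 0 < b := by nlinarith
  have y0 : 0 < y := by nlinarith
  -- all inequalities are linear over `ℚ[rho]`; each may be multiplied by `rho` and `rho - 2 > 0`
  have up : ∀ {u v : ℝ}, u < v → rho * u < rho * v ∧ (rho - 2) * u < (rho - 2) * v := fun h =>
    ⟨mul_lt_mul_of_pos_left h hr0, mul_lt_mul_of_pos_left h hr2⟩
  have up' : ∀ {u v : ℝ}, u ≤ v → rho * u ≤ rho * v ∧ (rho - 2) * u ≤ (rho - 2) * v := fun h =>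
    ⟨mul_le_mul_of_nonneg_left h hr0.le, mul_le_mul_of_nonneg_left h hr2.le⟩
  have hl := up (mul_pos hr2 hL0)
  have h1 := up hT
  have h2 := up' hT'
  have h3 := up' ha
  have h4 := up' hb
  have h5 := up' hc
  have h6 := up' hd
  have sq : ∀ x : ℝ, rho * (rho * x) = 2 * (rho * x) + x := fun x => by
    rw [← mul_assoc, hs]; ring
  have key : ∀ u v : ℝ, (v < u → False) → u ≤ v := fun u v h => not_lt.1 h
  have hl2 := mul_lt_mul_of_pos_right hρ hL0
  have ha2 := mul_lt_mul_of_pos_right hρ a0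
  have hb2 := mul_lt_mul_of_pos_right hρ b0
  have hy2 := mul_lt_mul_of_pos_right hρ y0
  have hl3 := mul_lt_mul_of_pos_right hρ' hL0
  have ha3 := mul_lt_mul_of_pos_right hρ' a0
  have hb3 := mul_lt_mul_of_pos_right hρ' b0
  have hy3 := mul_lt_mul_of_pos_right hρ' y0
  rcases h with h | h <;>
  · have h7 := up h
    refine ⟨⟨?_, ?_⟩, ⟨?_, ?_⟩, ?_, ?_⟩ <;>
    · refine key _ _ fun hn => ?_
      have h8 := up hn
      simp only [mul_add, sub_mul, mul_sub, sq, mul_assoc, mul_left_comm rho 2, one_mul] at *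
      clear sq
      generalize rho * l = l' at *
      generalize rho * a = a' at *
      generalize rho * b = b' at *
      generalize rho * y = y' at *
      linarith

end Rotations

/-! ### The logarithmic potential -/

/-- The integer part of `log x` to the base `√2`. A child in a balanced tree is lighter than its
parent by a factor of at least `√2`, and so has a smaller potential. -/
def ell (x : ℕ) : ℕ := Nat.log 2 (x ^ 2)

theorem ell_mono {x y : ℕ} (h : x ≤ y) : ell x ≤ ell y :=
  Nat.log_mono_right (Nat.pow_le_pow_left h 2)

theorem ell_lt_of_sq {x y : ℕ} (hx : 0 < x) (h : 2 * x ^ 2 ≤ y ^ 2) : ell x + 1 ≤ ell y := by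
  have h1 : Nat.log 2 (x ^ 2 * 2) = Nat.log 2 (x ^ 2) + 1 :=
    Nat.log_mul_base (by norm_num) (by positivity)
  rw [ell, ell, ← h1]
  exact Nat.log_mono_right (by omega)

/-- A child in a balanced tree has a smaller potential than its parent, since
`y ≤ (1 + √2) x` means that `√2 y ≤ x + y`. -/
theorem ell_child {x y : ℕ} (hy : 0 < y) (h : (y : ℝ) ≤ rho * x) : ell y + 1 ≤ ell (x + y) := by
  apply ell_lt_of_sq hy
  have hρ := rho_gt
  have hs := rho_sq
  have hx0 : (0 : ℝ) ≤ x := by positivity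
  have hy0 : (0 : ℝ) ≤ y := by positivity
  have h1 : (rho - 1) * y ≤ x + y := by nlinarith
  have h2 : (2 : ℝ) * y ^ 2 ≤ (x + y) ^ 2 := by
    have h3 : ((rho - 1) * y) * ((rho - 1) * y) ≤ ((x : ℝ) + y) * (x + y) :=
      mul_self_le_mul_self (by nlinarith) h1
    have h4 : ((rho - 1) * y) * ((rho - 1) * y) = 2 * (y : ℝ) ^ 2 := by
      linear_combination (y : ℝ) ^ 2 * hs
    nlinarith
  exact_mod_cast h2

theorem ell_of_rho_mul_lt {x y : ℕ} (hx : 0 < x) (h : rho * x < y) : ell x + 1 ≤ ell y := by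
  have hρ := rho_gt
  have hx0 : (0 : ℝ) < x := by exact_mod_cast hx
  have h1 : 2 * x < y := by
    have : (2 : ℝ) * x < y := by nlinarith
    exact_mod_cast this
  exact ell_lt_of_sq hx (by nlinarith)


/-! ### The heap of nonterminals -/

/-!
Arrays: `0` the input, `1` the output, `2` a stack, `3` and `4` the table of blocks, and from `5` to
`9` the data of the nonterminals.

Registers: `0` the number of nonterminals, `1` the length of the output, `2` the height of the stack,
from `10` new nonterminals, from `20` rotations, from `30` joining, from `40` splitting, from `50`
extraction, from `60` copying, from `70` the parse, from `80` joining the blocks, from `91` padding,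
and from `100` constants. Apart from the registers `0`, `1`, `2`, and the data `70`, `71` of the table
of blocks, a program only writes registers of its own range and of lower ranges.
-/

/-- The numbers that are fixed during the construction: the word bound `W`, the capacity `M` of each
of the ten arrays, and a Pell approximation `P / q` of `1 + √2`. -/
structure Cx where
  W : ℕ
  M : ℕ
  q : ℕ
  P : ℕ
  pell : P * P = 2 * P * q + q * q + 1
  le_P : 2 * q ≤ P
  P_lt : P < 3 * q
  hq : 8 * q ≤ W
  hM : 8 * M ≤ W

def Cx.lim (cx : Cx) : Lim := ⟨cx.W, cx.M, 10⟩

@[simp] theorem Cx.lim_W (cx : Cx) : cx.lim.W = cx.W := rfl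
@[simp] theorem Cx.lim_M (cx : Cx) : cx.lim.M = cx.M := rfl
@[simp] theorem Cx.lim_kx (cx : Cx) : cx.lim.kx = 10 := rfl

/-- The cells of the nonterminal `i` with derivation tree `T`, where `H` lists the derivation trees
of all nonterminals: array `1` holds the production, array `5` the length `x` of the derived string,
arrays `6` and `7` the quotient and remainder of `x P` by `q`, and arrays `8` and `9` the
children. -/
structure HCell (cx : Cx) (H : List Tr) (arr : ℕ → ℕ → ℕ) (i : ℕ) (T : Tr) : Prop where
  bal : T.Bal
  size_lt : T.size < cx.q
  size : arr 5 i = T.size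
  quo : arr 6 i * cx.q + arr 7 i = T.size * cx.P
  rem : arr 7 i < cx.q
  leaf : ∀ a, T = .leaf a → arr 1 (3 * i) = 0 ∧ arr 1 (3 * i + 1) = a
  node : ∀ l r, T = .node l r → arr 1 (3 * i) = 1 ∧ arr 1 (3 * i + 1) = arr 8 i ∧
    arr 1 (3 * i + 2) = arr 9 i ∧ arr 8 i < i ∧ arr 9 i < i ∧
    H[arr 8 i]? = some l ∧ H[arr 9 i]? = some r

/-- The state holds the nonterminals with derivation trees `H`. Register `0` is their number. -/
structure HInv (cx : Cx) (H : List Tr) (s : St) : Prop where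
  cnt : s.reg 0 = H.length
  out : s.reg 1 = 3 * H.length
  one : s.reg 100 = 1
  q : s.reg 101 = cx.q
  f : s.reg 102 = cx.P - 2 * cx.q
  two : s.reg 103 = 2
  zero : s.reg 107 = 0
  cell : ∀ i T, H[i]? = some T → HCell cx H s.arr i T

theorem getElem?_of_prefix {α : Type*} {l l' : List α} {i : ℕ} {x : α} (h : l <+: l')
    (hi : l[i]? = some x) : l'[i]? = some x := by
  obtain ⟨m, rfl⟩ := h
  rw [List.getElem?_append_left (List.getElem?_eq_some_iff.1 hi).1, hi]

namespace HInv

variable {cx : Cx} {H : List Tr} {s s' : St} {i y : ℕ} {T : Tr}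

theorem congr (h : HInv cx H s)
    (hr : ∀ r ∈ [0, 1, 100, 101, 102, 103, 107], s'.reg r = s.reg r)
    (ha : ∀ a ∈ [1, 5, 6, 7, 8, 9], s'.arr a = s.arr a) : HInv cx H s' := by
  simp only [List.forall_mem_cons] at hr ha
  obtain ⟨h0, h1, h2, h3, h4, h5, h6, -⟩ := hr
  obtain ⟨a1, a5, a6, a7, a8, a9, -⟩ := ha
  refine ⟨by rw [h0, h.cnt], by rw [h1, h.out], by rw [h2, h.one], by rw [h3, h.q],
    by rw [h4, h.f], by rw [h5, h.two], by rw [h6, h.zero], fun i T hi => ?_⟩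
  obtain ⟨c1, c2, c3, c4, c5, c6, c7⟩ := h.cell i T hi
  exact ⟨c1, c2, by rw [a5, c3], by rw [a6, a7, c4], by rw [a7]; exact c5, by rwa [a1],
    by rwa [a1, a8, a9]⟩

theorem lt (h : HInv cx H s) (hi : H[i]? = some T) : i < s.reg 0 := by
  rw [h.cnt]; exact (List.getElem?_eq_some_iff.1 hi).1

theorem quo_le (h : HInv cx H s) (hi : H[i]? = some T) :
    s.arr 6 i ≤ 3 * T.size ∧ s.arr 6 i ≤ 3 * cx.q := by
  have c := h.cell i T hi
  have h1 := c.quo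
  have h2 : T.size * cx.P ≤ T.size * (3 * cx.q) := Nat.mul_le_mul_left _ cx.P_lt.le
  have h3 : s.arr 6 i ≤ 3 * T.size := by
    by_contra hlt
    have : (3 * T.size + 1) * cx.q ≤ s.arr 6 i * cx.q := Nat.mul_le_mul_right _ (by omega)
    have h0 : 0 < cx.q := lt_of_le_of_lt (Nat.zero_le _) c.size_lt
    nlinarith
  have := c.size_lt
  omega

/-- The test `(1 + √2) |X| < y` on the machine. -/
theorem quo_lt_iff (h : HInv cx H s) (hi : H[i]? = some T) :
    s.arr 6 i < y ↔ rho * T.size < y :=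
  let c := h.cell i T hi
  rho_mul_lt_iff cx.pell c.size_lt c.quo c.rem

/-- Adding a nonterminal. -/
theorem append (h : HInv cx H s) (h0 : s'.reg 0 = H.length + 1) (h1 : s'.reg 1 = 3 * H.length + 3)
    (hr : ∀ r ∈ [100, 101, 102, 103, 107], s'.reg r = s.reg r)
    (ha : ∀ a ∈ [5, 6, 7, 8, 9], ∀ i < H.length, s'.arr a i = s.arr a i)
    (ha1 : ∀ i < 3 * H.length, s'.arr 1 i = s.arr 1 i)
    (hc : HCell cx H s'.arr H.length T) : HInv cx (H ++ [T]) s' := by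
  simp only [List.forall_mem_cons] at hr ha
  obtain ⟨h2, h3, h4, h5, h6, -⟩ := hr
  obtain ⟨a5, a6, a7, a8, a9, -⟩ := ha
  have hpre : H <+: H ++ [T] := List.prefix_append _ _
  refine ⟨by rw [h0]; simp, by rw [h1]; simp [mul_add], by rw [h2, h.one], by rw [h3, h.q],
    by rw [h4, h.f], by rw [h5, h.two], by rw [h6, h.zero], fun i U hi => ?_⟩
  rcases lt_trichotomy i H.length with hlt | rfl | hgt
  · rw [List.getElem?_append_left hlt] at hi
    obtain ⟨c1, c2, c3, c4, c5, c6, c7⟩ := h.cell i U hi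
    refine ⟨c1, c2, by rw [a5 i hlt, c3], by rw [a6 i hlt, a7 i hlt, c4],
      by rw [a7 i hlt]; exact c5, fun a hU => ?_, fun l r hU => ?_⟩
    · rw [ha1 _ (by omega), ha1 _ (by omega)]; exact c6 a hU
    · rw [ha1 _ (by omega), ha1 _ (by omega), ha1 _ (by omega), a8 i hlt, a9 i hlt]
      obtain ⟨d1, d2, d3, d4, d5, d6, d7⟩ := c7 l r hU
      exact ⟨d1, d2, d3, d4, d5, getElem?_of_prefix hpre d6, getElem?_of_prefix hpre d7⟩
  · simp only [List.getElem?_concat_length, Option.some.injEq] at hi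
    subst hi
    obtain ⟨c1, c2, c3, c4, c5, c6, c7⟩ := hc
    refine ⟨c1, c2, c3, c4, c5, c6, fun l r hU => ?_⟩
    obtain ⟨d1, d2, d3, d4, d5, d6, d7⟩ := c7 l r hU
    exact ⟨d1, d2, d3, d4, d5, getElem?_of_prefix hpre d6, getElem?_of_prefix hpre d7⟩
  · rw [List.getElem?_eq_none (by simp; omega)] at hi
    cases hi

end HInv

/-- Appends the nonterminal `X_{R[10]} X_{R[11]}`; its index is returned in register `12`. -/
def newNode : Cmd :=
  .seq (Cmd.blk [.ld 13 5 10, .ld 14 5 11, .add 13 13 14, .st 5 0 13,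
    .ld 13 6 10, .ld 14 6 11, .add 13 13 14,
    .ld 14 7 10, .ld 15 7 11, .add 14 14 15])
  (.seq (.ite 14 101 .skip (Cmd.blk [.sub 14 14 101, .add 13 13 100]))
  (Cmd.blk [.st 6 0 13, .st 7 0 14, .st 8 0 10, .st 9 0 11,
    .st 1 1 100, .add 1 1 100, .st 1 1 10, .add 1 1 100, .st 1 1 11, .add 1 1 100,
    .move 12 0, .add 0 0 100]))

/-- Appends a nonterminal for the letter `R[10]`; its index is returned in register `12`. -/
def newLeaf : Cmd :=
  Cmd.blk [.st 5 0 100, .st 6 0 103, .st 7 0 102, .st 1 1 107, .add 1 1 100, .st 1 1 10,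
    .add 1 1 100, .add 1 1 100, .move 12 0, .add 0 0 100]

theorem newLeaf_spec {cx : Cx} {H : List Tr} {s : St} (hI : HInv cx H s)
    (hq : 1 < cx.q) (hcap : 3 * (H.length + 1) ≤ cx.M) :
    Tri cx.lim newLeaf s fun k s' =>
      HInv cx (H ++ [.leaf (s.reg 10)]) s' ∧ s'.reg 12 = H.length ∧ k ≤ 50 := by
  have := cx.hM
  have h1 := cx.le_P
  have h2 := cx.P_lt
  simp [newLeaf, Cmd.blk, Op.ok, Op.run, Op.cost, hI.cnt, hI.out, hI.one, hI.two, hI.f, hI.zero]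
  repeat' apply And.intro
  all_goals try omega
  refine hI.append (by simp) (by simp) (by simp) ?_ ?_ ?_
  · simp only [List.forall_mem_cons]
    simp +contextual [Nat.ne_of_lt]
  · intro i hi; simp; repeat rw [if_neg (by omega)]
  · refine ⟨trivial, hq, by simp [Tr.size], by simp [Tr.size]; omega, by simp; omega, ?_, by simp⟩
    intro a ha; cases ha; simp

theorem newNode_spec {cx : Cx} {H : List Tr} {s : St} {l r : Tr} (hI : HInv cx H s)
    (hl : H[s.reg 10]? = some l) (hr : H[s.reg 11]? = some r) (hn : Tr.Near l.size r.size)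
    (hq : l.size + r.size < cx.q) (hcap : 3 * (H.length + 1) ≤ cx.M) :
    Tri cx.lim newNode s fun k s' =>
      HInv cx (H ++ [.node l r]) s' ∧ s'.reg 12 = H.length ∧ k ≤ 50 := by
  have := cx.hM
  have := cx.hq
  have h1 := cx.le_P
  have h2 := cx.P_lt
  have cl := hI.cell _ _ hl
  have cr := hI.cell _ _ hr
  have ll := hI.lt hl
  have lr := hI.lt hr
  have gl := hI.quo_le hl
  have gr := hI.quo_le hr
  rw [hI.cnt] at ll lr
  have := cl.rem
  have := cr.rem
  have e1 := cl.quo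
  have e2 := cr.quo
  simp [newNode, Cmd.blk, Op.ok, Op.run, Op.cost, hI.cnt, hI.out, hI.one, hI.q, Tri.ite_iff,
    cl.size, cr.size]
  split_ifs with hc
  all_goals
    repeat' apply And.intro
    all_goals try omega
    refine hI.append (by simp) (by simp) (by simp) ?_ ?_ ?_
    · intro a ha i hi
      have hne := Nat.ne_of_lt hi
      simp only [List.mem_cons, List.not_mem_nil, or_false] at ha
      rcases ha with rfl | rfl | rfl | rfl | rfl <;> simp [hne]
    · intro i hi; simp; repeat rw [if_neg (by omega)]
    · refine ⟨⟨cl.bal, cr.bal, hn⟩, hq, by simp [Tr.size], ?_, by simp; omega, by simp, ?_⟩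
      · simp only [Tr.size, add_mul]; simp
        (try rw [add_mul, one_mul])
        rw [add_mul]; omega
      · intro l' r' he
        cases he
        simp; refine ⟨by omega, by omega, ?_⟩
        simp [hl, hr]; omega


/-- `s'` agrees with `s` on the registers from `m` on, on the stack pointer (register `2`), on the
stack (array `2`) and on the arrays `0`, `3`, `4`. -/
structure Fr (m : ℕ) (s s' : St) : Prop where
  reg : ∀ r, m ≤ r → s'.reg r = s.reg r
  sp : s'.reg 2 = s.reg 2
  stk : ∀ i < s.reg 2, s'.arr 2 i = s.arr 2 i
  arr : ∀ a ∈ [0, 3, 4], s'.arr a = s.arr a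

theorem Fr.trans {m : ℕ} {s s₁ s₂ : St} (h₁ : Fr m s s₁) (h₂ : Fr m s₁ s₂) : Fr m s s₂ :=
  ⟨fun r hr => (h₂.reg r hr).trans (h₁.reg r hr), h₂.sp.trans h₁.sp,
    fun i hi => (h₂.stk i (by rw [h₁.sp]; exact hi)).trans (h₁.stk i hi),
    fun a ha => (h₂.arr a ha).trans (h₁.arr a ha)⟩

theorem Fr.mono {m m' : ℕ} {s s' : St} (h : Fr m s s') (hm : m ≤ m') : Fr m' s s' :=
  ⟨fun r hr => h.reg r (hm.trans hr), h.sp, h.stk, h.arr⟩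

@[simp] theorem Fr.set_left_iff {m r x : ℕ} {s s' : St} (hm : r < m) (h2 : r ≠ 2) :
    Fr m (s.set r x) s' ↔ Fr m s s' := by
  have h : ∀ r', m ≤ r' → (s.set r x).reg r' = s.reg r' := fun r' hr' => by
    rw [St.set_reg, if_neg (by omega)]
  have h' : (s.set r x).reg 2 = s.reg 2 := by rw [St.set_reg, if_neg (Ne.symm h2)]
  constructor
  · rintro ⟨h1, h2, h3, h4⟩
    exact ⟨fun r hr => (h1 r hr).trans (h r hr), h2.trans h', fun i hi => h3 i (by rwa [h']), h4⟩
  · rintro ⟨h1, h2, h3, h4⟩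
    exact ⟨fun r hr => (h1 r hr).trans (h r hr).symm, h2.trans h'.symm,
      fun i hi => h3 i (by rwa [h'] at hi), h4⟩

/-- The common form of the postconditions: at most `D` nonterminals have been added in at most `t`
steps, and register `o` holds one whose derivation tree satisfies `p`. -/
def Made (cx : Cx) (m : ℕ) (s : St) (H : List Tr) (D t o : ℕ) (p : Tr → Prop) (k : ℕ) (s' : St) :
    Prop :=
  ∃ H' T, HInv cx H' s' ∧ H <+: H' ∧ H'[s'.reg o]? = some T ∧ p T ∧ H'.length ≤ H.length + D ∧
    k ≤ t ∧ Fr m s s'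

/-- Appends a nonterminal with the children `R[10]` and `R[11]`, where `R[10]` is the left one if
`d` holds. -/
def newD (d : Bool) : Cmd :=
  if d then newNode else .seq (Cmd.blk [.move 13 10, .move 10 11, .move 11 13]) newNode

theorem newD_spec {cx : Cx} {H : List Tr} {s : St} {x y : Tr} (d : Bool) (hI : HInv cx H s)
    (hx : H[s.reg 10]? = some x) (hy : H[s.reg 11]? = some y) (hn : Near x.size y.size)
    (hq : x.size + y.size < cx.q) (hcap : 3 * (H.length + 1) ≤ cx.M) :
    Tri cx.lim (newD d) s (Made cx 16 s H 1 60 12 (· = nd d x y)) := by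
  cases d with
  | true =>
    refine (newNode_spec hI hx hy hn hq hcap).mono_frame 16 rfl ?_
    rintro k s' h1 h2 h3 ⟨h4, h5, h6⟩
    refine ⟨_, .node x y, h4, List.prefix_append _ _, by simp [h5], rfl, by simp, by omega, h1,
      h2 2 rfl, fun i _ => by rw [h3 2 rfl], ?_⟩
    simp only [List.forall_mem_cons]
    exact ⟨h3 0 rfl, h3 3 rfl, h3 4 rfl, by simp⟩
  | false =>
    simp only [newD, Cmd.blk, Tri.seq_iff, Tri.op_iff, Tri.skip_iff, Op.ok, Op.run, Op.cost,
      true_and, Bool.false_eq_true, if_false]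
    refine (newNode_spec (hI.congr (by simp) (by simp)) (l := y) (r := x) (by simpa using hy)
      (by simpa using hx) hn.symm (by omega) hcap).mono_frame 16 rfl ?_
    rintro k s' h1 h2 h3 ⟨h4, h5, h6⟩
    refine ⟨_, .node y x, h4, List.prefix_append _ _, by simp [h5], rfl, by simp, by omega, ?_⟩
    refine ⟨fun r hr => ?_, h2 2 rfl, fun i _ => by rw [h3 2 rfl]; rfl, ?_⟩
    · rw [h1 r hr]
      simp only [St.set_reg]
      repeat rw [if_neg (by omega)]
    · simp only [List.forall_mem_cons]
      exact ⟨h3 0 rfl, h3 3 rfl, h3 4 rfl, by simp⟩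

/-! ### Joining two balanced trees -/

/-- The array of the far children: those on the left if `d` holds. -/
def farA (d : Bool) : ℕ := if d then 8 else 9

/-- The array of the near children. -/
def nearA (d : Bool) : ℕ := if d then 9 else 8

theorem HInv.children {cx : Cx} {H : List Tr} {s : St} {i : ℕ} {d : Bool} {x y : Tr}
    (hI : HInv cx H s) (hi : H[i]? = some (nd d x y)) :
    H[s.arr (farA d) i]? = some x ∧ H[s.arr (nearA d) i]? = some y ∧ x.Bal ∧ y.Bal ∧
      Near x.size y.size := by
  have c := hI.cell i _ hi
  obtain ⟨b1, b2, b3⟩ := bal_nd.1 c.bal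
  refine ⟨?_, ?_, b1, b2, b3⟩
  · cases d
    · exact (c.node _ _ rfl).2.2.2.2.2.2
    · exact (c.node _ _ rfl).2.2.2.2.2.1
  · cases d
    · exact (c.node _ _ rfl).2.2.2.2.2.1
    · exact (c.node _ _ rfl).2.2.2.2.2.2

/-- Double rotation, given `L`, `X`, `Y` in the registers `20`, `24`, `25`. -/
def rotDouble (d : Bool) : Cmd :=
  .seq (Cmd.blk [.ld 26 (farA d) 24, .ld 27 (nearA d) 24, .move 10 20, .move 11 26])
  (.seq (newD d)
  (.seq (Cmd.blk [.move 28 12, .move 10 27, .move 11 25])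
  (.seq (newD d)
  (.seq (Cmd.blk [.move 10 28, .move 11 12]) (newD d)))))

/-- Single rotation, given `L`, `X`, `Y` in the registers `20`, `24`, `25`. -/
def rotSingle (d : Bool) : Cmd :=
  .seq (Cmd.blk [.move 10 20, .move 11 24])
  (.seq (newD d)
  (.seq (Cmd.blk [.move 10 12, .move 11 25]) (newD d)))

/-- Combines the trees `L` in register `20` and `T` in register `21`, which may be too heavy by a
constant factor. -/
def rebal (d : Bool) : Cmd :=
  .seq (Cmd.blk [.ld 22 6 20, .ld 23 5 21])
  (.ite 22 23
    (.seq (Cmd.blk [.ld 24 (farA d) 21, .ld 25 (nearA d) 21, .ld 23 5 24, .ld 26 6 25, .ld 27 5 20,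
      .add 27 27 23])
    (.ite 22 23 (rotDouble d) (.ite 26 27 (rotDouble d) (rotSingle d))))
    (.seq (Cmd.blk [.move 10 20, .move 11 21]) (newD d)))

theorem HInv.lt_M {cx : Cx} {H : List Tr} {s : St} {i : ℕ} {T : Tr}
    (hI : HInv cx H s) (hi : H[i]? = some T) (hcap : 3 * H.length ≤ cx.M) : i < cx.M := by
  have := hI.lt hi
  rw [hI.cnt] at this; omega

theorem farA_lt (d : Bool) : farA d < 10 := by cases d <;> decide
theorem nearA_lt (d : Bool) : nearA d < 10 := by cases d <;> decide

theorem rotSingle_spec {cx : Cx} {H : List Tr} {s : St} {L X Y : Tr} (d : Bool) (hI : HInv cx H s)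
    (hL : H[s.reg 20]? = some L) (hX : H[s.reg 24]? = some X) (hY : H[s.reg 25]? = some Y)
    (h1 : Near L.size X.size) (h2 : Near (L.size + X.size) Y.size)
    (hq : L.size + X.size + Y.size < cx.q) (hcap : 3 * (H.length + 3) ≤ cx.M) :
    Tri cx.lim (rotSingle d) s
      (Made cx 30 s H 3 250 12 fun U => U.toList = cat d L.toList (cat d X.toList Y.toList)) := by
  simp only [rotSingle, Cmd.blk, Tri.seq_iff, Tri.op_iff, Tri.skip_iff, Op.ok, Op.run, Op.cost,
      true_and]
  refine (newD_spec d (hI.congr (by simp) (by simp)) (x := L) (y := X) (by simpa using hL)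
    (by simpa using hX) h1 (by omega) (by omega)).mono ?_
  rintro k s' ⟨H', T, i1, i2, i3, rfl, i4, i5, i6⟩
  have r25 : s'.reg 25 = s.reg 25 := by simpa using i6.reg 25 (by norm_num)
  refine (newD_spec d (i1.congr (by simp) (by simp)) (x := nd d L X) (y := Y) (by simpa using i3)
    (by simpa [r25] using getElem?_of_prefix i2 hY) (by simpa using h2) (by simpa using hq)
    (by omega)).mono ?_
  rintro k' s'' ⟨H'', T, j1, j2, j3, rfl, j4, j5, j6⟩
  have i6' : Fr 30 s s' := by simpa using i6.mono (m' := 30) (by norm_num)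
  have j6' : Fr 30 s' s'' := by simpa using j6.mono (m' := 30) (by norm_num)
  exact ⟨H'', _, j1, i2.trans j2, j3, by simp [cat_assoc], by omega, by omega, i6'.trans j6'⟩

theorem rotDouble_spec {cx : Cx} {H : List Tr} {s : St} {L X₁ X₂ Y : Tr} (d : Bool)
    (hI : HInv cx H s) (hL : H[s.reg 20]? = some L) (hX : H[s.reg 24]? = some (nd d X₁ X₂))
    (hY : H[s.reg 25]? = some Y) (h1 : Near L.size X₁.size) (h2 : Near X₂.size Y.size)
    (h3 : Near (L.size + X₁.size) (X₂.size + Y.size))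
    (hq : L.size + (X₁.size + X₂.size) + Y.size < cx.q) (hcap : 3 * (H.length + 3) ≤ cx.M) :
    Tri cx.lim (rotDouble d) s (Made cx 30 s H 3 250 12 fun U =>
      U.toList = cat d L.toList (cat d (nd d X₁ X₂).toList Y.toList)) := by
  obtain ⟨c1, c2, -⟩ := hI.children hX
  have b1 := hI.lt_M hX (by omega)
  have hf := farA_lt d
  have hn := nearA_lt d
  simp only [rotDouble, Cmd.blk, Tri.seq_iff, Tri.op_iff, Tri.skip_iff, Op.ok, Op.run, Op.cost,
    true_and, Cx.lim_kx, Cx.lim_M]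
  refine ⟨⟨hf, b1⟩, ⟨hn, by simpa using b1⟩, ?_⟩
  refine (newD_spec d (hI.congr (by simp) (by simp)) (x := L) (y := X₁) (by simpa using hL)
    (by simpa using c1) h1 (by omega) (by omega)).mono ?_
  rintro k s' ⟨H', T, i1, i2, i3, rfl, i4, i5, i6⟩
  have r25 : s'.reg 25 = s.reg 25 := by simpa using i6.reg 25 (by norm_num)
  have r27 : s'.reg 27 = s.arr (nearA d) (s.reg 24) := by simpa using i6.reg 27 (by norm_num)
  refine (newD_spec d (i1.congr (by simp) (by simp)) (x := X₂) (y := Y)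
    (by simpa [r27] using getElem?_of_prefix i2 c2)
    (by simpa [r25] using getElem?_of_prefix i2 hY) h2 (by omega) (by omega)).mono ?_
  rintro k' s'' ⟨H'', T, j1, j2, j3, rfl, j4, j5, j6⟩
  have r28 : s''.reg 28 = s'.reg 12 := by simpa using j6.reg 28 (by norm_num)
  refine (newD_spec d (j1.congr (by simp) (by simp)) (x := nd d L X₁) (y := nd d X₂ Y)
    (by simpa [r28] using getElem?_of_prefix j2 i3)
    (by simpa using j3) (by simpa using h3) (by simp; omega) (by omega)).mono ?_
  rintro k'' s''' ⟨H''', T, l1, l2, l3, rfl, l4, l5, l6⟩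
  have i6' : Fr 30 s s' := by simpa using i6.mono (m' := 30) (by norm_num)
  have j6' : Fr 30 s' s'' := by simpa using j6.mono (m' := 30) (by norm_num)
  have l6' : Fr 30 s'' s''' := by simpa using l6.mono (m' := 30) (by norm_num)
  exact ⟨H''', _, l1, (i2.trans j2).trans l2, l3, by simp [cat_assoc], by omega, by omega,
    (i6'.trans j6').trans l6'⟩

/-- At most three new nonterminals are needed if the weight of `T` is at most `2 (1 + √2) - 1` times
that of `L`. This is the most that can happen when a tree of weight at most `(L + r) / (1 + √2)`
has been inserted into a sibling of `L` of weight `r`. -/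
theorem rebal_spec {cx : Cx} {H : List Tr} {s : St} {L T : Tr} (d : Bool) (hI : HInv cx H s)
    (hL : H[s.reg 20]? = some L) (hT : H[s.reg 21]? = some T)
    (h1 : (L.size : ℝ) ≤ rho * T.size) (h2 : (T.size : ℝ) ≤ (2 * rho - 1) * L.size)
    (hq : L.size + T.size < cx.q) (hcap : 3 * (H.length + 3) ≤ cx.M) :
    Tri cx.lim (rebal d) s
      (Made cx 30 s H 3 300 12 fun U => U.toList = cat d L.toList T.toList) := by
  have bL := hI.lt_M hL (by omega)
  have bT := hI.lt_M hT (by omega)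
  have hf := farA_lt d
  have hn := nearA_lt d
  have hρ := rho_gt
  have hLp := L.size_pos
  have := cx.hq
  have eT := (hI.cell _ _ hT).size
  have eL := (hI.cell _ _ hL).size
  have tL := @HInv.quo_lt_iff (y := T.size) _ _ _ _ _ hI hL
  simp [rebal, Cmd.blk, Tri.seq_iff, Tri.op_iff, Tri.skip_iff, Op.ok, Op.run, Op.cost,
    Tri.ite_iff, Cx.lim_kx, Cx.lim_M, eT, tL, bT, bL]
  by_cases hc : rho * L.size < T.size
  · have h1T : 1 < T.size := by
      have : (1 : ℝ) < T.size := by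
        have : (1 : ℝ) ≤ L.size := by exact_mod_cast hLp
        nlinarith
      exact_mod_cast this
    obtain ⟨X, Y, rfl⟩ := exists_eq_nd d h1T
    obtain ⟨hX, hY, balX, -, hXY⟩ := hI.children hT
    have bX := hI.lt_M hX (by omega)
    have bY := hI.lt_M hY (by omega)
    have eX := (hI.cell _ _ hX).size
    have tL' := @HInv.quo_lt_iff (y := X.size) _ _ _ _ _ hI hL
    have tY := @HInv.quo_lt_iff (y := L.size + X.size) _ _ _ _ _ hI hY
    rw [size_nd] at h2 hq hc
    rw [if_pos (by simpa using hc)]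
    simp only [eX, eL, hf, hn, bX, bY, tL', tY, true_and]
    refine ⟨by omega, ?_⟩
    have hdouble : (rho * L.size < X.size ∨ rho * Y.size < L.size + X.size) →
        ∃ X₁ X₂, X = nd d X₁ X₂ ∧ Near L.size X₁.size ∧ Near X₂.size Y.size ∧
          Near (L.size + X₁.size) (X₂.size + Y.size) := by
      intro hor
      have h1X : 1 < X.size := by
        have : (1 : ℝ) < X.size := by
          have h1L : (1 : ℝ) ≤ L.size := by exact_mod_cast hLp
          push_cast at hc
          rcases hor with h | h <;> nlinarith [hXY.1, hXY.2, rho_sq]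
        exact_mod_cast this
      obtain ⟨X₁, X₂, rfl⟩ := exists_eq_nd d h1X
      have b := bal_nd.1 balX
      rw [size_nd] at *
      refine ⟨X₁, X₂, rfl, near_double hLp hXY b.2.2 (by exact_mod_cast hc) h2 ?_⟩
      exact_mod_cast hor
    by_cases hor : rho * L.size < X.size ∨ rho * Y.size < L.size + X.size
    · obtain ⟨X₁, X₂, rfl, n1, n2, n3⟩ := hdouble hor
      have key := rotDouble_spec (s := ((((((((s.set 22 (s.arr 6 (s.reg 20))).set 23
        (X₁.size + X₂.size + Y.size)).set 24 (s.arr (farA d) (s.reg 21))).set 25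
        (s.arr (nearA d) (s.reg 21))).set 23 (X₁.size + X₂.size)).set 26
        (s.arr 6 (s.arr (nearA d) (s.reg 21)))).set 27 L.size).set 27
        (L.size + (X₁.size + X₂.size)))) d
        (hI.congr (by simp) (by simp)) (by simpa using hL) (by simpa using hX) (by simpa using hY)
        n1 n2 n3 (by simp at hq; omega) hcap
      simp only [size_nd] at *
      split_ifs with h1 h2
      · refine key.mono ?_
        rintro k s' ⟨H', T, i1, i2, i3, i4, i5, i6, i7⟩
        exact ⟨H', T, i1, i2, i3, by simpa using i4, i5, by omega, by simpa using i7⟩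
      · refine key.mono ?_
        rintro k s' ⟨H', T, i1, i2, i3, i4, i5, i6, i7⟩
        exact ⟨H', T, i1, i2, i3, by simpa using i4, i5, by omega, by simpa using i7⟩
      · push_cast at h1 h2 hor
        exact absurd hor (not_or.2 ⟨h1, h2⟩)
    · have h1 := not_or.1 hor
      obtain ⟨n1, n2⟩ := near_single hXY (by exact_mod_cast hc) h1.1 h1.2
      rw [if_neg h1.1, if_neg (by push_cast; exact h1.2)]
      refine (rotSingle_spec d (hI.congr (by simp) (by simp)) (L := L) (X := X) (Y := Y)
        (by simpa using hL) (by simpa using hX) (by simpa using hY) n1 n2 (by omega) hcap).mono ?_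
      rintro k s' ⟨H', T, i1, i2, i3, i4, i5, i6, i7⟩
      exact ⟨H', T, i1, i2, i3, by simpa using i4, i5, by omega, by simpa using i7⟩
  · rw [if_neg (by simpa using hc)]
    refine (newD_spec d (hI.congr (by simp) (by simp)) (x := L) (y := T) (by simpa using hL)
      (by simpa using hT) (near_of_le h1 hc) (by omega) (by omega)).mono ?_
    rintro k s' ⟨H', T, i1, i2, i3, rfl, i4, i5, i6⟩
    have i6' : Fr 30 s s' := by simpa using i6.mono (m' := 30) (by norm_num)
    exact ⟨H', _, i1, i2, i3, by simp, by omega, by omega, i6'⟩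

/-- The trees in the list, from the top of the stack downwards, are on the stack between the heights
`b` and `h`. -/
def OnStack (H : List Tr) (stk : ℕ → ℕ) (b : ℕ) : List Tr → ℕ → Prop
  | [], h => h = b
  | L :: Ls, h => ∃ h', h = h' + 1 ∧ H[stk h']? = some L ∧ OnStack H stk b Ls h'

theorem OnStack.le {H : List Tr} {stk : ℕ → ℕ} {b h : ℕ} {Ls : List Tr}
    (hs : OnStack H stk b Ls h) : h = b + Ls.length := by
  induction Ls generalizing h with
  | nil => exact hs
  | cons L Ls ih =>
    obtain ⟨h', rfl, -, h2⟩ := hs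
    simp [ih h2]; omega

theorem OnStack.congr {H H' : List Tr} {stk stk' : ℕ → ℕ} {b h : ℕ} {Ls : List Tr}
    (hs : OnStack H stk b Ls h) (hH : H <+: H') (he : ∀ i < h, stk' i = stk i) :
    OnStack H' stk' b Ls h := by
  induction Ls generalizing h with
  | nil => exact hs
  | cons L Ls ih =>
    obtain ⟨h', rfl, h1, h2⟩ := hs
    refine ⟨h', rfl, ?_, ih h2 fun i hi => he i (by omega)⟩
    rw [he h' (by omega)]
    exact getElem?_of_prefix hH h1

/-- The concatenation of the trees on the stack, the bottom one being farthest. -/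
def catStack (d : Bool) : List Tr → List ℕ → List ℕ
  | [], u => u
  | L :: Ls, u => catStack d Ls (cat d L.toList u)

/-- The condition on the far children `Ls` on the spine above a tree of weight `r`, along which a
tree of weight `b` is inserted: they are balanced with their siblings, and on every level above the
last one the weight is more than `1 + √2` times `b`. -/
def Spine (b : ℕ) : List Tr → ℕ → Prop
  | [], _ => True
  | L :: Ls, r => Near L.size r ∧ rho * b < L.size + r ∧ Spine b Ls (L.size + r)

/-- Joins the trees in the registers `30` and `31`, the first of which is (essentially) the heavier
one and is to the left of the second one if `d` holds. -/
def joinD (d : Bool) : Cmd :=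
  .seq (Cmd.blk [.move 32 2, .ld 33 6 31, .ld 34 5 30])
  (.seq (.loop 33 34 (Cmd.blk [.ld 35 (farA d) 30, .st 2 2 35, .add 2 2 100, .ld 30 (nearA d) 30,
    .ld 34 5 30]))
  (.seq (Cmd.blk [.move 10 30, .move 11 31])
  (.seq (newD d)
  (.loop 32 2 (.seq (Cmd.blk [.sub 2 2 100, .ld 20 2 2, .move 21 12]) (rebal d))))))

/-- The way up: the trees on the stack are combined with the current tree, which has grown by the
weight `b` of the inserted tree. -/
theorem joinD_up {cx : Cx} (d : Bool) (b B : ℕ) (Ls : List Tr) :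
    ∀ {H : List Tr} {s : St} {T : Tr} {r : ℕ}, HInv cx H s → H[s.reg 12]? = some T →
      OnStack H (s.arr 2) B Ls (s.reg 2) → s.reg 32 = B → T.size = r + b →
      Spine b Ls r → s.reg 2 ≤ cx.M → (Ls.map Tr.size).sum + T.size < cx.q →
      3 * (H.length + 3 * Ls.length) ≤ cx.M →
      Tri cx.lim (.loop 32 2 (.seq (Cmd.blk [.sub 2 2 100, .ld 20 2 2, .move 21 12]) (rebal d))) s
        fun k s' => ∃ H' U, HInv cx H' s' ∧ H <+: H' ∧ H'[s'.reg 12]? = some U ∧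
          U.toList = catStack d Ls T.toList ∧ H'.length ≤ H.length + 3 * Ls.length ∧
          k ≤ 320 * Ls.length + 2 ∧ (∀ r, 30 ≤ r → s'.reg r = s.reg r) ∧ s'.reg 2 = B ∧
          (∀ i < B, s'.arr 2 i = s.arr 2 i) ∧ ∀ a ∈ [0, 3, 4], s'.arr a = s.arr a := by
  induction Ls with
  | nil =>
    intro H s T r hI hT hS hB hr hsp hM hq hcap
    have h2 : s.reg 2 = B := hS
    refine Tri.loop_false (by omega) ⟨H, T, hI, List.prefix_rfl, hT, rfl, by simp, by simp,
      fun _ _ => rfl, h2, fun _ _ => rfl, fun _ _ => rfl⟩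
  | cons L Ls ih =>
    intro H s T r hI hT hS hB hr hsp hM hq hcap
    have hle := hS.le
    obtain ⟨h', e1, hL, hS'⟩ := hS
    obtain ⟨n1, n2, n3⟩ := hsp
    simp only [List.length_cons, List.map_cons, List.sum_cons] at *
    refine Tri.loop_true (by omega) ?_
    have hρ := rho_gt
    have es : s.reg 2 - 1 = h' := by omega
    simp only [Cmd.blk, Tri.seq_iff, Tri.op_iff, Tri.skip_iff, Op.ok, Op.run, Op.cost, St.set_reg,
      St.set_arr, hI.one, es, reduceIte, Nat.reduceEqDiff, Cx.lim_kx, Cx.lim_M, true_and]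
    refine ⟨by omega, ⟨by omega, by omega⟩, ?_⟩
    have b0 : (0 : ℝ) ≤ b := by positivity
    have r0 : (0 : ℝ) ≤ r := by positivity
    refine (rebal_spec d (hI.congr (by simp) (by simp)) (L := L) (T := T) (by simpa using hL)
      (by simpa using hT) ?_ ?_ (by omega) (by omega)).mono ?_
    · rw [hr]; push_cast; nlinarith [n1.1]
    · -- the inserted weight is at most `(L + r) / rho`, where `r ≤ rho * L`
      rw [hr]; push_cast
      nlinarith [n1.2, rho_sq, mul_lt_mul_of_pos_left n2 (show 0 < rho - 2 by linarith),
        mul_le_mul_of_nonneg_left n1.2 (show 0 ≤ rho - 2 by linarith)]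
    rintro k s' ⟨H', U, i1, i2, i3, i4, i5, i6, i7⟩
    have hU : U.size = L.size + T.size := by
      rw [← length_toList, i4]; cases d <;> simp [cat, length_toList, Nat.add_comm]
    have r2 : s'.reg 2 = h' := by simpa using i7.sp
    have r32 : s'.reg 32 = B := by simpa [hB] using i7.reg 32 (by norm_num)
    have st : ∀ i < h', s'.arr 2 i = s.arr 2 i := by simpa using i7.stk
    refine (ih (r := L.size + r) i1 i3 ?_ r32 (by omega) n3 (by omega) (by omega)
      (by omega)).mono ?_
    · rw [r2]
      exact hS'.congr i2 st
    rintro k' s'' ⟨H'', V, j1, j2, j3, j4, j5, j6, j7, j8, j9, j10⟩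
    refine ⟨H'', V, j1, i2.trans j2, j3, by rw [j4, i4]; rfl, by omega, by omega, fun r hr => ?_,
      j8, fun i hi => ?_, fun a ha => ?_⟩
    · rw [j7 r hr, i7.reg r hr]
      simp only [St.set_reg]
      repeat rw [if_neg (by omega)]
    · rw [j9 i hi, st i (by omega)]
    · rw [j10 a ha, i7.arr a ha]; rfl

/-- The way down: the far children along the spine of the heavier tree `Bg` are pushed on the stack
until a subtree `R` is reached that is not too heavy to be a sibling of the lighter tree `Sm`. Each
step lowers the potential. -/
theorem joinD_down {cx : Cx} (d : Bool) {H : List Tr} {Sm : Tr} {B : ℕ} (n : ℕ) :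
    ∀ {Bg : Tr} {s : St} {Ls : List Tr}, Bg.size ≤ n → HInv cx H s → H[s.reg 30]? = some Bg →
      H[s.reg 31]? = some Sm → s.reg 33 = s.arr 6 (s.reg 31) → s.reg 34 = Bg.size →
      OnStack H (s.arr 2) B Ls (s.reg 2) → Spine Sm.size Ls Bg.size →
      (Sm.size : ℝ) ≤ rho * Bg.size → 3 * H.length ≤ cx.M →
      s.reg 2 + (ell Bg.size - ell Sm.size) ≤ cx.M →
      Tri cx.lim (.loop 33 34 (Cmd.blk [.ld 35 (farA d) 30, .st 2 2 35, .add 2 2 100,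
          .ld 30 (nearA d) 30, .ld 34 5 30])) s fun k s' =>
        ∃ R Ls', HInv cx H s' ∧ H[s'.reg 30]? = some R ∧ OnStack H (s'.arr 2) B Ls' (s'.reg 2) ∧
          Spine Sm.size Ls' R.size ∧ Near R.size Sm.size ∧
          (∀ u, catStack d Ls' (cat d R.toList u) = catStack d Ls (cat d Bg.toList u)) ∧
          Ls'.length ≤ Ls.length + (ell Bg.size - ell Sm.size) ∧
          (Ls'.map Tr.size).sum + R.size = (Ls.map Tr.size).sum + Bg.size ∧
          k + 11 * Ls.length ≤ 11 * Ls'.length + 2 ∧ s'.reg 2 ≤ cx.M ∧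
          (∀ i < s.reg 2, s'.arr 2 i = s.arr 2 i) := by
  induction n with
  | zero => intro Bg s Ls hn; have := Bg.size_pos; omega
  | succ n ih =>
    intro Bg s Ls hn hI hB hS h33 h34 hst hsp hle hcap hM
    have tS := @HInv.quo_lt_iff (y := Bg.size) _ _ _ _ _ hI hS
    have hρ := rho_gt
    have hW := cx.hM
    by_cases hc : rho * Sm.size < Bg.size
    · have hSp := Sm.size_pos
      have h1B : 1 < Bg.size := by
        have h1 : (1 : ℝ) ≤ Sm.size := by exact_mod_cast hSp
        have : (1 : ℝ) < Bg.size := by nlinarith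
        exact_mod_cast this
      obtain ⟨X, Y, rfl⟩ := exists_eq_nd d h1B
      obtain ⟨hX, hY, -, -, hXY⟩ := hI.children hB
      have bB := hI.lt_M hB hcap
      have bY := hI.lt_M hY hcap
      have hf := farA_lt d
      have hn' := nearA_lt d
      have eY := (hI.cell _ _ hY).size
      have e1 := ell_of_rho_mul_lt hSp hc
      have e2 := ell_child Y.size_pos hXY.2
      have hXp := X.size_pos
      have f5 : s.arr (nearA d) (s.reg 30) = (s.setA 2 (s.reg 2) 0).arr (nearA d) (s.reg 30) := by
        cases d <;> simp [nearA]
      have n2 : nearA d ≠ 2 := by cases d <;> decide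
      rw [size_nd] at *
      refine Tri.loop_true (by rw [h33, h34]; exact tS.2 hc) ?_
      simp only [Cmd.blk, Tri.seq_iff, Tri.op_iff, Tri.skip_iff, Op.ok, Op.run, Op.cost, St.set_reg,
        St.set_arr, St.setA_arr, St.setA_reg, hI.one, reduceIte, Nat.reduceEqDiff, Cx.lim_kx,
        Cx.lim_M, Cx.lim_W, hf, hn', bB, bY, n2, eY, Nat.reduceLT, true_and, false_and, and_true]
      refine ⟨by omega, by omega, ?_⟩
      push_cast at hc
      refine (ih (Bg := Y) (Ls := X :: Ls) (by omega) (hI.congr (by simp) ?_) (by simpa using hY)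
        (by simpa using hS) (by simpa using h33) (by simp) ?_ ⟨hXY, hc, hsp⟩ ?_ hcap
        (by simp; omega)).mono ?_
      · simp only [List.forall_mem_cons]
        simp [St.setA]
      · refine ⟨s.reg 2, by simp, by simpa using hX, hst.congr List.prefix_rfl fun i hi => ?_⟩
        simp; omega
      · nlinarith [hXY.1, rho_sq]
      rintro k s' ⟨R, Ls', i1, i2, i3, i4, i5, i6, i7, i8, i9, i10, i11⟩
      simp only [List.length_cons, List.map_cons, List.sum_cons] at *
      refine ⟨R, Ls', i1, i2, i3, i4, i5, fun u => ?_, by omega, by omega, by omega, i10, ?_⟩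
      · rw [i6, toList_nd, cat_assoc]; rfl
      · intro i hi
        rw [i11 i (by simp; omega)]
        simp; omega
    · refine Tri.loop_false (by rw [h33, h34]; exact fun h => hc (tS.1 h)) ?_
      exact ⟨Bg, Ls, hI, hB, hst, hsp, ⟨not_lt.1 hc, hle⟩, fun _ => rfl, by omega, rfl, by omega,
        by omega, fun _ _ => rfl⟩

theorem catStack_cat (d : Bool) (Ls : List Tr) (u v : List ℕ) :
    catStack d Ls (cat d u v) = cat d (catStack d Ls u) v := by
  induction Ls generalizing u with
  | nil => rfl
  | cons L Ls ih => simp only [catStack]; rw [← cat_assoc, ih]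

theorem size_eq_of_toList {T U V : Tr} {d : Bool} (h : T.toList = cat d U.toList V.toList) :
    T.size = U.size + V.size := by
  rw [← length_toList, h]; cases d <;> simp [cat, length_toList, Nat.add_comm]

theorem joinD_spec {cx : Cx} {H : List Tr} {s : St} {A Z : Tr} (d : Bool) (hI : HInv cx H s)
    (hA : H[s.reg 30]? = some A) (hZ : H[s.reg 31]? = some Z)
    (hle : (Z.size : ℝ) ≤ rho * A.size) (hq : A.size + Z.size < cx.q)
    (hcap : 3 * (H.length + (3 * (ell A.size - ell Z.size) + 1)) ≤ cx.M)
    (hM : s.reg 2 + (ell A.size - ell Z.size) ≤ cx.M) :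
    Tri cx.lim (joinD d) s (Made cx 36 s H (3 * (ell A.size - ell Z.size) + 1)
      (600 * (ell A.size - ell Z.size) + 150) 12
      fun U => U.toList = cat d A.toList Z.toList) := by
  have bZ := hI.lt_M hZ (by omega)
  have bA := hI.lt_M hA (by omega)
  have eA := (hI.cell _ _ hA).size
  simp only [joinD, Tri.seq_iff]
  simp only [Cmd.blk, Tri.seq_iff, Tri.op_iff, Tri.skip_iff, Op.ok, Op.run, Op.cost, St.set_reg,
    St.set_arr, reduceIte, Nat.reduceEqDiff, Cx.lim_kx, Cx.lim_M, bZ, bA, Nat.reduceLT,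
    true_and]
  refine (joinD_down (B := s.reg 2) (Ls := []) (Sm := Z) d A.size le_rfl
    (hI.congr (by simp) (by simp)) (by simpa using hA) (by simpa using hZ) (by simp) (by simp [eA])
    (by simp [OnStack]) trivial hle (by omega) (by simpa using hM)).mono_frame 36
    (by cases d <;> rfl) ?_
  rintro k s₁ f1 f2 f3 ⟨R, Ls, i1, i2, i3, i4, i5, i6, i7, i8, i9, i10, i11⟩
  simp only [List.length_nil, List.map_nil, List.sum_nil, Nat.zero_add] at *
  have g31 : s₁.reg 31 = s.reg 31 := by simpa using f2 31 (by cases d <;> rfl)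
  have g32 : s₁.reg 32 = s.reg 2 := by simpa using f2 32 (by cases d <;> rfl)
  have hstk := i3.le
  refine (newD_spec d (i1.congr (by simp) (by simp)) (x := R) (y := Z) (by simpa using i2)
    (by simpa [g31] using hZ) i5 (by omega) (by omega)).mono ?_
  rintro k₂ s₂ ⟨H₂, T, j1, j2, j3, rfl, j4, j5, j6⟩
  have sp2 : s₂.reg 2 = s₁.reg 2 := by simpa using j6.sp
  have stk2 : ∀ i < s₁.reg 2, s₂.arr 2 i = s₁.arr 2 i := by simpa using j6.stk
  refine (joinD_up d Z.size (s.reg 2) Ls j1 j3 ?_ ?_ (r := R.size) (by simp) i4 (by omega)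
    (by simp; omega) (by omega)).mono ?_
  · rw [sp2]; exact i3.congr j2 stk2
  · simpa [g32] using j6.reg 32 (by norm_num)
  rintro k₃ s₃ ⟨H₃, V, l1, l2, l3, l4, l5, l6, l7, l8, l9, l10⟩
  refine ⟨H₃, V, l1, j2.trans l2, l3, ?_, by omega, by omega, ?_, l8, ?_, ?_⟩
  · change V.toList = _
    rw [l4, toList_nd, i6]; rfl
  · intro r hr
    rw [l7 r (by omega), j6.reg r (by omega)]
    simp only [St.set_reg]
    rw [if_neg (by omega), if_neg (by omega), f1 r hr]
    simp only [St.set_reg]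
    repeat rw [if_neg (by omega)]
  · intro i hi
    rw [l9 i hi, stk2 i (by omega), i11 i (by simpa using hi)]
    rfl
  · intro a ha
    rw [l10 a ha, j6.arr a ha]
    simp only [List.mem_cons, List.not_mem_nil, or_false] at ha
    simp only [St.set_arr]
    rcases ha with rfl | rfl | rfl
    · exact f3 0 (by cases d <;> rfl)
    · exact f3 3 (by cases d <;> rfl)
    · exact f3 4 (by cases d <;> rfl)

/-- Joins the trees in the registers `30` and `31`. -/
def join : Cmd :=
  .seq (Cmd.blk [.ld 33 5 30, .ld 34 5 31])
  (.ite 33 34 (.seq (Cmd.blk [.move 32 30, .move 30 31, .move 31 32]) (joinD false)) (joinD true))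

/-- The number of nonterminals added by joining trees of weights `a` and `b`. -/
def jc (a b : ℕ) : ℕ := 3 * ((ell a - ell b) + (ell b - ell a)) + 1

theorem join_spec {cx : Cx} {H : List Tr} {s : St} {A Z : Tr} (hI : HInv cx H s)
    (hA : H[s.reg 30]? = some A) (hZ : H[s.reg 31]? = some Z) (hq : A.size + Z.size < cx.q)
    (hcap : 3 * (H.length + jc A.size Z.size) ≤ cx.M) (hM : s.reg 2 + jc A.size Z.size ≤ cx.M) :
    Tri cx.lim join s (Made cx 36 s H (jc A.size Z.size) (200 * jc A.size Z.size) 12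
      fun U => U.toList = A.toList ++ Z.toList) := by
  unfold jc at *
  have bZ := hI.lt_M hZ (by omega)
  have bA := hI.lt_M hA (by omega)
  have eA := (hI.cell _ _ hA).size
  have eZ := (hI.cell _ _ hZ).size
  have hρ := rho_gt
  have hA0 : (0 : ℝ) ≤ A.size := by positivity
  have hZ0 : (0 : ℝ) ≤ Z.size := by positivity
  simp only [join, Tri.seq_iff]
  simp only [Cmd.blk, Tri.seq_iff, Tri.op_iff, Tri.skip_iff, Op.ok, Op.run, Op.cost, St.set_reg,
    St.set_arr, reduceIte, Nat.reduceEqDiff, Cx.lim_kx, Cx.lim_M, bZ, bA, Tri.ite_iff, eA, eZ,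
    Nat.reduceLT, true_and, and_true]
  split_ifs with hc
  · have hc' : (A.size : ℝ) ≤ Z.size := by exact_mod_cast hc.le
    have em := ell_mono hc.le
    refine (joinD_spec (A := Z) (Z := A) false (hI.congr (by simp) (by simp)) (by simpa using hZ)
      (by simpa using hA) (by nlinarith) (by omega) (by omega) (by simp; omega)).mono ?_
    rintro k s' ⟨H', T, i1, i2, i3, i4, i5, i6, i7⟩
    exact ⟨H', T, i1, i2, i3, by simpa [cat] using i4, by omega, by omega, by simpa using i7⟩
  · have hc' : (Z.size : ℝ) ≤ A.size := by exact_mod_cast not_lt.1 hc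
    have em := ell_mono (not_lt.1 hc)
    refine (joinD_spec (A := A) (Z := Z) true (hI.congr (by simp) (by simp)) (by simpa using hA)
      (by simpa using hZ) (by nlinarith) (by omega) (by omega) (by simp; omega)).mono ?_
    rintro k s' ⟨H', T, i1, i2, i3, i4, i5, i6, i7⟩
    exact ⟨H', T, i1, i2, i3, by simpa [cat] using i4, by omega, by omega, by simpa using i7⟩


/-! ### Splitting a balanced tree -/

/-- The condition under which the trees `Ls` on the stack can be joined from the top to the bottom
to a tree of weight at most `r` at a total cost that telescopes. -/
def Coll : List Tr → ℕ → Prop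
  | [], _ => True
  | L :: Ls, r => (r : ℝ) ≤ rho * L.size ∧ Coll Ls (L.size + r)

theorem Coll.anti {Ls : List Tr} {r r' : ℕ} (h : Coll Ls r) (hr : r' ≤ r) : Coll Ls r' := by
  induction Ls generalizing r r' with
  | nil => trivial
  | cons L Ls ih =>
    have : (r' : ℝ) ≤ r := by exact_mod_cast hr
    exact ⟨this.trans h.1, ih h.2 (by omega)⟩

/-- The cost of joining a tree of weight `L` with an accumulated tree of weight `r` is paid by the
increase of the potential of the accumulated tree, up to a constant. -/
theorem jc_le {L r : ℕ} (hL : 0 < L) (h : (r : ℝ) ≤ rho * L) :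
    jc L r + 3 * ell r ≤ 3 * ell (L + r) + 10 ∧ jc r L + 3 * ell r ≤ 3 * ell (L + r) + 10 := by
  have h1 : ell L ≤ ell (L + r) := ell_mono (by omega)
  have h2 : ell r ≤ ell (L + r) := ell_mono (by omega)
  have h3 : ell r ≤ ell L + 3 := by
    have e : Nat.log 2 (L ^ 2 * 2 ^ 3) = Nat.log 2 (L ^ 2) + 3 := by
      rw [show L ^ 2 * 2 ^ 3 = L ^ 2 * 2 * 2 * 2 by ring,
        Nat.log_mul_base (by norm_num) (by positivity),
        Nat.log_mul_base (by norm_num) (by positivity),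
        Nat.log_mul_base (by norm_num) (by positivity)]
    rw [ell, ell, ← e]
    apply Nat.log_mono_right
    have h4 : r ^ 2 ≤ L ^ 2 * 8 := by
      have hρ := rho_gt
      have hρ' := rho_lt
      have : (r : ℝ) ^ 2 ≤ L ^ 2 * 8 := by
        have hr0 : (0 : ℝ) ≤ r := by positivity
        have hL0 : (0 : ℝ) ≤ L := by positivity
        have : (r : ℝ) ≤ 2.415 * L := by nlinarith
        nlinarith
      exact_mod_cast this
    omega
  unfold jc
  omega

/-- Joins the trees on the stack above the height in register `40` to the tree in register `41`. -/
def collapse (d : Bool) : Cmd :=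
  .loop 40 2
    (.seq (Cmd.blk [.sub 2 2 100, .ld (if d then 30 else 31) 2 2, .move (if d then 31 else 30) 41])
    (.seq join (.op (.move 41 12))))

/-- The total cost telescopes: it is bounded by the increase of the potential of the accumulated
tree and the number of trees on the stack. -/
theorem collapse_spec {cx : Cx} (d : Bool) (B : ℕ) (Ls : List Tr) :
    ∀ {H : List Tr} {s : St} {T : Tr} {E : ℕ}, HInv cx H s → H[s.reg 41]? = some T →
      OnStack H (s.arr 2) B Ls (s.reg 2) → s.reg 40 = B → Coll Ls T.size →
      (Ls.map Tr.size).sum + T.size < cx.q → ell ((Ls.map Tr.size).sum + T.size) ≤ E →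
      s.reg 2 + 3 * E + 10 ≤ cx.M →
      3 * (H.length + 3 * (E - ell T.size) + 10 * Ls.length) ≤ cx.M →
      Tri cx.lim (collapse d) s
        fun k s' => ∃ H' U, HInv cx H' s' ∧ H <+: H' ∧ H'[s'.reg 41]? = some U ∧
          U.toList = catStack d Ls T.toList ∧
          H'.length ≤ H.length + 3 * (E - ell T.size) + 10 * Ls.length ∧
          k ≤ 220 * (3 * (E - ell T.size) + 10 * Ls.length) + 2 ∧
          (∀ r, 42 ≤ r → s'.reg r = s.reg r) ∧ s'.reg 2 = B ∧
          (∀ i < B, s'.arr 2 i = s.arr 2 i) ∧ ∀ a ∈ [0, 3, 4], s'.arr a = s.arr a := by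
  induction Ls with
  | nil =>
    intro H s T E hI hT hS hB hsp hq hE hM hcap
    have h2 : s.reg 2 = B := hS
    refine Tri.loop_false (by omega) ⟨H, T, hI, List.prefix_rfl, hT, rfl, by omega, by omega,
      fun _ _ => rfl, h2, fun _ _ => rfl, fun _ _ => rfl⟩
  | cons L Ls ih =>
    intro H s T E hI hT hS hB hsp hq hE hM hcap
    have hle := hS.le
    obtain ⟨h', e1, hL, hS'⟩ := hS
    simp only [List.length_cons, List.map_cons, List.sum_cons] at *
    refine Tri.loop_true (by omega) ?_
    have es : s.reg 2 - 1 = h' := by omega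
    have jcl := jc_le L.size_pos hsp.1
    have em := ell_mono (show L.size + T.size ≤ L.size + (Ls.map Tr.size).sum + T.size by omega)
    have em' := ell_mono (show T.size ≤ L.size + T.size by omega)
    have key : Tri cx.lim join (((s.set 2 h').set (if d then 30 else 31) (s.arr 2 h')).set
        (if d then 31 else 30) (s.reg 41)) (Made cx 36 (s.set 2 h') H
          (3 * (ell (L.size + T.size) - ell T.size) + 10)
          (200 * (3 * (ell (L.size + T.size) - ell T.size) + 10)) 12
          fun U => U.toList = cat d L.toList T.toList) := by
      cases d
      · refine (join_spec (A := T) (Z := L) (hI.congr (by simp) (by simp)) (by simpa using hT)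
          (by simpa using hL) (by omega) (by omega) (by simp; omega)).mono ?_
        rintro k s' ⟨H', U, i1, i2, i3, i4, i5, i6, i7⟩
        exact ⟨H', U, i1, i2, i3, i4, by omega, by omega, by simpa using i7⟩
      · refine (join_spec (A := L) (Z := T) (hI.congr (by simp) (by simp)) (by simpa using hL)
          (by simpa using hT) (by omega) (by omega) (by simp; omega)).mono ?_
        rintro k s' ⟨H', U, i1, i2, i3, i4, i5, i6, i7⟩
        exact ⟨H', U, i1, i2, i3, i4, by omega, by omega, by simpa using i7⟩
    have d1 : (if d then 30 else 31) ≠ 41 := by cases d <;> decide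
    simp only [Cmd.blk, Tri.seq_iff, Tri.op_iff, Tri.skip_iff, Op.ok, Op.run, Op.cost, St.set_reg,
      St.set_arr, hI.one, es, reduceIte, Nat.reduceEqDiff, Cx.lim_kx, Cx.lim_M, Nat.reduceLT,
      d1.symm, true_and]
    refine ⟨by omega, by omega, ?_⟩
    refine key.mono ?_
    rintro k s' ⟨H', U, i1, i2, i3, i4, i5, i6, i7⟩
    have hU := size_eq_of_toList i4
    have r2 : s'.reg 2 = h' := by simpa using i7.sp
    have r40 : s'.reg 40 = B := by simpa [hB] using i7.reg 40 (by norm_num)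
    have st : ∀ i < h', s'.arr 2 i = s.arr 2 i := by simpa using i7.stk
    refine (ih (T := U) (E := E) (i1.congr (by simp) (by simp)) (by simpa using i3) ?_
      (by simpa using r40) (by rw [hU]; exact hsp.2) (by omega) ?_ (by simp; omega)
      (by rw [hU]; omega)).mono ?_
    · simp only [St.set_reg, St.set_arr, r2]
      exact hS'.congr i2 st
    · rw [hU]; refine le_trans (le_of_eq ?_) hE; congr 1; omega
    rintro k' s'' ⟨H'', V, j1, j2, j3, j4, j5, j6, j7, j8, j9, j10⟩
    rw [hU] at j5 j6
    refine ⟨H'', V, j1, i2.trans j2, j3, by rw [j4, i4]; rfl, by omega, by omega, fun r hr => ?_,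
      j8, fun i hi => ?_, fun a ha => ?_⟩
    · rw [j7 r hr, St.set_reg, if_neg (by omega), i7.reg r (by omega), St.set_reg,
        if_neg (by omega)]
    · rw [j9 i hi, St.set_arr, st i (by omega)]
    · rw [j10 a ha, St.set_arr, i7.arr a ha]; rfl

/-- The first (or, if `d` is false, the last) `k` elements of a list. -/
def takeD (d : Bool) (k : ℕ) (u : List ℕ) : List ℕ := if d then u.take k else u.drop (u.length - k)

theorem takeD_length (d : Bool) (u : List ℕ) : takeD d u.length u = u := by
  cases d <;> simp [takeD]

theorem takeD_cat_of_le {d : Bool} {k : ℕ} {u v : List ℕ} (h : k ≤ u.length) :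
    takeD d k (cat d u v) = takeD d k u := by
  cases d
  · simp only [takeD, cat, Bool.false_eq_true, if_false, List.length_append]
    rw [show v.length + u.length - k = v.length + (u.length - k) by omega, List.drop_append,
      List.drop_of_length_le (by omega)]
    simp
  · simp [takeD, cat, List.take_append_of_le_length h]

theorem takeD_cat_of_ge {d : Bool} {k : ℕ} {u v : List ℕ} (h : u.length ≤ k)
    (h' : k ≤ u.length + v.length) :
    takeD d k (cat d u v) = cat d u (takeD d (k - u.length) v) := by
  cases d
  · simp only [takeD, cat, Bool.false_eq_true, if_false, List.length_append]
    rw [List.drop_append_of_le_length (by omega)]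
    congr 2; omega
  · simp [takeD, cat, List.take_append, List.take_of_length_le h]

/-- Extracts the first (or last) `R[43]` letters of the tree in register `42`. -/
def takeCmd (d : Bool) : Cmd :=
  .seq (Cmd.blk [.move 40 2, .ld 44 5 42])
  (.seq (.loop 43 44
    (.seq (Cmd.blk [.ld 45 (farA d) 42, .ld 46 5 45])
    (.seq (.ite 46 43
      (Cmd.blk [.st 2 2 45, .add 2 2 100, .sub 43 43 46, .ld 42 (nearA d) 42])
      (.op (.move 42 45)))
    (.op (.ld 44 5 42)))))
  (.seq (.op (.move 41 42)) (collapse d)))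

/-- The way down to the end of the prefix (or suffix): the subtrees passed are pushed on the stack. -/
theorem take_down {cx : Cx} (d : Bool) {H : List Tr} {B : ℕ} (n : ℕ) :
    ∀ {T : Tr} {s : St} {Ls : List Tr}, T.size ≤ n → HInv cx H s → H[s.reg 42]? = some T →
      s.reg 44 = T.size → 1 ≤ s.reg 43 → s.reg 43 ≤ T.size →
      OnStack H (s.arr 2) B Ls (s.reg 2) → Coll Ls T.size → 3 * H.length ≤ cx.M →
      s.reg 2 + ell T.size ≤ cx.M →
      Tri cx.lim (.loop 43 44
          (.seq (Cmd.blk [.ld 45 (farA d) 42, .ld 46 5 45])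
          (.seq (.ite 46 43
            (Cmd.blk [.st 2 2 45, .add 2 2 100, .sub 43 43 46, .ld 42 (nearA d) 42])
            (.op (.move 42 45)))
          (.op (.ld 44 5 42))))) s fun k s' =>
        ∃ R Ls', HInv cx H s' ∧ H[s'.reg 42]? = some R ∧ OnStack H (s'.arr 2) B Ls' (s'.reg 2) ∧
          Coll Ls' R.size ∧
          catStack d Ls' R.toList = catStack d Ls (takeD d (s.reg 43) T.toList) ∧
          Ls'.length + ell R.size ≤ Ls.length + ell T.size ∧
          (Ls'.map Tr.size).sum + R.size = (Ls.map Tr.size).sum + s.reg 43 ∧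
          k + 20 * ell R.size ≤ 20 * ell T.size + 2 ∧
          (∀ i < s.reg 2, s'.arr 2 i = s.arr 2 i) := by
  induction n with
  | zero => intro T s Ls hn; have := T.size_pos; omega
  | succ n ih =>
    intro T s Ls hn hI hT h44 h1 h43 hst hco hcap hM
    have hW := cx.hM
    by_cases hc : s.reg 43 < T.size
    · obtain ⟨X, Y, rfl⟩ := exists_eq_nd d (T := T) (by omega)
      obtain ⟨hX, hY, -, -, hXY⟩ := hI.children hT
      have bB := hI.lt_M hT hcap
      have bX := hI.lt_M hX hcap
      have bY := hI.lt_M hY hcap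
      have hf := farA_lt d
      have hn' := nearA_lt d
      have eX := (hI.cell _ _ hX).size
      have eY := (hI.cell _ _ hY).size
      have e2 := ell_child Y.size_pos hXY.2
      have e3 := ell_child X.size_pos hXY.1
      have hXp := X.size_pos
      have hYp := Y.size_pos
      have n2 : nearA d ≠ 2 := by cases d <;> decide
      have hlX := X.length_toList
      have hlY := Y.length_toList
      rw [Nat.add_comm Y.size] at e3
      rw [size_nd] at *
      refine Tri.loop_true (by omega) ?_
      simp only [Cmd.blk, Tri.seq_iff, Tri.op_iff, Tri.skip_iff, Op.ok, Op.run, Op.cost, St.set_reg,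
        St.set_arr, St.setA_arr, St.setA_reg, hI.one, reduceIte, Nat.reduceEqDiff, Cx.lim_kx,
        Cx.lim_M, Cx.lim_W, hf, hn', bB, bX, bY, n2, eX, eY, Tri.ite_iff, Nat.reduceLT, true_and,
        false_and, and_true]
      split_ifs with hk
      · refine ⟨by omega, by omega, by omega, ?_⟩
        refine (ih (T := Y) (Ls := X :: Ls) (by omega) (hI.congr (by simp) ?_) (by simpa using hY)
          (by simp) (by simp; omega) (by simp; omega) ?_ ⟨hXY.2, hco⟩ hcap
          (by simp; omega)).mono ?_
        · simp only [List.forall_mem_cons]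
          simp [St.setA]
        · refine ⟨s.reg 2, by simp, by simpa using hX, hst.congr List.prefix_rfl fun i hi => ?_⟩
          simp; omega
        rintro k s' ⟨R, Ls', i1, i2, i3, i4, i5, i6, i7, i8, i9⟩
        simp at i5 i6 i7 i8 i9
        refine ⟨R, Ls', i1, i2, i3, i4, ?_, by omega, by omega, by omega, ?_⟩
        · rw [i5, toList_nd, takeD_cat_of_ge (by omega) (by omega), hlX]; rfl
        · intro i hi
          rw [i9 i (by omega), if_neg (by omega)]
      · refine (ih (T := X) (Ls := Ls) (by omega) (hI.congr (by simp) (by simp)) (by simpa using hX)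
          (by simp) (by simpa using h1) (by simp; omega) (by simpa using hst)
          (hco.anti (by omega)) hcap (by simp; omega)).mono ?_
        rintro k s' ⟨R, Ls', i1, i2, i3, i4, i5, i6, i7, i8, i9⟩
        simp at i5 i6 i7 i8 i9
        refine ⟨R, Ls', i1, i2, i3, i4, ?_, by omega, by omega, by omega, i9⟩
        rw [i5, toList_nd, takeD_cat_of_le (by omega)]
    · refine Tri.loop_false (by omega) ?_
      have : s.reg 43 = T.toList.length := by rw [length_toList]; omega
      refine ⟨T, Ls, hI, hT, hst, hco, by rw [this, takeD_length], by omega, ?_, by omega,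
        fun _ _ => rfl⟩
      rw [this, length_toList]

theorem take_spec {cx : Cx} {H : List Tr} {s : St} {T : Tr} (d : Bool) (hI : HInv cx H s)
    (hT : H[s.reg 42]? = some T) (h1 : 1 ≤ s.reg 43) (h2 : s.reg 43 ≤ T.size)
    (hcap : 3 * (H.length + 13 * ell T.size) ≤ cx.M) (hM : s.reg 2 + 4 * ell T.size + 10 ≤ cx.M) :
    Tri cx.lim (takeCmd d) s (Made cx 47 s H (13 * ell T.size) (3000 * ell T.size + 20) 41
      fun U => U.toList = takeD d (s.reg 43) T.toList) := by
  have bT := hI.lt_M hT (by omega)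
  have cT := hI.cell _ _ hT
  have hq := cT.size_lt
  simp only [takeCmd, Tri.seq_iff (c₂ := Cmd.seq _ (Cmd.seq _ (collapse d)))]
  simp only [Cmd.blk, Tri.seq_iff (c₁ := Cmd.op _), Tri.op_iff, Tri.skip_iff, Op.ok, Op.run,
    Op.cost, St.set_reg,
    St.set_arr, reduceIte, Nat.reduceEqDiff, Cx.lim_kx, Cx.lim_M, bT, Nat.reduceLT, cT.size,
    true_and]
  rw [Tri.seq_iff]
  refine (take_down (B := s.reg 2) (Ls := []) d T.size le_rfl (hI.congr (by simp) (by simp))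
    (by simpa using hT) (by simp) (by simpa using h1) (by simpa using h2) (by simp [OnStack])
    trivial (by omega) (by simp; omega)).mono_frame 47 (by cases d <;> rfl) ?_
  rintro k s₁ f1 f2 f3 ⟨R, Ls, i1, i2, i3, i4, i5, i6, i7, i8, i9⟩
  simp at i5 i6 i7 i8 i9
  have g40 : s₁.reg 40 = s.reg 2 := by simpa using f2 40 (by cases d <;> rfl)
  have hstk := i3.le
  have em := ell_mono h2
  rw [← i7] at em
  have em' := ell_mono (show R.size ≤ (Ls.map Tr.size).sum + R.size by omega)
  simp only [Tri.seq_iff, Tri.op_iff, Op.ok, Op.run, true_and]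
  refine (collapse_spec d (s.reg 2) Ls (T := R) (E := ell T.size) (i1.congr (by simp) (by simp))
    (by simpa using i2) (by simpa using i3) (by simpa using g40) i4 (by omega) (by omega)
    (by simp; omega) (by omega)).mono ?_
  rintro k₂ s₂ ⟨H₂, U, j1, j2, j3, j4, j5, j6, j7, j8, j9, j10⟩
  refine ⟨H₂, U, j1, j2, j3, j4.trans i5, by omega, ?_, ?_, j8, ?_, ?_⟩
  · simp only [Op.cost]; omega
  · intro r hr
    rw [j7 r (by omega), St.set_reg, if_neg (by omega), f1 r hr]
    simp only [St.set_reg]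
    repeat rw [if_neg (by omega)]
  · intro i hi
    rw [j9 i hi, St.set_arr, i9 i hi]
  · intro a ha
    rw [j10 a ha]
    simp only [List.mem_cons, List.not_mem_nil, or_false] at ha
    simp only [St.set_arr]
    rcases ha with rfl | rfl | rfl
    · exact f3 0 (by cases d <;> rfl)
    · exact f3 3 (by cases d <;> rfl)
    · exact f3 4 (by cases d <;> rfl)


/-! ### The table of blocks -/

/-- The text described by a sequence of trees. -/
def flat (Bs : List Tr) : List ℕ := Bs.flatMap Tr.toList

/-- All trees have weight at most `B`, and all but the last one have weight exactly `B`. -/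
def Blocks (B : ℕ) (Bs : List Tr) : Prop :=
  ∀ j T, Bs[j]? = some T → T.size ≤ B ∧ (j + 1 < Bs.length → T.size = B)

theorem Blocks.tail {B : ℕ} {T : Tr} {Bs : List Tr} (h : Blocks B (T :: Bs)) : Blocks B Bs :=
  fun j U hj => by
    obtain ⟨h1, h2⟩ := h (j + 1) U (by simpa using hj)
    exact ⟨h1, fun hl => h2 (by simp; omega)⟩

theorem Blocks.drop_flat {B : ℕ} {Bs : List Tr} (h : Blocks B Bs) {j : ℕ} {T : Tr}
    (hj : Bs[j]? = some T) :
    (flat Bs).drop (j * B) = T.toList ++ flat (Bs.drop (j + 1)) := by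
  induction j generalizing Bs with
  | zero =>
    cases Bs with
    | nil => simp at hj
    | cons U Bs => simp at hj; subst hj; simp [flat]
  | succ j ih =>
    cases Bs with
    | nil => simp at hj
    | cons U Bs =>
      have hlen := (List.getElem?_eq_some_iff.1 hj).1
      have hU := (h 0 U (by simp)).2 (by simp at hlen ⊢; omega)
      simp only [List.getElem?_cons_succ] at hj
      have := ih h.tail hj
      rw [List.drop_succ_cons, ← this, flat, List.flatMap_cons, Nat.succ_mul, Nat.add_comm,
        ← hU, ← length_toList, List.drop_append]
      simp [flat]

theorem flat_nil_length : (flat []).length = 0 := rfl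

theorem length_flat (Bs : List Tr) : (flat Bs).length = (Bs.map Tr.size).sum := by
  simp [flat, List.length_flatMap, length_toList]

theorem length_le_flat (Bs : List Tr) : Bs.length ≤ (flat Bs).length := by
  induction Bs with
  | nil => simp
  | cons T Bs ih =>
    have := T.size_pos
    simp only [flat, List.flatMap_cons, List.length_append, List.length_cons, length_toList] at *
    omega

theorem Blocks.length_flat_add {B : ℕ} {Bs : List Tr} (h : Blocks B Bs) {j : ℕ} {T : Tr}
    (hj : Bs[j]? = some T) :
    (flat Bs).length = j * B + T.size + (flat (Bs.drop (j + 1))).length := by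
  have h1 := congrArg List.length (h.drop_flat hj)
  rw [List.length_drop, List.length_append, length_toList] at h1
  have := T.size_pos
  omega

/-- A substring of length at most `B` is a suffix of a block, cut to length, or a suffix of a block
followed by a prefix of the next one. -/
theorem Blocks.take_drop_flat {B : ℕ} {Bs : List Tr} (h : Blocks B Bs) {st m : ℕ} (h1 : 1 ≤ m)
    (hm : m ≤ B) (hst : st + m ≤ (flat Bs).length) :
    ∃ T, Bs[st / B]? = some T ∧ st / B * B ≤ st ∧ st < st / B * B + T.size ∧
      (m ≤ T.size - (st - st / B * B) →
        ((flat Bs).drop st).take m = (T.toList.drop (st - st / B * B)).take m) ∧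
      (T.size - (st - st / B * B) < m → ∃ U, Bs[st / B + 1]? = some U ∧
        m - (T.size - (st - st / B * B)) ≤ U.size ∧ ((flat Bs).drop st).take m =
          T.toList.drop (st - st / B * B) ++
            U.toList.take (m - (T.size - (st - st / B * B)))) := by
  have hB : 0 < B := by omega
  set j := st / B with hj
  have e1 : j * B ≤ st := Nat.div_mul_le_self st B
  have e2 : st < j * B + B := by
    have := Nat.lt_div_mul_add (a := st) hB; omega
  have hlen : j < Bs.length := by
    by_contra hc
    have : (flat Bs).length ≤ Bs.length * B := by
      rw [length_flat]
      have := List.sum_le_card_nsmul (Bs.map Tr.size) B (by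
        intro x hx
        obtain ⟨T, hT, rfl⟩ := List.mem_map.1 hx
        obtain ⟨i, hi⟩ := List.mem_iff_getElem?.1 hT
        exact (h i T hi).1)
      simpa using this
    have : Bs.length * B ≤ j * B := Nat.mul_le_mul_right _ (by omega)
    omega
  obtain ⟨T, hT⟩ : ∃ T, Bs[j]? = some T := ⟨_, List.getElem?_eq_getElem hlen⟩
  have hl := h.length_flat_add hT
  have hd := h.drop_flat hT
  have hsz : st < j * B + T.size := by
    by_cases hlast : j + 1 < Bs.length
    · rw [(h j T hT).2 hlast]; omega
    · rw [List.drop_of_length_le (by omega), flat_nil_length] at hl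
      omega
  have hdrop : (flat Bs).drop st =
      T.toList.drop (st - j * B) ++ flat (Bs.drop (j + 1)) := by
    rw [show st = j * B + (st - j * B) by omega, ← List.drop_drop, hd,
      List.drop_append_of_le_length (by rw [length_toList]; omega)]
    congr 2; omega
  refine ⟨T, hT, e1, hsz, fun hle => ?_, fun hlt => ?_⟩
  · rw [hdrop, List.take_append_of_le_length (by rw [List.length_drop, length_toList]; exact hle)]
  · have hlast : j + 1 < Bs.length := by
      by_contra hc
      rw [List.drop_of_length_le (by omega), flat_nil_length] at hl
      omega
    obtain ⟨U, hU⟩ : ∃ U, Bs[j + 1]? = some U := ⟨_, List.getElem?_eq_getElem hlast⟩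
    have hl2 := h.length_flat_add hU
    have hTB := (h j T hT).2 hlast
    have hle : m - (T.size - (st - j * B)) ≤ U.size := by
      by_cases hlast2 : j + 1 + 1 < Bs.length
      · rw [(h _ U hU).2 hlast2]; omega
      · rw [List.drop_of_length_le (by omega), Nat.succ_mul, flat_nil_length] at hl2
        omega
    refine ⟨U, hU, hle, ?_⟩
    have hrest : flat (Bs.drop (j + 1)) = U.toList ++ flat (Bs.drop (j + 2)) := by
      have := List.getElem?_eq_some_iff.1 hU
      obtain ⟨hh, rfl⟩ := this
      rw [List.drop_eq_getElem_cons hh]; rfl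
    rw [hdrop, List.take_append, List.take_of_length_le
      (by rw [List.length_drop, length_toList]; omega), hrest, List.length_drop, length_toList,
      List.take_append_of_le_length (by rw [length_toList]; exact hle)]

/-- The blocks `Bs` are listed in the arrays `3` (nonterminals) and `4` (positions). Register `70` is
the length of the text so far, and register `71` the index of the last block. -/
structure Tab (cx : Cx) (B : ℕ) (H Bs : List Tr) (s : St) : Prop where
  blocks : Blocks B Bs
  tbl : ∀ j T, Bs[j]? = some T → H[s.arr 3 j]? = some T ∧ s.arr 4 j = j * B
  reg_B : s.reg 104 = B
  reg_L : s.reg 70 = (flat Bs).length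
  reg_nb : s.reg 71 + 1 = Bs.length
  le_M : (flat Bs).length ≤ cx.M

theorem Tab.congr {cx : Cx} {B : ℕ} {H H' Bs : List Tr} {s s' : St} (h : Tab cx B H Bs s)
    (hH : H <+: H') (hr : ∀ r ∈ [70, 71, 104], s'.reg r = s.reg r)
    (ha : ∀ a ∈ [3, 4], s'.arr a = s.arr a) : Tab cx B H' Bs s' := by
  simp only [List.forall_mem_cons] at hr ha
  obtain ⟨h1, h2, h3, -⟩ := hr
  obtain ⟨a3, a4, -⟩ := ha
  refine ⟨h.blocks, fun j T hj => ?_, by rw [h3, h.reg_B], by rw [h1, h.reg_L],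
    by rw [h2, h.reg_nb], h.le_M⟩
  obtain ⟨h4, h5⟩ := h.tbl j T hj
  exact ⟨by rw [a3]; exact getElem?_of_prefix hH h4, by rw [a4, h5]⟩

theorem Tab.lt_M {cx : Cx} {B : ℕ} {H Bs : List Tr} {s : St} (h : Tab cx B H Bs s) {j : ℕ} {T : Tr}
    (hj : Bs[j]? = some T) : j < cx.M := by
  have h1 := (List.getElem?_eq_some_iff.1 hj).1
  have h2 := length_le_flat Bs
  have := h.le_M
  omega

/-- Extracts the substring of length `R[51]` from position `R[50]` on; it may span two blocks. -/
def extract : Cmd :=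
  .seq (Cmd.blk [.div 52 50 104, .ld 42 3 52, .ld 53 4 52, .sub 53 50 53, .ld 43 5 42,
    .sub 43 43 53, .move 54 43])
  (.seq (takeCmd false)
  (.ite 54 51
    (.seq (Cmd.blk [.move 55 41, .add 52 52 100, .ld 42 3 52, .sub 43 51 54])
    (.seq (takeCmd true)
    (.seq (Cmd.blk [.move 30 55, .move 31 41])
    (.seq join (.op (.move 41 12))))))
    (.seq (Cmd.blk [.move 42 41, .move 43 51]) (takeCmd true))))

theorem jc_le_of_le {a b c : ℕ} (ha : a ≤ c) (hb : b ≤ c) : jc a b ≤ 3 * ell c + 1 := by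
  have := ell_mono ha
  have := ell_mono hb
  unfold jc; omega

theorem extract_spec {cx : Cx} {B : ℕ} {H Bs : List Tr} {s : St} (hI : HInv cx H s)
    (hT : Tab cx B H Bs s) (h1 : 1 ≤ s.reg 51) (hB : s.reg 51 ≤ B)
    (hst : s.reg 50 + s.reg 51 ≤ (flat Bs).length) (hq : 2 * B < cx.q)
    (hcap : 3 * (H.length + 29 * ell (2 * B) + 1) ≤ cx.M)
    (hM : s.reg 2 + 4 * ell (2 * B) + 10 ≤ cx.M) :
    Tri cx.lim extract s (Made cx 56 s H (29 * ell (2 * B) + 1) (6600 * ell (2 * B) + 300) 41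
      fun U => U.toList = ((flat Bs).drop (s.reg 50)).take (s.reg 51)) := by
  have hW := cx.hM
  obtain ⟨T, t1, t2, t3, t4, t5⟩ := hT.blocks.take_drop_flat h1 hB hst
  have bj := hT.lt_M t1
  obtain ⟨u1, u2⟩ := hT.tbl _ T t1
  have eT := (hI.cell _ _ u1).size
  have bT := hI.lt_M u1 (by omega)
  have szT := (hT.blocks _ _ t1).1
  have elT := ell_mono (show T.size ≤ 2 * B by omega)
  set j := s.reg 50 / B with hj
  set keep := T.size - (s.reg 50 - j * B) with hkeep
  simp only [extract, Tri.seq_iff (c₁ := Cmd.blk _)]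
  simp only [Cmd.blk, Tri.seq_iff (c₁ := Cmd.op _), Tri.op_iff, Tri.skip_iff, Op.ok, Op.run,
    Op.cost, St.set_reg, St.set_arr, reduceIte, Nat.reduceEqDiff, Cx.lim_kx, Cx.lim_M, Nat.reduceLT,
    hT.reg_B, ← hj, u2, eT, bT, bj, true_and]
  refine ⟨t2, by omega, ?_⟩
  rw [← hkeep, Tri.seq_iff]
  refine (take_spec false (hI.congr (by simp) (by simp)) (T := T) (by simpa using u1)
    (by simp; omega) (by simp; omega) (by omega) (by simp; omega)).mono ?_
  rintro k s₁ ⟨H₁, S, i1, i2, i3, i4, i5, i6, i7⟩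
  simp only [St.set_reg, reduceIte, Nat.reduceEqDiff] at i4
  have g : ∀ r, 47 ≤ r → r ≠ 52 → r ≠ 53 → r ≠ 54 → s₁.reg r = s.reg r := fun r hr _ _ _ => by
    rw [i7.reg r hr]
    simp only [St.set_reg]
    repeat rw [if_neg (by omega)]
  have g52 : s₁.reg 52 = j := by rw [i7.reg 52 (by norm_num)]; simp
  have g54 : s₁.reg 54 = keep := by rw [i7.reg 54 (by norm_num)]; simp
  have g51 := g 51 (by norm_num) (by norm_num) (by norm_num) (by norm_num)
  have g2 : s₁.reg 2 = s.reg 2 := by simpa using i7.sp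
  have hS : S.toList = T.toList.drop (s.reg 50 - j * B) := by
    rw [i4]; simp only [takeD, length_toList, Bool.false_eq_true, if_false]
    congr 1; omega
  have szS : S.size = keep := by
    rw [← length_toList, hS, List.length_drop, length_toList]
  have i7' : Fr 56 s s₁ := by simpa using i7.mono (m' := 56) (by norm_num)
  have hT₁ : Tab cx B H₁ Bs s₁ := hT.congr i2 (by
      simp [i7.reg]) (by
      have := i7.arr 3 (by simp)
      have := i7.arr 4 (by simp)
      simp_all)
  rw [Tri.ite_iff]
  split_ifs with hc
  · rw [g54, g51] at hc
    obtain ⟨U, v1, v2, v3⟩ := t5 hc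
    obtain ⟨w1, -⟩ := hT₁.tbl _ U v1
    have bj' := hT.lt_M v1
    have szU := (hT.blocks _ _ v1).1
    have elU := ell_mono (show U.size ≤ 2 * B by omega)
    simp only [Tri.seq_iff, Tri.op_iff, Tri.skip_iff, Op.ok, Op.run,
      Op.cost, St.set_reg, St.set_arr, reduceIte, Nat.reduceEqDiff, Cx.lim_kx, Cx.lim_M, Cx.lim_W,
      Nat.reduceLT, g52, i1.one, g54, g51, bj', true_and]
    refine ⟨by omega, by omega, ?_⟩
    refine (take_spec true (i1.congr (by simp) (by simp)) (T := U) (by simpa using w1)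
      (by simp; omega) (by simp; omega) (by omega) (by simp; omega)).mono ?_
    rintro k₂ s₂ ⟨H₂, V, j1, j2, j3, j4, j5, j6, j7⟩
    simp only [St.set_reg, reduceIte, Nat.reduceEqDiff, takeD, if_true] at j4
    have r55 : s₂.reg 55 = s₁.reg 41 := by rw [j7.reg 55 (by norm_num)]; simp
    have j7' : Fr 56 s₁ s₂ := by simpa using j7.mono (m' := 56) (by norm_num)
    have szV : V.size = s.reg 51 - keep := by
      rw [← length_toList, j4, List.length_take, length_toList]; omega
    have hjc := jc_le_of_le (show S.size ≤ 2 * B by omega) (show V.size ≤ 2 * B by omega)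
    refine (join_spec (A := S) (Z := V) (j1.congr (by simp) (by simp))
      (by simpa [r55] using getElem?_of_prefix j2 i3) (by simpa using j3) (by omega) (by omega)
      (by simp [j7'.sp]; omega)).mono ?_
    rintro k₃ s₃ ⟨H₃, Z, l1, l2, l3, l4, l5, l6, l7⟩
    have l7' : Fr 56 s₂ s₃ := by simpa using l7.mono (m' := 56) (by norm_num)
    refine ⟨H₃, Z, l1.congr (by simp) (by simp), (i2.trans j2).trans l2, by simpa using l3, ?_,
      by omega, by omega, ?_⟩
    · change Z.toList = _
      rw [l4, v3, hS, j4]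
    · obtain ⟨f1, f2, f3, f4⟩ := (i7'.trans j7').trans l7'
      refine ⟨fun r hr => ?_, by simpa using f2, f3, f4⟩
      rw [St.set_reg, if_neg (by omega), f1 r hr]
  · rw [g54, g51] at hc
    have elS := ell_mono (show S.size ≤ 2 * B by omega)
    simp only [Tri.seq_iff, Tri.op_iff, Tri.skip_iff, Op.ok, Op.run, Op.cost, true_and]
    refine (take_spec true (i1.congr (by simp) (by simp)) (T := S) (by simpa using i3)
      (by simpa [g51] using h1) (by simp [g51]; omega) (by omega) (by simp; omega)).mono ?_
    rintro k₂ s₂ ⟨H₂, V, j1, j2, j3, j4, j5, j6, j7⟩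
    simp only [St.set_reg, reduceIte, Nat.reduceEqDiff, takeD, if_true] at j4
    have j7' : Fr 56 s₁ s₂ := by simpa using j7.mono (m' := 56) (by norm_num)
    refine ⟨H₂, V, j1, i2.trans j2, j3, ?_, by omega, by omega, i7'.trans j7'⟩
    change V.toList = _
    rw [j4, t4 (by omega), hS, g51]


/-! ### Copying a piece of the text -/

theorem Fr.of_keeps {c : Cmd} {m : ℕ} {s s' : St} (h1 : ∀ r, m ≤ r → s'.reg r = s.reg r)
    (h2 : ∀ r, c.keeps r → s'.reg r = s.reg r) (h3 : ∀ a, c.keepsA a → s'.arr a = s.arr a)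
    (k2 : c.keeps 2) (ka : ∀ a ∈ [0, 2, 3, 4], c.keepsA a) : Fr m s s' :=
  ⟨h1, h2 2 k2, fun i _ => by rw [h3 2 (ka 2 (by simp))], fun a ha => h3 a (ka a (by
    simp only [List.mem_cons, List.not_mem_nil, or_false] at ha ⊢; tauto))⟩

/-- Returns the `R[61]` letters of the text that are to follow when the text is continued by copying
from the position `R[60]` on. If fewer than `R[61]` letters are available, then they are repeated by
doubling. -/
def piece : Cmd :=
  .seq (Cmd.blk [.move 50 60, .sub 62 70 60])
  (.ite 62 61
    (.seq (.op (.move 51 62))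
    (.seq extract
    (.seq (.op (.ld 63 5 41))
    (.seq (.loop 63 61
      (.seq (Cmd.blk [.move 10 41, .move 11 41])
      (.seq newNode (Cmd.blk [.move 41 12, .ld 63 5 41]))))
    (.seq (Cmd.blk [.move 42 41, .move 43 61]) (takeCmd true))))))
    (.seq (.op (.move 51 61)) extract))

/-- The tree describes a power of the substring of length `d` at the position `st` of `f`. -/
def IsPower (f : List ℕ) (st d : ℕ) (T : Tr) : Prop :=
  (∃ c, T.size = c * d) ∧ ∀ i < T.size, T.toList[i]? = f[st + i % d]?

theorem IsPower.double {f : List ℕ} {st d : ℕ} {T : Tr} (h : IsPower f st d T) :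
    IsPower f st d (.node T T) := by
  obtain ⟨⟨c, hc⟩, h2⟩ := h
  refine ⟨⟨2 * c, by simp only [Tr.size, hc]; ring⟩, fun i hi => ?_⟩
  simp only [Tr.size, Tr.toList] at *
  by_cases hlt : i < T.size
  · rw [List.getElem?_append_left (by rw [length_toList]; exact hlt), h2 i hlt]
  · rw [List.getElem?_append_right (by rw [length_toList]; omega), length_toList,
      h2 _ (by omega)]
    have : i % d = (i - T.size) % d := by
      conv_lhs => rw [show i = (i - T.size) + c * d by omega]
      simp
    rw [this]

/-- The available period of a self-referential factor is doubled until it is long enough. -/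
theorem double_loop {cx : Cx} {f : List ℕ} {st d : ℕ} (n : ℕ) :
    ∀ {H : List Tr} {s : St} {T : Tr}, ell (2 * s.reg 61) - ell T.size ≤ n → HInv cx H s →
      H[s.reg 41]? = some T → s.reg 63 = T.size → IsPower f st d T → 2 * s.reg 61 < cx.q →
      T.size < 2 * s.reg 61 → 3 * (H.length + n) ≤ cx.M →
      Tri cx.lim (.loop 63 61 (.seq (Cmd.blk [.move 10 41, .move 11 41])
        (.seq newNode (Cmd.blk [.move 41 12, .ld 63 5 41])))) s
        fun k s' => ∃ H' U, HInv cx H' s' ∧ H <+: H' ∧ H'[s'.reg 41]? = some U ∧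
          IsPower f st d U ∧ s.reg 61 ≤ U.size ∧ U.size < 2 * s.reg 61 ∧
          H'.length ≤ H.length + n ∧ k ≤ 70 * n + 2 := by
  induction n with
  | zero =>
    intro H s T hn hI hT h63 hp hq hlt hcap
    refine Tri.loop_false ?_ ⟨H, T, hI, List.prefix_rfl, hT, hp, ?_, hlt, by omega, by omega⟩
    all_goals
      by_contra hc
      have := ell_lt_of_sq (y := 2 * T.size) T.size_pos (by nlinarith [T.size_pos])
      have := ell_mono (show 2 * T.size ≤ 2 * s.reg 61 by omega)
      omega
  | succ n ih =>
    intro H s T hn hI hT h63 hp hq hlt hcap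
    by_cases hc : T.size < s.reg 61
    · have e1 := ell_lt_of_sq (y := 2 * T.size) T.size_pos (by nlinarith [T.size_pos])
      have e2 := ell_mono (show 2 * T.size ≤ 2 * s.reg 61 by omega)
      refine Tri.loop_true (by omega) ?_
      simp only [Cmd.blk, Tri.seq_iff, Tri.op_iff, Tri.skip_iff, Op.ok, Op.run, Op.cost,
        St.set_reg, St.set_arr, reduceIte, Nat.reduceEqDiff, Cx.lim_kx, Cx.lim_M, Nat.reduceLT,
        true_and]
      have hρ := rho_gt
      have hnear : Near T.size T.size := by
        have : (0 : ℝ) ≤ T.size := by positivity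
        constructor <;> nlinarith
      refine (newNode_spec (hI.congr (by simp) (by simp)) (l := T) (r := T) (by simpa using hT)
        (by simpa using hT) hnear (by omega) (by omega)).mono_frame 16 rfl ?_
      rintro k s₁ f1 - - ⟨i1, i2, i3⟩
      have hget : (H ++ [Tr.node T T])[s₁.reg 12]? = some (.node T T) := by simp [i2]
      have f61 : s₁.reg 61 = s.reg 61 := by rw [f1 61 (by norm_num)]; simp
      have sz : (Tr.node T T).size = 2 * T.size := by simp [Tr.size]; omega
      refine ⟨i1.lt_M hget (by simp; omega), ?_⟩
      refine (ih (T := .node T T) (by simp [f61, sz]; omega) (i1.congr (by simp) (by simp))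
        (by simpa using hget) (by simp [(i1.cell _ _ hget).size]) hp.double (by simp [f61]; omega)
        (by simp [f61, sz]; omega) (by simp; omega)).mono ?_
      rintro k' s₂ ⟨H₂, U, j1, j2, j3, j4, j5, j6, j7, j8⟩
      simp [f61] at j5 j6 j7
      exact ⟨H₂, U, j1, (List.prefix_append _ _).trans j2, j3, j4, j5, j6, by omega, by omega⟩
    · refine Tri.loop_false (by omega) ⟨H, T, hI, List.prefix_rfl, hT, hp, by omega, hlt, by omega,
        by omega⟩

/-- The continuation by `m` letters of a text `f` by copying from the position `st` on. -/
def IsCopy (f : List ℕ) (st m : ℕ) (T : Tr) : Prop :=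
  T.size = m ∧ ∀ i < m, T.toList[i]? = f[st + i % (f.length - st)]?

theorem isCopy_of_eq {f : List ℕ} {st m : ℕ} {T : Tr} (h : T.toList = (f.drop st).take m)
    (hm : st + m ≤ f.length) : IsCopy f st m T := by
  refine ⟨?_, fun i hi => ?_⟩
  · rw [← length_toList, h, List.length_take, List.length_drop]; omega
  · rw [h, List.getElem?_take_of_lt hi, List.getElem?_drop, Nat.mod_eq_of_lt (by omega)]

theorem piece_spec {cx : Cx} {B : ℕ} {H Bs : List Tr} {s : St} (hI : HInv cx H s)
    (hT : Tab cx B H Bs s) (h1 : 1 ≤ s.reg 61) (hB : s.reg 61 ≤ B)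
    (hst : s.reg 60 < (flat Bs).length) (hq : 2 * B < cx.q)
    (hcap : 3 * (H.length + 43 * ell (2 * B) + 1) ≤ cx.M)
    (hM : s.reg 2 + 4 * ell (2 * B) + 10 ≤ cx.M) :
    Tri cx.lim piece s (Made cx 64 s H (43 * ell (2 * B) + 1) (9700 * ell (2 * B) + 400) 41
      (fun U => IsCopy (flat Bs) (s.reg 60) (s.reg 61) U)) := by
  have hL := hT.reg_L
  set L := (flat Bs).length with hLdef
  simp only [piece, Cmd.blk, Tri.seq_iff, Tri.op_iff, Tri.skip_iff, Op.ok, Op.run, Op.cost,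
    St.set_reg, reduceIte, Nat.reduceEqDiff, Cx.lim_kx, Cx.lim_M, Nat.reduceLT, hL,
    true_and, Tri.ite_iff]
  refine ⟨hst.le, ?_⟩
  split_ifs with hc
  · refine (extract_spec (Bs := Bs) (B := B) (hI.congr (by simp) (by simp))
      (hT.congr List.prefix_rfl (by simp) (by simp)) (by simp; omega) (by simp; omega)
      (by simp; omega) hq (by omega) (by simpa using hM)).mono ?_
    rintro k s₁ ⟨H₁, T, i1, i2, i3, i4, i5, i6, i7⟩
    simp only [St.set_reg, reduceIte, Nat.reduceEqDiff] at i4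
    have i7' : Fr 64 s s₁ := by simpa using i7.mono (m' := 64) (by norm_num)
    have szT : T.size = L - s.reg 60 := by
      rw [← length_toList, i4, List.length_take, List.length_drop]; omega
    have hpow : IsPower (flat Bs) (s.reg 60) (L - s.reg 60) T := by
      refine ⟨⟨1, by omega⟩, fun i hi => ?_⟩
      rw [i4, List.getElem?_take_of_lt (by omega), List.getElem?_drop, Nat.mod_eq_of_lt (by omega)]
    have r61 : s₁.reg 61 = s.reg 61 := by rw [i7.reg 61 (by norm_num)]; simp
    have r2 : s₁.reg 2 = s.reg 2 := by simpa using i7.sp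
    refine ⟨i1.lt_M i3 (by omega), ?_⟩
    have e1 := ell_mono (show 2 * s.reg 61 ≤ 2 * B by omega)
    refine (double_loop (ell (2 * s.reg 61) - ell T.size) (T := T) (by simp [r61])
      (i1.congr (by simp) (by simp)) (by simpa using i3) (by simp [(i1.cell _ _ i3).size]) hpow
      (by simp [r61]; omega) (by simp [r61]; omega) (by omega)).mono_frame 64 rfl ?_
    rintro k₂ s₂ f1 f2 f3 ⟨H₂, U, j1, j2, j3, j4, j5, j6, j7, j8⟩
    have g61 : s₂.reg 61 = s.reg 61 := by rw [f2 61 rfl]; simp [r61]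
    have g2 : s₂.reg 2 = s.reg 2 := by rw [f2 2 rfl]; simp [r2]
    simp [r61] at j5 j6
    have e2 := ell_mono (show U.size ≤ 2 * B by omega)
    refine (take_spec true (j1.congr (by simp) (by simp)) (T := U) (by simpa using j3)
      (by simp [g61]; omega) (by simp [g61]; omega) (by omega) (by simp [g2]; omega)).mono ?_
    rintro k₃ s₃ ⟨H₃, V, l1, l2, l3, l4, l5, l6, l7⟩
    simp only [St.set_reg, reduceIte, Nat.reduceEqDiff, takeD, if_true, g61] at l4
    refine ⟨H₃, V, l1, (i2.trans j2).trans l2, l3, ⟨?_, fun i hi => ?_⟩, by omega, by omega, ?_⟩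
    · rw [← length_toList, l4, List.length_take, length_toList]; omega
    · rw [l4, List.getElem?_take_of_lt hi, j4.2 i (by omega)]
    · have f' : Fr 64 s₁ s₂ := by
        simpa using Fr.of_keeps f1 f2 f3 rfl (by decide)
      have l7' : Fr 64 s₂ s₃ := by simpa using l7.mono (m' := 64) (by norm_num)
      exact (i7'.trans f').trans l7'
  · refine (extract_spec (Bs := Bs) (B := B) (hI.congr (by simp) (by simp))
      (hT.congr List.prefix_rfl (by simp) (by simp)) (by simp; omega) (by simp; omega)
      (by simp; omega) hq (by omega) (by simpa using hM)).mono ?_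
    rintro k s₁ ⟨H₁, T, i1, i2, i3, i4, i5, i6, i7⟩
    simp only [St.set_reg, reduceIte, Nat.reduceEqDiff] at i4
    exact ⟨H₁, T, i1, i2, i3, isCopy_of_eq i4 (by omega), by omega, by omega,
      by simpa using i7.mono (m' := 64) (by norm_num)⟩

/-- Appends the tree in register `41` to the text: to the last block, if that is not full, and as a
new block otherwise. -/
def append : Cmd :=
  .seq (Cmd.blk [.ld 64 3 71, .ld 65 5 64, .ld 66 5 41])
  (.seq (.ite 65 104
    (.seq (Cmd.blk [.move 30 64, .move 31 41]) (.seq join (.op (.st 3 71 12))))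
    (Cmd.blk [.add 71 71 100, .st 3 71 41, .st 4 71 70]))
  (.op (.add 70 70 66)))

theorem Blocks.append_block {B : ℕ} {Bs : List Tr} {T X : Tr} (h : Blocks B (Bs ++ [T]))
    (hT : T.size = B) (hX : X.size ≤ B) : Blocks B (Bs ++ [T] ++ [X]) := by
  intro j U hj
  rcases lt_trichotomy j (Bs ++ [T]).length with hlt | rfl | hgt
  · rw [List.getElem?_append_left hlt] at hj
    refine ⟨(h j U hj).1, fun _ => ?_⟩
    by_cases hl : j + 1 < (Bs ++ [T]).length
    · exact (h j U hj).2 hl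
    · simp only [List.length_append, List.length_singleton] at hl hlt
      obtain rfl : j = Bs.length := by omega
      simp at hj
      rw [← hj, hT]
  · simp only [List.getElem?_concat_length, Option.some.injEq] at hj
    subst hj
    exact ⟨hX, fun hl => by simp at hl⟩
  · rw [List.getElem?_eq_none (by simp at hgt ⊢; omega)] at hj
    cases hj

theorem Blocks.replace_last {B : ℕ} {Bs : List Tr} {T X : Tr} (h : Blocks B (Bs ++ [T]))
    (hX : X.size ≤ B) : Blocks B (Bs ++ [X]) := by
  intro j U hj
  rcases lt_trichotomy j Bs.length with hlt | rfl | hgt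
  · rw [List.getElem?_append_left hlt] at hj
    have := h j U (by rw [List.getElem?_append_left hlt, hj])
    refine ⟨this.1, fun _ => this.2 (by simp; omega)⟩
  · simp only [List.getElem?_concat_length, Option.some.injEq] at hj
    subst hj
    exact ⟨hX, fun hl => by simp at hl⟩
  · rw [List.getElem?_eq_none (by simp; omega)] at hj
    cases hj

theorem flat_append (Bs Cs : List Tr) : flat (Bs ++ Cs) = flat Bs ++ flat Cs := by
  simp [flat]

theorem flat_singleton (T : Tr) : flat [T] = T.toList := by simp [flat]

/-- A tree may be appended if it fits into the last block or if that block is full. -/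
theorem append_spec {cx : Cx} {B : ℕ} {H Bs : List Tr} {s : St} {T X : Tr} (hI : HInv cx H s)
    (hT : Tab cx B H (Bs ++ [T]) s) (hX : H[s.reg 41]? = some X)
    (hX1 : X.size ≤ B) (hX2 : T.size < B → T.size + X.size ≤ B)
    (hLM : (flat (Bs ++ [T])).length + X.size ≤ cx.M) (hq : 2 * B < cx.q)
    (hcap : 3 * (H.length + 3 * ell (2 * B) + 1) ≤ cx.M)
    (hM : s.reg 2 + 4 * ell (2 * B) + 10 ≤ cx.M) :
    Tri cx.lim append s fun k s' => ∃ H' Cs U, HInv cx H' s' ∧ H <+: H' ∧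
      Tab cx B H' (Cs ++ [U]) s' ∧ flat (Cs ++ [U]) = flat (Bs ++ [T]) ++ X.toList ∧
      H'.length ≤ H.length + 3 * ell (2 * B) + 1 ∧ k ≤ 600 * ell (2 * B) + 250 ∧
      s'.reg 2 = s.reg 2 := by
  have hW := cx.hM
  have hnb : s.reg 71 = Bs.length := by have := hT.reg_nb; simp at this; omega
  have gT : (Bs ++ [T])[Bs.length]? = some T := by simp
  obtain ⟨u1, -⟩ := hT.tbl _ _ gT
  have bnb := hT.lt_M gT
  have eT := (hI.cell _ _ u1).size
  have bT := hI.lt_M u1 (by omega)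
  have eX := (hI.cell _ _ hX).size
  have bX := hI.lt_M hX (by omega)
  have szT := (hT.blocks _ _ gT).1
  have hL := hT.reg_L
  have hjc := jc_le_of_le (show T.size ≤ 2 * B by omega) (show X.size ≤ 2 * B by omega)
  have hlen := length_le_flat (Bs ++ [T])
  have hXp := X.size_pos
  simp only [List.length_append, List.length_singleton] at hlen
  simp only [append, Cmd.blk, Tri.seq_iff, Tri.op_iff, Tri.skip_iff, Op.ok, Op.run, Op.cost,
    St.set_reg, St.set_arr, St.setA_reg, reduceIte, Nat.reduceEqDiff, Cx.lim_kx, Cx.lim_M, Cx.lim_W,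
    Nat.reduceLT, hL, hnb, eT, bT, bX, eX, bnb, hT.reg_B, hI.one, true_and, Tri.ite_iff]
  split_ifs with hc
  · refine (join_spec (A := T) (Z := X) (hI.congr (by simp) (by simp)) (by simpa using u1)
      (by simpa using hX) (by omega) (by omega) (by simp; omega)).mono ?_
    rintro k s₁ ⟨H₁, U, i1, i2, i3, i4, i5, i6, i7⟩
    have r : ∀ r ∈ [70, 71, 104], s₁.reg r = s.reg r := by
      simp only [List.forall_mem_cons]
      simp [i7.reg]
    have i7' : Fr 67 s s₁ := by simpa using i7.mono (m' := 67) (by norm_num)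
    have szU : U.size = T.size + X.size := by
      rw [← length_toList, i4, List.length_append, length_toList, length_toList]
    have r66 : s₁.reg 66 = X.size := by rw [i7.reg 66 (by norm_num)]; simp
    have hfl : flat (Bs ++ [U]) = flat (Bs ++ [T]) ++ X.toList := by
      rw [flat_append, flat_append, flat_singleton, flat_singleton, i4, List.append_assoc]
    simp only [r 70 (by simp), r 71 (by simp), hL, hnb, r66]
    refine ⟨bnb, by omega, H₁, Bs, U, i1.congr (by simp) ?_, i2, ?_, hfl, by omega, by omega, ?_⟩
    · simp [St.setA]
    · refine ⟨hT.blocks.replace_last (by have := hX2 hc; omega), ?_, ?_, ?_, ?_, ?_⟩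
      · intro j V hj
        rcases lt_trichotomy j Bs.length with hlt | rfl | hgt
        · rw [List.getElem?_append_left hlt] at hj
          have := hT.tbl j V (by rw [List.getElem?_append_left hlt, hj])
          simp only [St.set_arr, St.setA_arr]
          have a3 := i7.arr 3 (by simp)
          have a4 := i7.arr 4 (by simp)
          simp only [St.set_arr] at a3 a4
          rw [if_neg (by omega), if_neg (by omega), a3, a4]
          exact ⟨getElem?_of_prefix i2 this.1, this.2⟩
        · simp only [List.getElem?_concat_length, Option.some.injEq] at hj
          subst hj
          have a4 := i7.arr 4 (by simp)
          simp only [St.set_arr] at a4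
          simp only [St.set_arr, St.setA_arr]
          rw [if_pos (by simp), if_neg (by omega), a4]
          exact ⟨i3, (hT.tbl _ _ gT).2⟩
        · rw [List.getElem?_eq_none (by simp; omega)] at hj
          cases hj
      · simpa using (r 104 (by simp)).trans hT.reg_B
      · rw [hfl, List.length_append, length_toList]; simp
      · simp [r 71 (by simp), hnb]
      · rw [hfl, List.length_append, length_toList]; exact hLM
    · simpa using i7'.sp
  · have hTB : T.size = B := by omega
    have hfl : flat (Bs ++ [T] ++ [X]) = flat (Bs ++ [T]) ++ X.toList := by
      rw [flat_append _ [X], flat_singleton]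
    have hfT := hT.blocks.length_flat_add gT
    rw [List.drop_of_length_le (by simp), flat_nil_length] at hfT
    refine ⟨by omega, by omega, by omega, by omega, H, Bs ++ [T], X, hI.congr (by simp) ?_,
      List.prefix_rfl, ?_, hfl, by omega, by omega, ?_⟩
    · simp [St.setA]
    · refine ⟨hT.blocks.append_block hTB hX1, ?_, ?_, ?_, ?_, ?_⟩
      · intro j V hj
        rcases lt_trichotomy j (Bs ++ [T]).length with hlt | rfl | hgt
        · rw [List.getElem?_append_left hlt] at hj
          have := hT.tbl j V hj
          simp only [List.length_append, List.length_singleton] at hlt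
          simp only [St.set_arr, St.setA_arr]
          rw [if_neg (by omega), if_neg (by omega), if_neg (by omega), if_neg (by omega)]
          exact this
        · simp only [List.getElem?_concat_length, Option.some.injEq] at hj
          subst hj
          simp
          refine ⟨hX, ?_⟩
          rw [hfT, hTB]; ring
        · rw [List.getElem?_eq_none (by simp at hgt ⊢; omega)] at hj
          cases hj
      · simpa using hT.reg_B
      · rw [hfl, List.length_append, length_toList]; simp
      · simp
      · rw [hfl, List.length_append, length_toList]; exact hLM
    · simp


/-! ### Reading the parse -/

/-- A factor that is copied from the position `st` of the prefix `t.take L` repeats the letters from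
there on with period `L - st`. -/
theorem IsCopy.append_eq {t : List ℕ} {st L m : ℕ} {U : Tr} (h : IsCopy (t.take L) st m U)
    (hst : st < L) (hm : L + m ≤ t.length) (hc : ∀ k < m, t[L + k]? = t[st + k]?) :
    t.take L ++ U.toList = t.take (L + m) := by
  have hl : (t.take L).length = L := by rw [List.length_take]; omega
  obtain ⟨h1, h2⟩ := h
  rw [hl] at h2
  have key : ∀ i, i < m → t[L + i]? = t[st + i % (L - st)]? := by
    intro i
    induction i using Nat.strong_induction_on with
    | _ i ih =>
      intro hi
      by_cases hlt : i < L - st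
      · rw [Nat.mod_eq_of_lt hlt, hc i hi]
      · rw [hc i hi, Nat.mod_eq_sub_mod (by omega), ← ih (i - (L - st)) (by omega) (by omega)]
        congr 1; omega
  apply List.ext_getElem?
  intro i
  rcases lt_or_ge i L with hi | hi
  · rw [List.getElem?_append_left (by omega), List.getElem?_take_of_lt hi,
      List.getElem?_take_of_lt (by omega)]
  · rw [List.getElem?_append_right (by omega), hl]
    by_cases hi2 : i < L + m
    · have hd : (i - L) % (L - st) < L - st := Nat.mod_lt _ (by omega)
      rw [List.getElem?_take_of_lt hi2, h2 _ (by omega), List.getElem?_take_of_lt (by omega),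
        ← key _ (by omega)]
      congr 1; omega
    · rw [List.getElem?_eq_none (by rw [length_toList]; omega),
        List.getElem?_eq_none (by rw [List.length_take]; omega)]

/-- Continues the text by `R[75]` letters that are copied from the position `R[74]` on. The copied
factor is cut at the ends of the blocks. -/
def copyLoop : Cmd :=
  .loop 107 75 (
    .seq (Cmd.blk [.ld 64 3 71, .ld 65 5 64])
    (.seq (.ite 65 104 (.op (.sub 65 104 65)) (.op (.move 65 104)))
    (.seq (.ite 75 65 (.op (.move 61 75)) (.op (.move 61 65)))
    (.seq (.op (.move 60 74))
    (.seq piece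
    (.seq append (Cmd.blk [.add 74 74 61, .sub 75 75 61])))))))

/-- The room in the block that the next piece is put into. -/
theorem Blocks.room {B : ℕ} {Bs : List Tr} {T : Tr} (hB : 0 < B) (h : Blocks B (Bs ++ [T])) :
    ∃ r, r = (if T.size < B then B - T.size else B) ∧ 1 ≤ r ∧ r ≤ B ∧
      ((flat (Bs ++ [T])).length + r) / B = (flat (Bs ++ [T])).length / B + 1 := by
  have gT : (Bs ++ [T])[Bs.length]? = some T := by simp
  have hl := h.length_flat_add gT
  rw [List.drop_of_length_le (by simp), flat_nil_length, Nat.add_zero] at hl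
  have := (h _ _ gT).1
  have := T.size_pos
  rw [hl]
  split_ifs with hc
  · refine ⟨_, rfl, by omega, by omega, ?_⟩
    rw [show Bs.length * B + T.size + (B - T.size) = (Bs.length + 1) * B by
      rw [Nat.succ_mul]; omega, Nat.mul_div_cancel _ hB, Nat.add_comm (Bs.length * B),
      Nat.add_mul_div_right _ _ hB, Nat.div_eq_of_lt hc]
    omega
  · refine ⟨_, rfl, by omega, by omega, ?_⟩
    rw [Nat.add_div_right _ hB]

/-- The number of pieces is at most one more than the number of ends of blocks within the factor. -/
theorem copyLoop_spec {cx : Cx} {B : ℕ} {t : List ℕ} (n : ℕ) (hB : 0 < B) (hq : 2 * B < cx.q)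
    (htM : t.length ≤ cx.M) :
    ∀ {H Bs : List Tr} {T : Tr} {s : St} {L : ℕ}, HInv cx H s → Tab cx B H (Bs ++ [T]) s →
      flat (Bs ++ [T]) = t.take L → L + s.reg 75 ≤ t.length →
      (0 < s.reg 75 → s.reg 74 < L) →
      (∀ k < s.reg 75, t[L + k]? = t[s.reg 74 + k]?) →
      (s.reg 75 = 0 ∨ (L + s.reg 75) / B + 1 ≤ L / B + n) →
      3 * (H.length + n * (46 * ell (2 * B) + 2)) ≤ cx.M →
      s.reg 2 + 4 * ell (2 * B) + 10 ≤ cx.M →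
      Tri cx.lim copyLoop s fun k s' => ∃ H' Cs U, HInv cx H' s' ∧ H <+: H' ∧
        Tab cx B H' (Cs ++ [U]) s' ∧ flat (Cs ++ [U]) = t.take (L + s.reg 75) ∧
        H'.length ≤ H.length + n * (46 * ell (2 * B) + 2) ∧
        k ≤ n * (10300 * ell (2 * B) + 700) + 2 ∧ s'.reg 2 = s.reg 2 := by
  induction n with
  | zero =>
    intro H Bs T s L hI hT hf hL hst hc hn hcap hM
    have h0 : s.reg 75 = 0 := by
      rcases hn with h | h
      · exact h
      · have := Nat.div_le_div_right (c := B) (show L ≤ L + s.reg 75 by omega); omega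
    refine Tri.loop_false (by rw [hI.zero]; omega) ⟨H, Bs, T, hI, List.prefix_rfl, hT, ?_,
      by omega, by omega, rfl⟩
    rw [h0]; exact hf
  | succ n ih =>
    intro H Bs T s L hI hT hf hL hst hc hn hcap hM
    by_cases h0 : s.reg 75 = 0
    · refine Tri.loop_false (by rw [hI.zero]; omega) ⟨H, Bs, T, hI, List.prefix_rfl, hT, ?_,
        by omega, by omega, rfl⟩
      rw [h0]; exact hf
    have hn' := hn.resolve_left h0
    have hst' := hst (by omega)
    have hlen : (flat (Bs ++ [T])).length = L := by rw [hf, List.length_take]; omega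
    obtain ⟨r, r1, r2, r3, r4⟩ := hT.blocks.room hB
    rw [hlen] at r4
    rw [Nat.add_mul n 1, Nat.one_mul] at hcap
    have hW := cx.hM
    have hnb : s.reg 71 = Bs.length := by have := hT.reg_nb; simp at this; omega
    have gT : (Bs ++ [T])[Bs.length]? = some T := by simp
    obtain ⟨u1, -⟩ := hT.tbl _ _ gT
    have bnb := hT.lt_M gT
    have eT := (hI.cell _ _ u1).size
    have bT := hI.lt_M u1 (by omega)
    have szT := (hT.blocks _ _ gT).1
    -- the length of the next piece
    obtain ⟨m, hm⟩ : ∃ m, m = if s.reg 75 < r then s.reg 75 else r := ⟨_, rfl⟩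
    have hm1 : 1 ≤ m ∧ m ≤ r ∧ m ≤ s.reg 75 ∧ (m = s.reg 75 ∨ m = r) := by
      rw [hm]; split_ifs <;> omega
    obtain ⟨m1, m2, m3, m4⟩ := hm1
    refine Tri.loop_true (by rw [hI.zero]; omega) ?_
    rw [Tri.seq_iff]
    refine Tri.mono (Q := fun k s₁ => s₁ = (s.set 64 (s.arr 3 Bs.length)).set 65 T.size ∧ k = 4)
      ?_ ?_
    · simp only [Cmd.blk, Tri.seq_iff, Tri.op_iff, Tri.skip_iff, Op.ok, Op.run, Op.cost,
        St.set_reg, St.set_arr, reduceIte, Cx.lim_kx, Cx.lim_M,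
        Nat.reduceLT, hnb, true_and, eT, bnb, bT, and_self]
    rintro _ _ ⟨rfl, rfl⟩
    rw [Tri.seq_iff]
    refine Tri.mono (Q := fun k s₁ =>
      s₁ = ((s.set 64 (s.arr 3 Bs.length)).set 65 T.size).set 65 r ∧ k ≤ 3) ?_ ?_
    · rw [Tri.ite_iff]
      simp only [Tri.op_iff, Op.ok, Op.run, Op.cost, St.set_reg, reduceIte, Nat.reduceEqDiff,
        hT.reg_B]
      by_cases hlt : T.size < B
      · rw [if_pos hlt] at r1 ⊢; rw [r1]; exact ⟨hlt.le, rfl, by omega⟩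
      · rw [if_neg hlt] at r1 ⊢; rw [r1]; exact ⟨trivial, rfl, by omega⟩
    rintro k₁ _ ⟨rfl, hk₁⟩
    rw [Tri.seq_iff]
    refine Tri.mono (Q := fun k s₁ =>
      s₁ = (((s.set 64 (s.arr 3 Bs.length)).set 65 T.size).set 65 r).set 61 m ∧ k ≤ 3) ?_ ?_
    · rw [Tri.ite_iff]
      simp only [Tri.op_iff, Op.ok, Op.run, Op.cost, St.set_reg, reduceIte, Nat.reduceEqDiff]
      by_cases hlt : s.reg 75 < r
      · rw [if_pos hlt] at hm ⊢; rw [hm]; exact ⟨trivial, rfl, by omega⟩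
      · rw [if_neg hlt] at hm ⊢; rw [hm]; exact ⟨trivial, rfl, by omega⟩
    rintro k₂ _ ⟨rfl, hk₂⟩
    simp only [Tri.seq_iff, Tri.op_iff, Op.ok, Op.run, Op.cost, true_and]
    refine (piece_spec (Bs := Bs ++ [T]) (B := B) (hI.congr (by simp) (by simp))
      (hT.congr List.prefix_rfl (by simp) (by simp)) (by simpa using m1) (by simp; omega)
      (by simp [hlen]; omega) hq (by omega) (by simpa using hM)).mono_frame 64 rfl ?_
    rintro k₃ s₁ - f2 - ⟨H₁, U, i1, i2, i3, i4, i5, i6, i7⟩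
    have f2' := f2 61 rfl
    simp only [St.set_reg, reduceIte, Nat.reduceEqDiff, hf] at i4 f2'
    have i7' : ∀ r ∈ [70, 71, 72, 73, 74, 75, 104, 107], s₁.reg r = s.reg r := by
      simp only [List.forall_mem_cons]
      simp [i7.reg]
    have a34 : ∀ a ∈ [3, 4], s₁.arr a = s.arr a := by
      simp only [List.forall_mem_cons]
      simp [i7.arr]
    have sp : s₁.reg 2 = s.reg 2 := by simpa using i7.sp
    have szU := i4.1
    refine (append_spec i1 (hT.congr i2 (fun r hr => i7' r (by simp at hr ⊢; tauto)) a34) i3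
      (by omega) (fun hlt => by rw [if_pos hlt] at r1; omega) (by omega) hq
      (by omega) (by omega)).mono_frame 72 rfl ?_
    rintro k₄ s₂ g1 g2 - ⟨H₂, Cs, V, j1, j2, j3, j4, j5, j6, j7⟩
    have e74 : s₂.reg 74 = s.reg 74 := (g1 74 (by norm_num)).trans (i7' 74 (by simp))
    have e75 : s₂.reg 75 = s.reg 75 := (g1 75 (by norm_num)).trans (i7' 75 (by simp))
    have e61 : s₂.reg 61 = m := (g2 61 rfl).trans f2'
    rw [hf, i4.append_eq hst' (by omega) (fun k hk => hc k (by omega))] at j4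
    simp only [Cmd.blk, Tri.seq_iff, Tri.op_iff, Tri.skip_iff, Op.ok, Op.run, Op.cost,
      St.set_reg, reduceIte, Nat.reduceEqDiff, Cx.lim_W, e74, e75, e61]
    refine ⟨by omega, by omega, ?_⟩
    refine (ih (j1.congr (by simp) (by simp)) (j3.congr List.prefix_rfl (by simp) (by simp)) j4
      (by simp; omega) (by simp; omega) ?_ ?_ (by omega) (by simp [j7, sp]; omega)).mono ?_
    · intro k hk
      simp at hk ⊢
      rw [Nat.add_assoc, hc (m + k) (by omega), Nat.add_assoc]
    · simp
      rcases m4 with h | h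
      · left; omega
      · right
        rw [show L + m + (s.reg 75 - m) = L + s.reg 75 by omega, h, r4]; omega
    · rintro k₅ s₃ ⟨H₃, Ds, X, l1, l2, l3, l4, l5, l6, l7⟩
      simp at l4 l7
      rw [show L + m + (s.reg 75 - m) = L + s.reg 75 by omega] at l4
      refine ⟨H₃, Ds, X, l1, (i2.trans j2).trans l2, l3, l4, ?_, ?_, by rw [l7, j7, sp]⟩
      · rw [Nat.add_mul n 1, Nat.one_mul]; omega
      · rw [Nat.add_mul n 1, Nat.one_mul]; omega


theorem lzLength_take_succ {p : List LZTriple} {i : ℕ} (h : i < p.length) :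
    lzLength (p.take (i + 1)) = lzLength (p.take i) + p[i].len + 1 := by
  rw [List.take_succ_eq_append_getElem h]
  simp only [lzLength, List.map_append, List.sum_append, List.map_cons, List.map_nil,
    List.sum_cons, List.sum_nil]
  omega

theorem lzLength_take_le (p : List LZTriple) (i : ℕ) : lzLength (p.take i) ≤ lzLength p := by
  conv_rhs => rw [← List.take_append_drop i p, lzLength, List.map_append, List.sum_append]
  exact Nat.le_add_right _ _

theorem length_le_lzLength (p : List LZTriple) : p.length ≤ lzLength p := by
  induction p with
  | nil => simp
  | cons q p ih => simp only [lzLength, List.map_cons, List.sum_cons, List.length_cons] at *; omega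

/-- The parse is found in the array `0`. -/
def IsInput (p : List LZTriple) (arr : ℕ → ℕ) : Prop :=
  ∀ i (h : i < p.length), arr (3 * i) = p[i].start ∧ arr (3 * i + 1) = p[i].len ∧
    arr (3 * i + 2) = p[i].next

/-- Treats one triple of the parse. -/
def triple : Cmd :=
  .seq (Cmd.blk [.ld 74 0 72, .add 72 72 100, .ld 75 0 72, .add 72 72 100, .ld 76 0 72,
    .add 72 72 100])
  (.seq (.ite 107 75 (.op (.sub 74 74 100)) .skip)
  (.seq copyLoop
  (.seq (.op (.move 10 76))
  (.seq newLeaf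
  (.seq (.op (.move 41 12)) append)))))

/-- The cost is proportional to one plus the number of ends of blocks that are passed, so that the
sum over all triples telescopes. -/
theorem triple_spec {cx : Cx} {B i : ℕ} {p : List LZTriple} {t : List ℕ} (hp : IsLZParse p t)
    (hi : i < p.length) (hB : 0 < B) (hq : 2 * B < cx.q) (htM : 3 * t.length ≤ cx.M)
    {H Bs : List Tr} {T : Tr} {s : St} (hI : HInv cx H s) (hT : Tab cx B H (Bs ++ [T]) s)
    (hf : flat (Bs ++ [T]) = t.take (lzLength (p.take i))) (hin : IsInput p (s.arr 0))
    (h72 : s.reg 72 = 3 * i) {c : ℕ}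
    (hc : c = (lzLength (p.take (i + 1))) / B + 1 - lzLength (p.take i) / B)
    (hcap : 3 * (H.length + c * (49 * ell (2 * B) + 4)) ≤ cx.M)
    (hM : s.reg 2 + 4 * ell (2 * B) + 10 ≤ cx.M) :
    Tri cx.lim triple s fun k s' => ∃ H' Cs U, HInv cx H' s' ∧ H <+: H' ∧
      Tab cx B H' (Cs ++ [U]) s' ∧ flat (Cs ++ [U]) = t.take (lzLength (p.take (i + 1))) ∧
      H'.length ≤ H.length + c * (49 * ell (2 * B) + 4) ∧
      k ≤ c * (10900 * ell (2 * B) + 1100) ∧ s'.reg 2 = s.reg 2 ∧ s'.reg 72 = 3 * (i + 1) ∧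
      IsInput p (s'.arr 0) := by
  obtain ⟨L, hL⟩ : ∃ L, L = lzLength (p.take i) := ⟨_, rfl⟩
  have hlt := lzLength_take_succ hi
  have hle := lzLength_take_le p (i + 1)
  have hpl := length_le_lzLength p
  have hst := hp.start_le i hi
  have hcp := hp.copy i hi
  have hnx := hp.next i hi
  rw [← hp.length_eq] at hle hpl
  rw [← hL] at hf hc hst hcp hnx hlt
  rw [hlt] at hc hle ⊢
  obtain ⟨e1, e2, e3⟩ := hin i hi
  have hW := cx.hM
  obtain ⟨ℓ, hℓ⟩ : ∃ ℓ, ℓ = p[i].len := ⟨_, rfl⟩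
  obtain ⟨a, ha⟩ : ∃ a, a = p[i].start := ⟨_, rfl⟩
  obtain ⟨x, hx⟩ : ∃ x, x = p[i].next := ⟨_, rfl⟩
  simp only [← hℓ, ← ha, ← hx] at *
  have hdiv1 := Nat.div_le_div_right (c := B) (show L ≤ L + ℓ by omega)
  have hdiv2 := Nat.div_le_div_right (c := B) (show L + ℓ ≤ L + ℓ + 1 by omega)
  have hc1 : 1 ≤ c := by omega
  have hcD : c * (46 * ell (2 * B) + 2) + (3 * ell (2 * B) + 2) ≤ c * (49 * ell (2 * B) + 4) := by
    nlinarith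
  have hcT : c * (10300 * ell (2 * B) + 700) + (600 * ell (2 * B) + 400) ≤
      c * (10900 * ell (2 * B) + 1100) := by nlinarith
  unfold triple
  rw [Tri.seq_iff]
  refine Tri.mono (Q := fun k s₁ => k = 9 ∧ s₁.reg 74 = a ∧ s₁.reg 75 = ℓ ∧ s₁.reg 76 = x ∧
    s₁.reg 72 = 3 * (i + 1) ∧ (∀ r, r < 72 ∨ 76 < r → s₁.reg r = s.reg r) ∧ s₁.arr = s.arr) ?_ ?_
  · simp only [Cmd.blk, Tri.seq_iff, Tri.op_iff, Tri.skip_iff, Op.ok, Op.run, Op.cost,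
      St.set_reg, St.set_arr, reduceIte, Nat.reduceEqDiff, Cx.lim_kx, Cx.lim_M, Cx.lim_W,
      Nat.reduceLT, h72, hI.one, true_and, e1, e2, e3, Nat.add_assoc, Nat.reduceAdd, and_true]
    refine ⟨by omega, by omega, by omega, by omega, by omega, by omega, by omega, fun r hr => ?_⟩
    repeat rw [if_neg (by omega)]
  rintro _ s₁ ⟨rfl, b1, b2, b3, b4, b5, b6⟩
  rw [Tri.seq_iff]
  refine Tri.mono (Q := fun k s₂ => k ≤ 2 ∧ s₂.reg 74 = a - 1 ∧
    (∀ r, r ≠ 74 → s₂.reg r = s₁.reg r) ∧ s₂.arr = s.arr ∨ k ≤ 2 ∧ ℓ = 0 ∧ s₂ = s₁) ?_ ?_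
  · rw [Tri.ite_iff, b5 107 (by norm_num), hI.zero, b2]
    split_ifs with h
    · simp only [Tri.op_iff, Op.ok, Op.run, Op.cost, b1, b5 100 (by norm_num), hI.one]
      exact ⟨(hst h).1, Or.inl ⟨by omega, by simp, fun r hr => by simp [hr], by simp [b6]⟩⟩
    · simp only [Tri.skip_iff]
      exact Or.inr ⟨by omega, by omega, trivial⟩
  intro k₂ s₂ hs₂
  have c0 : k₂ ≤ 2 := by rcases hs₂ with h | h <;> exact h.1
  have c1 : 0 < ℓ → s₂.reg 74 = a - 1 := by
    rcases hs₂ with h | h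
    · exact fun _ => h.2.1
    · intro h'; omega
  have c2 : ∀ r, r ≠ 74 → s₂.reg r = s₁.reg r := by
    rcases hs₂ with h | h
    · exact h.2.2.1
    · rw [h.2.2]; exact fun _ _ => rfl
  have c3 : s₂.arr = s.arr := by
    rcases hs₂ with h | h
    · exact h.2.2.2
    · rw [h.2.2]; exact b6
  clear hs₂
  have d75 : s₂.reg 75 = ℓ := by rw [c2 75 (by norm_num), b2]
  have d : ∀ r, r < 72 ∨ 76 < r → s₂.reg r = s.reg r := fun r hr => by
    rw [c2 r (by omega), b5 r hr]
  rw [Tri.seq_iff]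
  refine (copyLoop_spec (t := t) (L := L) c hB hq (by omega) (Bs := Bs) (T := T)
    (hI.congr (fun r hr => d r ?_) (by simp [c3]))
    (hT.congr List.prefix_rfl (fun r hr => d r ?_) (by simp [c3])) hf (by omega) ?_ ?_ ?_ (by omega)
    (by rw [d 2 (by norm_num)]; omega)).mono_frame 108 rfl ?_
  · simp at hr; omega
  · simp at hr; omega
  · rw [d75]; intro h; rw [c1 h]; have := hst h; omega
  · rw [d75]; intro k hk; rw [c1 (by omega)]; exact hcp k hk
  · right; rw [d75]; omega
  rintro k₃ s₃ - f2 f3 ⟨H₁, Cs, U, i1, i2, i3, i4, i5, i6, i7⟩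
  have g76 : s₃.reg 76 = x := by rw [f2 76 rfl, c2 76 (by norm_num), b3]
  have g72 : s₃.reg 72 = 3 * (i + 1) := by rw [f2 72 rfl, c2 72 (by norm_num), b4]
  have g0 : s₃.arr 0 = s.arr 0 := by rw [f3 0 rfl, c3]
  have g2 : s₃.reg 2 = s.reg 2 := by rw [i7, d 2 (by norm_num)]
  rw [d75] at i4
  simp only [Tri.seq_iff, Tri.op_iff, Op.ok, Op.run, Op.cost, true_and]
  refine (newLeaf_spec (i1.congr (by simp) (by simp)) (by omega) (by omega)).mono_frame 13 rfl ?_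
  rintro k₄ s₄ h1 h2 h3 ⟨j1, j2, j3⟩
  simp only [St.set_reg, reduceIte, g76] at j1
  have hget : (H₁ ++ [Tr.leaf x])[s₄.reg 12]? = some (.leaf x) := by simp [j2]
  have hfl : (flat (Cs ++ [U])).length = L + ℓ := by
    rw [i4, List.length_take]; omega
  have m2 : s₄.reg 2 = s₃.reg 2 := by rw [h2 2 rfl]; simp
  refine (append_spec (X := .leaf x) (j1.congr (by simp) (by simp))
    (i3.congr (List.prefix_append _ _) (by simp [h1]) (by simp [h3 3 rfl, h3 4 rfl]))
    (by simpa using hget) (by simp [Tr.size]; omega) (by simp [Tr.size])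
    (by simp [Tr.size]; omega) hq (by simp; omega) (by simp; omega)).mono_frame 72 rfl ?_
  rintro k₅ s₅ l1 - l3 ⟨H₂, Ds, V, n1, n2, n3, n4, n5, n6, n7⟩
  simp only [List.length_append, List.length_singleton] at n5
  refine ⟨H₂, Ds, V, n1, (i2.trans (List.prefix_append _ _)).trans n2, n3, ?_, by omega, by omega,
    ?_, ?_, ?_⟩
  · rw [n4, i4, Tr.toList]
    have : t[L + ℓ]'(by omega) = x := by
      have := List.getElem?_eq_some_iff.1 hnx; exact this.2
    rw [List.take_succ_eq_append_getElem (by omega), this]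
  · rw [n7]; simp [m2, g2]
  · rw [l1 72 (by norm_num)]; simp [h1, g72]
  · rw [l3 0 rfl]; simp [h3 0 rfl, g0, hin]

/-- Reads the parse. The first triple consists of a letter. -/
def parse : Cmd :=
  .seq (Cmd.blk [.const 72 2, .ld 10 0 72])
  (.seq newLeaf
  (.seq (Cmd.blk [.const 71 0, .st 3 71 12, .st 4 71 107, .move 70 100, .const 72 3,
    .add 73 105 105, .add 73 73 105])
  (.loop 72 73 triple)))

theorem triple_loop_spec {cx : Cx} {B : ℕ} {p : List LZTriple} {t : List ℕ} (hp : IsLZParse p t)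
    (hB : 0 < B) (hq : 2 * B < cx.q) (htM : 3 * t.length ≤ cx.M) (n : ℕ) :
    ∀ {i : ℕ} {H Bs : List Tr} {T : Tr} {s : St} {c : ℕ}, i + n = p.length →
    HInv cx H s → Tab cx B H (Bs ++ [T]) s →
    flat (Bs ++ [T]) = t.take (lzLength (p.take i)) → IsInput p (s.arr 0) →
    s.reg 72 = 3 * i → s.reg 73 = 3 * p.length →
    c = t.length / B - lzLength (p.take i) / B + n →
    3 * (H.length + c * (49 * ell (2 * B) + 4)) ≤ cx.M →
    s.reg 2 + 4 * ell (2 * B) + 10 ≤ cx.M →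
    Tri cx.lim (.loop 72 73 triple) s fun k s' => ∃ H' Cs U, HInv cx H' s' ∧ H <+: H' ∧
      Tab cx B H' (Cs ++ [U]) s' ∧ flat (Cs ++ [U]) = t ∧
      H'.length ≤ H.length + c * (49 * ell (2 * B) + 4) ∧
      k ≤ c * (10900 * ell (2 * B) + 1102) + 2 ∧ s'.reg 2 = s.reg 2 := by
  induction n with
  | zero =>
    intro i H Bs T s c hn hI hT hf hin h72 h73 hc hcap hM
    refine Tri.loop_false (by omega) ⟨H, Bs, T, hI, List.prefix_rfl, hT, ?_, by omega, by omega,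
      rfl⟩
    rw [hf, List.take_of_length_le (show p.length ≤ i by omega), ← hp.length_eq, List.take_length]
  | succ n ih =>
    intro i H Bs T s c hn hI hT hf hin h72 h73 hc hcap hM
    have hi : i < p.length := by omega
    have h1 := Nat.div_le_div_right (c := B) (lzLength_take_le p (i + 1))
    have h2 := Nat.div_le_div_right (c := B)
      (show lzLength (p.take i) ≤ lzLength (p.take (i + 1)) by rw [lzLength_take_succ hi]; omega)
    rw [← hp.length_eq] at h1
    obtain ⟨c₁, hc₁⟩ : ∃ c₁, c₁ = lzLength (p.take (i + 1)) / B + 1 - lzLength (p.take i) / B :=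
      ⟨_, rfl⟩
    obtain ⟨c₂, hc₂⟩ : ∃ c₂, c₂ = t.length / B - lzLength (p.take (i + 1)) / B + n := ⟨_, rfl⟩
    obtain rfl : c = c₁ + c₂ := by omega
    have hc0 : 1 ≤ c₁ := by omega
    have hx : 2 ≤ 2 * c₁ := by omega
    rw [add_mul] at hcap ⊢
    rw [add_mul]
    have hx : c₁ * (10900 * ell (2 * B) + 1100) + 2 * c₁ = c₁ * (10900 * ell (2 * B) + 1102) := by
      ring
    refine Tri.loop_true (by omega) ?_
    refine (triple_spec hp hi hB hq htM hI hT hf hin h72 hc₁ (by omega) hM).mono_frame 77 rfl ?_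
    rintro k s₁ - f2 - ⟨H₁, Cs, U, i1, i2, i3, i4, i5, i6, i7, i8, i9⟩
    refine (ih (by omega) i1 i3 i4 i9 i8 (by rw [f2 73 rfl, h73]) hc₂ (by omega)
      (by omega)).mono ?_
    rintro k₂ s₂ ⟨H₂, Ds, V, j1, j2, j3, j4, j5, j6, j7⟩
    exact ⟨H₂, Ds, V, j1, i2.trans j2, j3, j4, by omega, by omega, by omega⟩

theorem parse_spec {cx : Cx} {B : ℕ} {p : List LZTriple} {t : List ℕ} (hp : IsLZParse p t)
    (hp0 : p ≠ []) (hB : 0 < B) (hq : 2 * B < cx.q) (htM : 3 * t.length ≤ cx.M) {s : St}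
    (hI : HInv cx [] s) (hin : IsInput p (s.arr 0)) (h104 : s.reg 104 = B)
    (h105 : s.reg 105 = p.length) {c : ℕ} (hc : c = t.length / B + p.length)
    (hcap : 3 * (c * (49 * ell (2 * B) + 4)) ≤ cx.M)
    (hM : s.reg 2 + 4 * ell (2 * B) + 10 ≤ cx.M) :
    Tri cx.lim parse s fun k s' => ∃ H Bs T, HInv cx H s' ∧
      Tab cx B H (Bs ++ [T]) s' ∧ flat (Bs ++ [T]) = t ∧
      H.length ≤ c * (49 * ell (2 * B) + 4) ∧
      k ≤ c * (10900 * ell (2 * B) + 1102) ∧ s'.reg 2 = s.reg 2 := by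
  have hn : 0 < p.length := List.length_pos_iff.2 hp0
  have hpl := length_le_lzLength p
  rw [← hp.length_eq] at hpl
  have hW := cx.hM
  have hsub := Nat.sub_le (t.length / B) (lzLength (p.take 1) / B)
  obtain ⟨c', rfl⟩ : ∃ c', c = c' + 1 := ⟨c - 1, by omega⟩
  rw [Nat.add_mul c' 1, Nat.one_mul] at hcap ⊢
  have hst := hp.start_le 0 hn
  have hnx := hp.next 0 hn
  have hl1 := lzLength_take_succ hn
  have h0 : p[0].len = 0 := by
    by_contra h
    have := hst (by omega)
    simp [lzLength] at this
    omega
  obtain ⟨-, -, e3⟩ := hin 0 hn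
  simp only [List.take_zero, h0] at hnx hl1
  simp [lzLength] at hnx
  have hl0 : lzLength [] = 0 := rfl
  rw [hl0] at hl1
  simp only [parse, Cmd.blk, Tri.seq_iff, Tri.op_iff, Tri.skip_iff, Op.ok, Op.run, Op.cost,
    St.set_reg, St.set_arr, reduceIte, Nat.reduceEqDiff, Cx.lim_kx, Cx.lim_M, Cx.lim_W,
    Nat.reduceLT, true_and, e3]
  refine ⟨by omega, by omega, ?_⟩
  refine (newLeaf_spec (hI.congr (by simp) (by simp)) (by omega) (by simp; omega)).mono_frame 13
    rfl ?_
  rintro k s₁ f1 f2 f3 ⟨i1, i2, i3⟩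
  simp only [St.set_reg, reduceIte, List.nil_append] at i1
  have g105 : s₁.reg 105 = p.length := by rw [f1 105 (by norm_num)]; simp [h105]
  have g100 := i1.one
  have g107 := i1.zero
  have g104 : s₁.reg 104 = B := by rw [f1 104 (by norm_num)]; simp [h104]
  have g2 : s₁.reg 2 = s.reg 2 := by rw [f2 2 rfl]; simp
  have g0 : s₁.arr 0 = s.arr 0 := by rw [f3 0 rfl]; simp
  simp only [St.set_reg, St.setA_reg, reduceIte, Nat.reduceEqDiff, g105, i2, g100, g107,
    List.length_nil]
  refine ⟨by omega, by omega, by omega, by omega, by omega, by omega, ?_⟩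
  have hfl : flat [Tr.leaf p[0].next] = t.take (lzLength (p.take (0 + 1))) := by
    rw [hl1, flat_singleton, Tr.toList]
    cases t with
    | nil => simp at hnx
    | cons y t => simp at hnx ⊢; exact hnx.symm
  refine (triple_loop_spec hp hB hq htM (p.length - 1) (i := 1) (c := t.length / B -
    lzLength (p.take 1) / B + (p.length - 1)) (Bs := []) (T := .leaf p[0].next) (by omega)
    (i1.congr (by simp) (by simp [St.setA])) ?_ hfl
    (by rw [← g0] at hin; simpa [St.setA] using hin) (by simp) (by simp; omega) rfl ?_
    (by simp [g2]; omega)).mono ?_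
  · refine ⟨?_, ?_, by simp [g104], ?_, by simp, ?_⟩
    · intro j U hj
      rw [List.nil_append, List.getElem?_singleton] at hj
      split_ifs at hj with hj0
      subst hj0; cases hj
      simp [Tr.size]; omega
    · intro j U hj
      rw [List.nil_append, List.getElem?_singleton] at hj
      split_ifs at hj with hj0
      subst hj0; cases hj
      simp
    · simp [flat_singleton, Tr.toList]
    · simp [flat_singleton, Tr.toList]; omega
  · have : (t.length / B - lzLength (p.take 1) / B + (p.length - 1)) * (49 * ell (2 * B) + 4) ≤
      c' * (49 * ell (2 * B) + 4) := Nat.mul_le_mul_right _ (by omega)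
    simp; omega
  · rintro k₂ s₂ ⟨H₂, Ds, V, j1, j2, j3, j4, j5, j6, j7⟩
    have h1 : (t.length / B - lzLength (p.take 1) / B + (p.length - 1)) * (49 * ell (2 * B) + 4) ≤
      c' * (49 * ell (2 * B) + 4) := Nat.mul_le_mul_right _ (by omega)
    have h2 : (t.length / B - lzLength (p.take 1) / B + (p.length - 1)) *
      (10900 * ell (2 * B) + 1102) ≤ c' * (10900 * ell (2 * B) + 1102) :=
      Nat.mul_le_mul_right _ (by omega)
    simp at j5 j7
    refine ⟨H₂, Ds, V, j1, j3, j4, by omega, ?_, by rw [j7, g2]⟩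
    rw [Nat.add_mul c' 1, Nat.one_mul]; omega


/-! ### Joining the blocks -/

/-- From the top to the bottom of the stack, the weights at least double, starting from `u / 2`. -/
def Tower : List Tr → ℕ → Prop
  | [], _ => True
  | L :: Ls, u => u ≤ L.size ∧ Tower Ls (2 * L.size)

theorem Tower.anti {Ls : List Tr} {u v : ℕ} (h : Tower Ls u) (hv : v ≤ u) : Tower Ls v := by
  cases Ls with
  | nil => trivial
  | cons L Ls => exact ⟨hv.trans h.1, h.2⟩

/-- The trees that remain in the end can be joined from the top to the bottom at a telescoping
cost. -/
theorem Tower.coll {Ls : List Tr} {u : ℕ} (h : Tower Ls u) : Coll Ls u := by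
  induction Ls generalizing u with
  | nil => trivial
  | cons L Ls ih =>
    obtain ⟨h1, h2⟩ := h
    have hρ := rho_gt
    refine ⟨?_, ih (h2.anti (by omega))⟩
    have h1' : (u : ℝ) ≤ L.size := by exact_mod_cast h1
    have : (0 : ℝ) ≤ L.size := by positivity
    nlinarith

theorem catStack_append (Ls : List Tr) (u v : List ℕ) :
    catStack true Ls (u ++ v) = catStack true Ls u ++ v :=
  catStack_cat true Ls u v

theorem length_catStack (Ls : List Tr) (u : List ℕ) :
    (catStack true Ls u).length = (Ls.map Tr.size).sum + u.length := by
  induction Ls generalizing u with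
  | nil => simp [catStack]
  | cons L Ls ih =>
    have : ∀ w, cat true L.toList w = L.toList ++ w := fun _ => rfl
    rw [catStack, ih, this, List.length_append, length_toList, List.map_cons, List.sum_cons]
    omega

/-- Joins the tree in register `81` with the trees on top of the stack as long as these are not at
least twice as heavy. -/
def absorb : Cmd :=
  .loop 107 82 (.ite 107 2
    (.seq (Cmd.blk [.sub 83 2 100, .ld 84 2 83, .ld 85 5 84, .ld 86 5 81, .add 86 86 86])
      (.ite 85 86
        (.seq (Cmd.blk [.move 2 83, .move 10 84, .move 11 81])
          (.seq newNode (.op (.move 81 12))))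
        (.op (.const 82 0))))
    (.op (.const 82 0)))

/-- Each new nonterminal removes one tree from the stack. -/
theorem absorb_spec {cx : Cx} (Ls : List Tr) :
    ∀ {H : List Tr} {s : St} {T : Tr}, HInv cx H s → H[s.reg 81]? = some T →
      OnStack H (s.arr 2) 0 Ls (s.reg 2) → s.reg 82 = 1 → Tower Ls T.size →
      (Ls.map Tr.size).sum + T.size < cx.q → 3 * (H.length + Ls.length) ≤ cx.M →
      s.reg 2 ≤ cx.M →
      Tri cx.lim absorb s fun k s' => ∃ H' Ls' U, HInv cx H' s' ∧ H <+: H' ∧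
        H'[s'.reg 81]? = some U ∧ OnStack H' (s'.arr 2) 0 Ls' (s'.reg 2) ∧
        Tower (U :: Ls') T.size ∧ catStack true Ls' U.toList = catStack true Ls T.toList ∧
        H'.length + Ls'.length = H.length + Ls.length ∧
        k + 70 * Ls'.length ≤ 70 * Ls.length + 30 := by
  induction Ls with
  | nil =>
    intro H s T hI hT hS h82 hTw hq hcap hM
    have h2 : s.reg 2 = 0 := hS
    have := cx.hM
    have := cx.hq
    refine Tri.loop_true (by rw [hI.zero]; omega) ?_
    simp only [Tri.ite_iff, hI.zero, h2, Nat.lt_irrefl, if_false, Tri.op_iff, Op.ok, Op.run,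
      Op.cost, Cx.lim_W]
    refine ⟨by omega, Tri.loop_false (by simp) ⟨H, [], T, hI.congr (by simp) (by simp),
      List.prefix_rfl, by simpa using hT, by simpa using hS, ⟨le_rfl, trivial⟩, rfl, rfl, by simp⟩⟩
  | cons L Ls ih =>
    intro H s T hI hT hS h82 hTw hq hcap hM
    have := cx.hM
    have := cx.hq
    have hS₀ := hS
    obtain ⟨h', e1, hL, hS'⟩ := hS
    obtain ⟨w1, w2⟩ := hTw
    simp only [List.length_cons, List.map_cons, List.sum_cons] at *
    have bL := hI.lt_M hL (by omega)
    have bT := hI.lt_M hT (by omega)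
    have eL := (hI.cell _ _ hL).size
    have eT := (hI.cell _ _ hT).size
    have es : s.reg 2 - 1 = h' := by omega
    refine Tri.loop_true (by rw [hI.zero]; omega) ?_
    rw [Tri.ite_iff, if_pos (by rw [hI.zero]; omega)]
    simp only [Cmd.blk, Tri.seq_iff, Tri.op_iff, Tri.skip_iff, Op.ok, Op.run, Op.cost, St.set_reg,
      St.set_arr, reduceIte, Nat.reduceEqDiff, Cx.lim_kx, Cx.lim_M, Cx.lim_W, Nat.reduceLT, hI.one,
      es, eL, eT, true_and, Tri.ite_iff]
    refine ⟨by omega, by omega, by omega, by omega, by omega, ?_⟩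
    split_ifs with hc
    · have hnear : Near L.size T.size := by
        have hρ := rho_gt
        have h1 : (T.size : ℝ) ≤ L.size := by exact_mod_cast w1
        have h2 : (L.size : ℝ) ≤ 2 * T.size := by
          have : L.size ≤ 2 * T.size := by omega
          exact_mod_cast this
        have h3 : (0 : ℝ) ≤ T.size := by positivity
        constructor <;> nlinarith
      refine (newNode_spec (hI.congr (by simp) (by simp)) (l := L) (r := T) (by simpa using hL)
        (by simpa using hT) hnear (by omega) (by omega)).mono_frame 16 rfl ?_
      rintro k s₁ f1 f2 f3 ⟨i1, i2, i3⟩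
      have hget : (H ++ [Tr.node L T])[s₁.reg 12]? = some (.node L T) := by simp [i2]
      have g82 : s₁.reg 82 = 1 := by rw [f1 82 (by norm_num)]; simpa using h82
      have g2 : s₁.reg 2 = h' := by rw [f2 2 rfl]; simp
      have ga : s₁.arr 2 = s.arr 2 := by rw [f3 2 rfl]; simp
      have sz : (Tr.node L T).size = L.size + T.size := rfl
      have hS₁ := hS'.congr (List.prefix_append H [Tr.node L T]) (stk' := s₁.arr 2) (by simp [ga])
      refine (ih (T := .node L T) (i1.congr (by simp) (by simp)) (by simpa using hget)
        (by simpa [g2] using hS₁) (by simpa using g82) (w2.anti (by omega)) (by omega)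
        (by simp; omega) (by simp [g2]; omega)).mono ?_
      rintro k₂ s₂ ⟨H₂, Ls₂, U, j1, j2, j3, j4, ⟨j5, j6⟩, j7, j8, j9⟩
      simp only [List.length_append, List.length_singleton] at j8
      exact ⟨H₂, Ls₂, U, j1, (List.prefix_append _ _).trans j2, j3, j4, ⟨by omega, j6⟩, j7,
        by omega, by omega⟩
    · refine ⟨by omega, Tri.loop_false (by simp [hI.zero]) ⟨H, L :: Ls, T,
        hI.congr (by simp) (by simp), List.prefix_rfl, by simpa using hT, by simpa using hS₀,
        ⟨le_rfl, by omega, w2⟩, rfl, rfl, by simp; omega⟩⟩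

/-- Joins the blocks. All blocks but the last one have the same weight, and are joined like the
digits of a binary counter. -/
def tower : Cmd :=
  .seq (.op (.const 80 0))
  (.seq (.loop 80 71
    (.seq (Cmd.blk [.ld 81 3 80, .const 82 1])
    (.seq absorb (Cmd.blk [.st 2 2 81, .add 2 2 100, .add 80 80 100]))))
  (.seq (Cmd.blk [.ld 41 3 71, .const 40 0]) (collapse true)))

theorem tower_loop_spec {cx : Cx} {B : ℕ} {Bs : List Tr} {T : Tr}
    (hq : (flat (Bs ++ [T])).length < cx.q) (n : ℕ) :
    ∀ {j : ℕ} {H Ls : List Tr} {s : St}, j + n = Bs.length → s.reg 80 = j → HInv cx H s →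
      Tab cx B H (Bs ++ [T]) s → OnStack H (s.arr 2) 0 Ls (s.reg 2) → Tower Ls B →
      catStack true Ls [] = flat (Bs.take j) → Ls.length ≤ j →
      3 * (H.length + Ls.length + n) ≤ cx.M →
      Tri cx.lim (.loop 80 71
        (.seq (Cmd.blk [.ld 81 3 80, .const 82 1])
        (.seq absorb (Cmd.blk [.st 2 2 81, .add 2 2 100, .add 80 80 100])))) s
        fun k s' => ∃ H' Ls', HInv cx H' s' ∧ H <+: H' ∧ Tab cx B H' (Bs ++ [T]) s' ∧
          OnStack H' (s'.arr 2) 0 Ls' (s'.reg 2) ∧ Tower Ls' B ∧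
          catStack true Ls' [] = flat Bs ∧ Ls'.length ≤ Bs.length ∧
          H'.length + Ls'.length = H.length + Ls.length + n ∧
          k + 70 * Ls'.length ≤ 70 * Ls.length + 110 * n + 2 := by
  induction n with
  | zero =>
    intro j H Ls s hj h80 hI hT hS hTw hf hl hcap
    have := hT.reg_nb
    simp only [List.length_append, List.length_singleton] at this
    rw [List.take_of_length_le (by omega)] at hf
    exact Tri.loop_false (by omega) ⟨H, Ls, hI, List.prefix_rfl, hT, hS, hTw, hf, by omega, rfl,
      by omega⟩
  | succ n ih =>
    intro j H Ls s hj h80 hI hT hS hTw hf hl hcap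
    have hnb := hT.reg_nb
    simp only [List.length_append, List.length_singleton] at hnb
    have hjl : j < Bs.length := by omega
    have := cx.hM
    obtain ⟨V, hV⟩ : ∃ V, Bs[j]? = some V := ⟨_, List.getElem?_eq_getElem hjl⟩
    have hV' : (Bs ++ [T])[j]? = some V := by rw [List.getElem?_append_left hjl, hV]
    obtain ⟨t1, -⟩ := hT.tbl j V hV'
    have szV := (hT.blocks j V hV').2 (by simp; omega)
    have bj := hT.lt_M hV'
    have htake : flat (Bs.take (j + 1)) = flat (Bs.take j) ++ V.toList := by
      rw [List.take_add_one, hV, Option.toList_some, flat_append, flat_singleton]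
    have hcat : catStack true Ls V.toList = flat (Bs.take (j + 1)) := by
      have := catStack_append Ls [] V.toList
      rw [List.nil_append] at this
      rw [this, hf, htake]
    have hsum : (Ls.map Tr.size).sum + V.size < cx.q := by
      rw [← length_toList, ← length_catStack, hcat]
      refine lt_of_le_of_lt ?_ hq
      conv_rhs => rw [flat_append, ← List.take_append_drop (j + 1) Bs, flat_append]
      simp only [List.length_append]; omega
    have hle := hS.le
    refine Tri.loop_true (by omega) ?_
    simp only [Cmd.blk, Tri.seq_iff, Tri.op_iff, Tri.skip_iff, Op.ok, Op.run, Op.cost, St.set_reg,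
      reduceIte, Nat.reduceEqDiff, Cx.lim_kx, Cx.lim_M, Cx.lim_W, Nat.reduceLT, h80,
      true_and]
    refine ⟨bj, by omega, ?_⟩
    refine (absorb_spec Ls (T := V) (hI.congr (by simp) (by simp)) (by simpa using t1)
      (by simpa using hS) (by simp) (hTw.anti (by omega)) hsum (by omega)
      (by simp; omega)).mono_frame 87 rfl ?_
    rintro k s₁ f1 f2 f3 ⟨H₁, Ls₁, U, i1, i2, i3, i4, i5, i6, i7, i8⟩
    have g80 : s₁.reg 80 = j := by rw [f2 80 rfl]; simp [h80]
    have hle₁ := i4.le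
    have := i1.one
    have hHl := i2.length_le
    simp only [St.setA_reg, g80, i1.one]
    refine ⟨by omega, by omega, by omega, ?_⟩
    have hS₂ : OnStack H₁ ((s₁.setA 2 (s₁.reg 2) (s₁.reg 81)).arr 2) 0 (U :: Ls₁)
        (s₁.reg 2 + 1) := by
      refine ⟨_, rfl, by simpa using i3, i4.congr List.prefix_rfl ?_⟩
      intro i hi
      simp only [St.setA_arr]
      rw [if_neg (by omega)]
    refine (ih (j := j + 1) (Ls := U :: Ls₁) (by omega) (by simp)
      (i1.congr (by simp) (by simp [St.setA]))
      (hT.congr i2 (by simp [f2 70 rfl, f2 71 rfl, f1 104])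
        (by simp [St.setA, f3 3 rfl, f3 4 rfl])) (by simpa using hS₂) (i5.anti (by omega)) ?_
      (by simp; omega) (by simp; omega)).mono ?_
    · have : cat true U.toList [] = U.toList := by simp [cat]
      rw [catStack, this, i6, hcat]
    · rintro k₂ s₂ ⟨H₂, Ls₂, j1, j2, j3, j4, j5, j6, j7, j8, j9⟩
      simp only [List.length_cons] at j8 j9
      exact ⟨H₂, Ls₂, j1, i2.trans j2, j3, j4, j5, j6, j7, by omega, by omega⟩

theorem tower_spec {cx : Cx} {B : ℕ} {H Bs : List Tr} {T : Tr} {s : St} (hI : HInv cx H s)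
    (hT : Tab cx B H (Bs ++ [T]) s) (hq : (flat (Bs ++ [T])).length < cx.q) (h2 : s.reg 2 = 0)
    {E : ℕ} (hE : E = ell (flat (Bs ++ [T])).length)
    (hcap : 3 * (H.length + 3 * E + 11 * Bs.length + 4) ≤ cx.M) :
    Tri cx.lim tower s fun k s' => ∃ H' U, HInv cx H' s' ∧ H'[s'.reg 41]? = some U ∧
      U.toList = flat (Bs ++ [T]) ∧ H'.length ≤ H.length + 3 * E + 11 * Bs.length ∧
      k ≤ 700 * E + 2400 * Bs.length + 20 := by
  have hW := cx.hM
  simp only [tower, Tri.seq_iff, Tri.op_iff, Op.ok, Op.run, Op.cost, Cx.lim_W]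
  refine ⟨by omega, ?_⟩
  refine (tower_loop_spec hq Bs.length (j := 0) (Ls := []) (by omega) (by simp)
    (hI.congr (by simp) (by simp)) (hT.congr List.prefix_rfl (by simp) (by simp))
    (show _ = 0 by simpa using h2) trivial rfl (by simp) (by simp; omega)).mono ?_
  rintro k s₁ ⟨H₁, Ls, i1, i2, i3, i4, i5, i6, i7, i8, i9⟩
  have gT : (Bs ++ [T])[Bs.length]? = some T := by simp
  obtain ⟨u1, -⟩ := i3.tbl _ _ gT
  have hnb := i3.reg_nb
  simp only [List.length_append, List.length_singleton] at hnb
  replace hnb : s₁.reg 71 = Bs.length := by omega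
  have bnb := i3.lt_M gT
  have hle := i4.le
  have hHl := i2.length_le
  simp only [List.length_nil] at i8 i9
  have hsum : (Ls.map Tr.size).sum + T.size = (flat (Bs ++ [T])).length := by
    have := length_catStack Ls []
    rw [i6] at this
    rw [flat_append, List.length_append, this, flat_singleton, length_toList]; simp
  simp only [Cmd.blk, Tri.seq_iff, Tri.op_iff, Tri.skip_iff, Op.ok, Op.run, Op.cost, Cx.lim_kx,
    Cx.lim_M, Cx.lim_W, Nat.reduceLT, hnb, true_and]
  refine ⟨bnb, by omega, ?_⟩
  refine (collapse_spec true 0 Ls (T := T) (E := E) (i1.congr (by simp) (by simp))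
    (by simpa using u1) (by simpa using i4) (by simp)
    (i5.coll.anti (i3.blocks _ _ gT).1) (by rw [hsum]; exact hq) (by rw [hsum, hE])
    (by simp; omega) (by omega)).mono ?_
  rintro k₂ s₂ ⟨H₂, U, j1, j2, j3, j4, j5, j6, -⟩
  refine ⟨H₂, U, j1, j3, ?_, by omega, by omega⟩
  have := catStack_append Ls [] T.toList
  rw [List.nil_append] at this
  rw [j4, this, i6, flat_append, flat_singleton]


/-! ### The whole construction -/

/-- Computes the next upper Pell approximation `R[110] / R[101]` of `1 + √2` until the denominator
is at least `R[112]`. -/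
def pell : Cmd :=
  .loop 101 112 (Cmd.blk [.add 113 110 110, .add 114 113 113, .add 114 114 110, .add 115 101 101,
    .add 101 113 101, .add 110 114 115])

/-- The recursion `(P, q) ↦ (5 P + 2 q, 2 P + q)` preserves `P² = 2 P q + q² + 1`. As `q` grows at
least by the factor `2`, the number of steps is logarithmic, and as it grows at most by the factor
`7`, the result is still a small multiple of the bound. -/
theorem pell_spec {Λ : Lim} (n : ℕ) : ∀ {s : St},
    s.reg 110 * s.reg 110 = 2 * s.reg 110 * s.reg 101 + s.reg 101 * s.reg 101 + 1 →
    2 * s.reg 101 ≤ s.reg 110 → s.reg 110 < 3 * s.reg 101 →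
    s.reg 101 ≤ 7 * s.reg 112 → s.reg 112 ≤ s.reg 101 * 2 ^ n → 21 * s.reg 112 ≤ Λ.W →
    Tri Λ pell s fun k s' =>
      s'.reg 110 * s'.reg 110 = 2 * s'.reg 110 * s'.reg 101 + s'.reg 101 * s'.reg 101 + 1 ∧
      2 * s'.reg 101 ≤ s'.reg 110 ∧ s'.reg 110 < 3 * s'.reg 101 ∧ s.reg 112 ≤ s'.reg 101 ∧
      s'.reg 101 ≤ 7 * s.reg 112 ∧ k ≤ 8 * n + 2 := by
  induction n with
  | zero =>
    intro s h1 h2 h3 h4 h5 h6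
    exact Tri.loop_false (by omega) ⟨h1, h2, h3, by omega, h4, by omega⟩
  | succ n ih =>
    intro s h1 h2 h3 h4 h5 h6
    by_cases hc : s.reg 101 < s.reg 112
    · refine Tri.loop_true hc ?_
      simp only [Cmd.blk, Tri.seq_iff, Tri.op_iff, Tri.skip_iff, Op.ok, Op.run, Op.cost, St.set_reg,
        reduceIte, Nat.reduceEqDiff]
      refine ⟨by omega, by omega, by omega, by omega, by omega, by omega, ?_⟩
      refine (ih ?_ ?_ ?_ ?_ ?_ ?_).mono ?_
      · simp; nlinarith
      · simp; omega
      · simp; omega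
      · simp; omega
      · simp
        rw [pow_succ] at h5
        calc s.reg 112 ≤ s.reg 101 * (2 ^ n * 2) := h5
          _ = (2 * s.reg 101) * 2 ^ n := by ring
          _ ≤ _ := Nat.mul_le_mul_right _ (by omega)
      · simpa using h6
      · rintro k s' ⟨i1, i2, i3, i4, i5, i6⟩
        simp at i4 i5
        exact ⟨i1, i2, i3, i4, i5, by omega⟩
    · exact Tri.loop_false (by omega) ⟨h1, h2, h3, by omega, h4, by omega⟩

/-- Sets the constant registers, given the number of triples in register `0` and the length of the
text in register `5`. -/
def setup : Cmd :=
  .seq (Cmd.blk [.move 105 0, .move 106 5, .const 0 0, .const 1 0, .const 2 0, .const 100 1,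
    .const 103 2, .const 107 0, .div 104 106 105, .add 104 104 100, .add 112 106 106,
    .add 112 112 112, .add 112 112 100, .const 110 5, .const 101 2])
  (.seq pell (Cmd.blk [.sub 102 110 101, .sub 102 102 101]))

theorem setup_spec {W M n N : ℕ} {s : St} (h0 : s.reg 0 = n) (h5 : s.reg 5 = N) (hn : 1 ≤ n)
    (hN : n ≤ N) (hW : 300 * N ≤ W) (hM : 8 * M ≤ W) :
    Tri ⟨W, M, 10⟩ setup s fun k s' => ∃ cx : Cx, cx.W = W ∧ cx.M = M ∧ 4 * N < cx.q ∧
      HInv cx [] s' ∧ s'.reg 2 = 0 ∧ s'.reg 104 = N / n + 1 ∧ s'.reg 105 = n ∧ s'.arr = s.arr ∧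
      k ≤ 8 * Nat.log 2 N + 50 := by
  have hd : N / n ≤ N := Nat.div_le_self _ _
  simp only [setup, Cmd.blk, Tri.seq_iff, Tri.op_iff, Tri.skip_iff, Op.ok, Op.run, Op.cost,
    St.set_reg, reduceIte, Nat.reduceEqDiff, h0, h5, true_and]
  refine ⟨by omega, by omega, by omega, by omega, by omega, by omega, by omega, by omega, by omega,
    by omega, by omega, by omega, ?_⟩
  have hlog : N < 2 ^ (Nat.log 2 N + 1) := Nat.lt_pow_succ_log_self (by norm_num) _
  rw [pow_succ] at hlog
  refine (pell_spec (Nat.log 2 N + 2) (by simp) (by simp) (by simp) (by simp; omega) ?_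
    (by simp; omega)).mono_frame 116 rfl ?_
  · simp; rw [pow_add]; omega
  rintro k s₁ f1 f2 f3 ⟨i1, i2, i3, i4, i5, i6⟩
  simp at i4 i5
  have g : ∀ a, s₁.arr a = s.arr a := fun a => by rw [f3 a rfl]; simp
  refine ⟨by omega, by omega, ⟨W, M, s₁.reg 101, s₁.reg 110, i1, i2, i3, by omega, hM⟩, rfl, rfl,
    by simp only; omega, ⟨?_, ?_, ?_, ?_, ?_, ?_, ?_, ?_⟩, ?_, ?_, ?_, ?_, by omega⟩
  · simp [f2 0 rfl]
  · simp [f2 1 rfl]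
  · simp [f2 100 rfl]
  · simp
  · simp; omega
  · simp [f2 103 rfl]
  · simp [f2 107 rfl]
  · simp
  · simp [f2 2 rfl]
  · simp [f2 104 rfl]
  · simp [f2 105 rfl]
  · simp; exact funext g

/-- Adds `n (⌊log₂ B⌋ + 1)` nonterminals that do not occur in any derivation, so that the size of the
output is not smaller than the bound for it. -/
def pad : Cmd :=
  .seq (Cmd.blk [.move 92 104, .const 91 0])
  (.seq (.loop 107 92 (Cmd.blk [.add 91 91 105, .div 92 92 103]))
  (.seq (Cmd.blk [.const 93 0, .const 10 0])
  (.loop 93 91 (.seq newLeaf (.op (.add 93 93 100))))))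

theorem log_loop_spec {Λ : Lim} (v : ℕ) : ∀ {s : St}, s.reg 107 = 0 → s.reg 103 = 2 →
    s.reg 92 = v → 1 ≤ v → s.reg 91 + s.reg 105 * (Nat.log 2 v + 1) < Λ.W →
    Tri Λ (.loop 107 92 (Cmd.blk [.add 91 91 105, .div 92 92 103])) s fun k s' =>
      s'.reg 91 = s.reg 91 + s.reg 105 * (Nat.log 2 v + 1) ∧ k ≤ 4 * (Nat.log 2 v + 1) + 2 := by
  induction v using Nat.strong_induction_on with
  | _ v ih =>
    intro s h0 h2 hv h1 hW
    refine Tri.loop_true (by omega) ?_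
    have hs : s.reg 91 + s.reg 105 ≤ s.reg 91 + s.reg 105 * (Nat.log 2 v + 1) := by
      rw [Nat.mul_add]; omega
    simp only [Cmd.blk, Tri.seq_iff, Tri.op_iff, Tri.skip_iff, Op.ok, Op.run, Op.cost, St.set_reg,
      reduceIte, Nat.reduceEqDiff, hv, h2, true_and]
    refine ⟨by omega, ?_⟩
    by_cases hv2 : v < 2
    · obtain rfl : v = 1 := by omega
      refine Tri.loop_false (by simp [h0]) ?_
      simp
    · have hl : Nat.log 2 v = Nat.log 2 (v / 2) + 1 := by
        rw [Nat.log_of_one_lt_of_le (by norm_num) (by omega)]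
      rw [hl, Nat.mul_add] at hW
      refine (ih (v / 2) (by omega) (by simpa using h0) (by simpa using h2) (by simp) (by omega)
        (by simp only [St.set_reg, reduceIte, Nat.reduceEqDiff]; omega)).mono ?_
      rintro k s' ⟨i1, i2⟩
      simp only [St.set_reg, reduceIte, Nat.reduceEqDiff] at i1
      rw [hl]
      refine ⟨?_, by omega⟩
      rw [i1, Nat.mul_add _ (Nat.log 2 (v / 2) + 1)]; omega

theorem leaf_loop_spec {cx : Cx} (hq : 1 < cx.q) (n : ℕ) : ∀ {H : List Tr} {s : St},
    HInv cx H s → s.reg 93 + n = s.reg 91 → 3 * (H.length + n) ≤ cx.M → s.reg 91 < cx.W →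
    Tri cx.lim (.loop 93 91 (.seq newLeaf (.op (.add 93 93 100)))) s fun k s' => ∃ H',
      HInv cx H' s' ∧ H <+: H' ∧ H'.length = H.length + n ∧ k ≤ 53 * n + 2 := by
  induction n with
  | zero =>
    intro H s hI hn hcap hW
    exact Tri.loop_false (by omega) ⟨H, hI, List.prefix_rfl, rfl, by omega⟩
  | succ n ih =>
    intro H s hI hn hcap hW
    refine Tri.loop_true (by omega) ?_
    rw [Tri.seq_iff]
    refine (newLeaf_spec hI hq (by omega)).mono_frame 13 rfl ?_
    rintro k s₁ f1 - - ⟨i1, -, i3⟩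
    have g93 := f1 93 (by norm_num)
    have g91 := f1 91 (by norm_num)
    simp only [Tri.op_iff, Op.ok, Op.run, Op.cost, Cx.lim_W, i1.one, g93]
    refine ⟨by omega, ?_⟩
    refine (ih (i1.congr (by simp) (by simp)) (by simp [g91]; omega) (by simp; omega)
      (by simp [g91, hW])).mono ?_
    rintro k₂ s₂ ⟨H₂, j1, j2, j3, j4⟩
    simp only [List.length_append, List.length_singleton] at j3
    exact ⟨H₂, j1, (List.prefix_append _ _).trans j2, by omega, by omega⟩

theorem pad_spec {cx : Cx} {H : List Tr} {s : St} {n B E : ℕ} (hI : HInv cx H s) (hq : 1 < cx.q)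
    (hB : 1 ≤ B) (hn : 1 ≤ n) (h104 : s.reg 104 = B) (h105 : s.reg 105 = n)
    (hE : E = n * (Nat.log 2 B + 1)) (hcap : 3 * (H.length + E) ≤ cx.M) :
    Tri cx.lim pad s fun k s' => ∃ H', HInv cx H' s' ∧ H <+: H' ∧ H'.length = H.length + E ∧
      k ≤ 57 * E + 8 := by
  have hW := cx.hM
  have := cx.hq
  have hle : Nat.log 2 B + 1 ≤ E := by rw [hE]; exact Nat.le_mul_of_pos_left _ hn
  simp only [pad, Cmd.blk, Tri.seq_iff, Tri.op_iff, Tri.skip_iff, Op.ok, Op.run, Op.cost,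
    Cx.lim_W, true_and]
  refine ⟨by omega, ?_⟩
  refine (log_loop_spec B (by simp [hI.zero]) (by simp [hI.two]) (by simp [h104]) hB
    (by simp [h105, ← hE]; omega)).mono_frame 93 rfl ?_
  rintro k s₁ f1 f2 f3 ⟨i1, i2⟩
  simp [h105, ← hE] at i1
  refine ⟨by omega, by omega, ?_⟩
  have hI₁ : HInv cx H s₁ := hI.congr
    (by simp only [List.forall_mem_cons]; simp [f1, f2 0 rfl, f2 1 rfl])
    (by simp only [List.forall_mem_cons]
        simp [f3 1 rfl, f3 5 rfl, f3 6 rfl, f3 7 rfl, f3 8 rfl, f3 9 rfl])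
  refine (leaf_loop_spec hq E (hI₁.congr (by simp) (by simp)) (by simp [i1]) hcap
    (by simp [i1]; omega)).mono ?_
  rintro k₂ s₂ ⟨H₂, j1, j2, j3, j4⟩
  exact ⟨H₂, j1, j2, j3, by omega⟩

/-- The construction. In the end, the root is in register `41`. -/
def build : Cmd := .seq setup (.seq parse (.seq tower pad))

theorem ell_le (x : ℕ) : ell x ≤ 2 * Nat.log 2 x + 1 := by
  unfold ell
  have : x < 2 ^ (Nat.log 2 x + 1) := Nat.lt_pow_succ_log_self (by norm_num) _
  have h : x ^ 2 < 2 ^ (2 * Nat.log 2 x + 1 + 1) := by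
    calc x ^ 2 < (2 ^ (Nat.log 2 x + 1)) ^ 2 := Nat.pow_lt_pow_left this (by norm_num)
      _ = _ := by rw [← pow_mul]; ring_nf
  exact Nat.lt_succ_iff.1 (Nat.log_lt_of_lt_pow' (by omega) h)

/-- All bounds are multiples of `E = n (⌊log₂ B⌋ + 1)`, where `B = ⌊N / n⌋ + 1` is the size of the
blocks. -/
theorem log_bounds {n N B E : ℕ} (hn : 1 ≤ n) (hN : n ≤ N) (hB : B = N / n + 1)
    (hE : E = n * (Nat.log 2 B + 1)) :
    n ≤ E ∧ n * ell (2 * B) ≤ 3 * E ∧ Nat.log 2 N ≤ 2 * E ∧ ell N ≤ 5 * E ∧ E ≤ 2 * N ∧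
      N < n * B := by
  have hNB : N < n * B := by rw [hB]; exact Nat.lt_mul_div_succ N hn
  have hB0 : B ≠ 0 := by rw [hB]; exact Nat.succ_ne_zero _
  have hE' : E = n * Nat.log 2 B + n := by rw [hE, Nat.mul_add, Nat.mul_one]
  have hb : Nat.log 2 B ≤ n * Nat.log 2 B := Nat.le_mul_of_pos_left _ hn
  have h1 : ell (2 * B) ≤ 2 * Nat.log 2 B + 3 := by
    have h := ell_le (2 * B)
    have : Nat.log 2 (2 * B) = Nat.log 2 B + 1 := by
      rw [Nat.mul_comm, Nat.log_mul_base (by norm_num) hB0]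
    omega
  have h2 : Nat.log 2 N ≤ n + Nat.log 2 B := by
    apply Nat.lt_succ_iff.1
    apply Nat.log_lt_of_lt_pow' (by omega)
    have e1 : n < 2 ^ n := Nat.lt_two_pow_self
    have e2 : B < 2 ^ (Nat.log 2 B + 1) := Nat.lt_pow_succ_log_self (by norm_num) _
    calc N < n * B := hNB
      _ ≤ 2 ^ n * 2 ^ (Nat.log 2 B + 1) := Nat.mul_le_mul e1.le e2.le
      _ = _ := by rw [← pow_add, ← Nat.add_assoc]
  have h3 := ell_le N
  have h4 : Nat.log 2 B < B := Nat.log_lt_self 2 hB0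
  have h5 : n * (N / n) ≤ N := Nat.mul_div_le N n
  refine ⟨by omega, ?_, by omega, by omega, ?_, hNB⟩
  · calc n * ell (2 * B) ≤ n * (2 * Nat.log 2 B + 3) := Nat.mul_le_mul_left _ h1
      _ = 2 * (n * Nat.log 2 B) + 3 * n := by ring
      _ ≤ _ := by omega
  · rw [hE]
    calc n * (Nat.log 2 B + 1) ≤ n * (N / n + 1) := Nat.mul_le_mul_left _ (by omega)
      _ = n * (N / n) + n := by ring
      _ ≤ 2 * N := by omega

/-- Each array has length `4096 N`, which suffices as `E ≤ 2 N`. -/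
theorem build_spec {W n N B E : ℕ} {p : List LZTriple} {t : List ℕ} (hp : IsLZParse p t)
    (hp0 : p ≠ []) {s : St} (hn : n = p.length) (hN : N = t.length) (h0 : s.reg 0 = n)
    (h5 : s.reg 5 = N) (hin : IsInput p (s.arr 0)) (hB : B = N / n + 1)
    (hE : E = n * (Nat.log 2 B + 1)) (hW : 8 * (4096 * N) ≤ W) :
    Tri ⟨W, 4096 * N, 10⟩ build s fun k s' => ∃ (cx : Cx) (H : List Tr) (U : Tr), cx.M = 4096 * N ∧
      HInv cx H s' ∧ H[s'.reg 41]? = some U ∧ U.toList = t ∧ 3 * H.length ≤ 4096 * N ∧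
      E ≤ H.length ∧ H.length ≤ 400 * E ∧ k ≤ 90000 * E := by
  have hn1 : 1 ≤ n := by rw [hn]; exact List.length_pos_iff.2 hp0
  have hnN : n ≤ N := by rw [hn, hN, hp.length_eq]; exact length_le_lzLength p
  obtain ⟨b1, b2, b3, b4, b5, b6⟩ := log_bounds hn1 hnN hB hE
  have hB1 : 1 ≤ B := by rw [hB]; exact Nat.succ_pos _
  have hBN : B ≤ N + 1 := by rw [hB]; exact Nat.succ_le_succ (Nat.div_le_self _ _)
  obtain ⟨c, hc⟩ : ∃ c, c = t.length / B + p.length := ⟨_, rfl⟩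
  have hc2 : c ≤ 2 * n := by
    have : N / B < n := Nat.div_lt_of_lt_mul (by rw [Nat.mul_comm]; exact b6)
    rw [hc, ← hN, ← hn]; omega
  have k1 : c * (49 * ell (2 * B) + 4) ≤ 302 * E := by
    calc c * (49 * ell (2 * B) + 4) ≤ 2 * n * (49 * ell (2 * B) + 4) := Nat.mul_le_mul_right _ hc2
      _ = 98 * (n * ell (2 * B)) + 8 * n := by ring
      _ ≤ _ := by omega
  have k2 : c * (10900 * ell (2 * B) + 1102) ≤ 68000 * E := by
    calc c * (10900 * ell (2 * B) + 1102) ≤ 2 * n * (10900 * ell (2 * B) + 1102) :=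
          Nat.mul_le_mul_right _ hc2
      _ = 21800 * (n * ell (2 * B)) + 2204 * n := by ring
      _ ≤ _ := by omega
  have k3 : ell (2 * B) ≤ n * ell (2 * B) := Nat.le_mul_of_pos_left _ hn1
  simp only [build, Tri.seq_iff]
  refine (setup_spec h0 h5 hn1 hnN (by omega) hW).mono ?_
  rintro k s₁ ⟨cx, rfl, hM, i1, i2, i3, i4, i5, i6, i7⟩
  rw [← hM]
  change Tri cx.lim _ _ _
  refine (parse_spec hp hp0 hB1 (by omega) (by omega) i2 (by rw [i6]; exact hin)
    (by rw [i4, hB]) (by rw [i5, hn]) hc (by omega) (by omega)).mono_frame 108 rfl ?_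
  rintro k₂ s₂ f1 f2 - ⟨H₂, Bs, T, j1, j2, j3, j4, j5, j6⟩
  have hBs : Bs.length < n := by
    have gT : (Bs ++ [T])[Bs.length]? = some T := by simp
    have := j2.blocks.length_flat_add gT
    rw [j3, ← hN] at this
    by_contra hge
    have : n * B ≤ Bs.length * B := Nat.mul_le_mul_right _ (by omega)
    omega
  have g105 : s₂.reg 105 = n := by rw [f2 105 rfl, i5]
  change Tri cx.lim _ _ _
  refine (tower_spec j1 j2 (by rw [j3]; omega) (by rw [j6, i3]) rfl
    (by rw [j3, ← hN]; omega)).mono_frame 94 rfl ?_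
  rintro k₃ s₃ f3 - - ⟨H₃, U, l1, l2, l3, l4, l5⟩
  rw [j3, ← hN] at l4 l5
  change Tri cx.lim _ _ _
  refine (pad_spec l1 (by omega) hB1 hn1 (by rw [f3 104 (by norm_num), j2.reg_B])
    (by rw [f3 105 (by norm_num), g105]) hE (by omega)).mono_frame 94 rfl ?_
  rintro k₄ s₄ - f4 - ⟨H₄, m1, m2, m3, m4⟩
  refine ⟨cx, H₄, U, rfl, m1, ?_, by rw [l3, j3], by omega, by omega, by omega, by omega⟩
  rw [f4 41 rfl]
  exact getElem?_of_prefix m2 l2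


/-! ### The program -/

/-- Computes the length `N` of the text in register `5`, and `4096 N` in register `8`. -/
def count : Cmd :=
  .seq (Cmd.blk [.const 1 1, .const 2 0, .const 5 0, .const 6 0])
  (.seq (.loop 6 0 (Cmd.blk [.add 2 2 1, .ld 3 0 2, .add 5 5 3, .add 5 5 1, .add 2 2 1, .add 2 2 1,
    .add 6 6 1]))
  (Cmd.blk (.move 8 5 :: List.replicate 12 (.add 8 8 8))))

theorem count_loop_spec {W : ℕ} {p : List LZTriple} (hW : 4096 * lzLength p ≤ W)
    (n : ℕ) :
    ∀ {i : ℕ} {s : St}, i + n = p.length → IsInput p (s.arr 0) → s.reg 0 = p.length →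
      s.reg 1 = 1 → s.reg 2 = 3 * i → s.reg 5 = lzLength (p.take i) → s.reg 6 = i →
      Tri ⟨W, 3 * p.length, 1⟩ (.loop 6 0 (Cmd.blk [.add 2 2 1, .ld 3 0 2, .add 5 5 3, .add 5 5 1,
        .add 2 2 1, .add 2 2 1, .add 6 6 1])) s fun k s' =>
        s'.reg 5 = lzLength p ∧ k ≤ 10 * n + 2 := by
  induction n with
  | zero =>
    intro i s hi hin h0 h1 h2 h5 h6
    refine Tri.loop_false (by omega) ⟨?_, by omega⟩
    rw [h5, List.take_of_length_le (by omega)]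
  | succ n ih =>
    intro i s hi hin h0 h1 h2 h5 h6
    have hil : i < p.length := by omega
    obtain ⟨-, e2, -⟩ := hin i hil
    have hl := lzLength_take_succ hil
    have hle := lzLength_take_le p (i + 1)
    have hpl := length_le_lzLength p
    refine Tri.loop_true (by omega) ?_
    simp only [Cmd.blk, Tri.seq_iff, Tri.op_iff, Tri.skip_iff, Op.ok, Op.run, Op.cost, St.set_reg,
      St.set_arr, reduceIte, Nat.reduceEqDiff, h1, h2, h5, h6, e2, Nat.reduceLT, true_and]
    refine ⟨by omega, by omega, by omega, by omega, by omega, by omega, by omega, ?_⟩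
    refine (ih (i := i + 1) (by omega) (by simpa using hin) (by simpa using h0) (by simpa using h1)
      (by simp; omega) (by simp; omega) (by simp)).mono ?_
    rintro k s' ⟨i1, i2⟩
    exact ⟨i1, by omega⟩

theorem count_spec {W : ℕ} {p : List LZTriple} (hW : 8192 * lzLength p ≤ W) (hp : p ≠ []) {s : St}
    (hin : IsInput p (s.arr 0)) (h0 : s.reg 0 = p.length) :
    Tri ⟨W, 3 * p.length, 1⟩ count s fun k s' => s'.reg 0 = p.length ∧ s'.reg 5 = lzLength p ∧
      s'.reg 8 = 4096 * lzLength p ∧ s'.arr 0 = s.arr 0 ∧ k ≤ 10 * p.length + 20 := by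
  have hn := List.length_pos_iff.2 hp
  have hpl := length_le_lzLength p
  simp only [count, Cmd.blk, Tri.seq_iff, Tri.op_iff, Tri.skip_iff, Op.ok, Op.run, Op.cost]
  refine ⟨by omega, by omega, by omega, by omega, ?_⟩
  refine (count_loop_spec (by omega) p.length (i := 0) (by omega) (by simpa using hin)
    (by simpa using h0) (by simp) (by simp) (by simp [lzLength]) (by simp)).mono_frame 7 rfl ?_
  rintro k s₁ f1 f2 f3 ⟨i1, i2⟩
  have g0 : s₁.reg 0 = p.length := by rw [f2 0 rfl]; simp [h0]
  have ga : s₁.arr 0 = s.arr 0 := by rw [f3 0 rfl]; simp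
  simp only [List.replicate, Cmd.blk, Tri.seq_iff, Tri.op_iff, Tri.skip_iff, Op.ok, Op.run, Op.cost,
    St.set_reg, St.set_arr, reduceIte, Nat.reduceEqDiff, i1, g0, ga, true_and]
  repeat' apply And.intro
  all_goals omega

/-- Sets the base addresses of the arrays. -/
def bases : RAMProgram :=
  [.move 2 28, .add 3 2 2, .add 4 3 2, .add 5 4 2, .add 6 5 2, .add 7 6 2, .add 8 7 2, .add 9 8 2,
    .add 10 9 2]

/-- Moves the base address of the productions, their number, and the root to the output registers. -/
def results : RAMProgram := [.move 0 2, .move 1 20, .move 2 61]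

/-- The program. It counts the letters in order to place the arrays, with array `0` at the address of
the input, then runs the construction, and finally moves the results. It does not depend on `α`. -/
def program : RAMProgram :=
  .move 20 0 :: (count.comp 1 ++ (bases ++ (build.comp (10 + count.len) ++ results)))

theorem length_program : program.length = 13 + count.len + build.len := by
  simp only [program, List.length_cons, List.length_append, Cmd.length_comp, bases, results,
    List.length_nil]
  omega

namespace RAMState

variable {w : ℕ} {P : RAMProgram}

/-- A list of instructions without jumps is executed from the first to the last one. -/
theorem iterate_step_of_straight {l : List RAMInstr}
    (hl : ∀ I ∈ l, ∀ rs : RAMState w, (rs.exec I).pc = rs.pc + 1) :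
    ∀ {o : ℕ} {rs : RAMState w}, rs.pc = o → CodeAt P o l →
      (step P)^[l.length] rs = l.foldl exec rs ∧ (l.foldl exec rs).pc = o + l.length := by
  induction l with
  | nil => intro o rs h _; exact ⟨rfl, h⟩
  | cons I l ih =>
    intro o rs h hc
    obtain ⟨h1, h2⟩ := ih (fun I hI => hl I (by simp [hI])) (o := o + 1) (rs := rs.exec I)
      (by rw [hl I (by simp), h]) hc.tail
    refine ⟨?_, by rw [List.foldl_cons, h2, List.length_cons]; omega⟩
    rw [List.length_cons, Function.iterate_succ_apply, step_of_eq h hc.head, h1, List.foldl_cons]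

/-- The state of the structured language that is represented by a state of the RAM. -/
def toSt (M : ℕ) (rs : RAMState w) : St :=
  ⟨fun r => (rs.reg (r + 20)).toNat, fun k i => (rs.mem (BitVec.ofNat w (k * M + i))).toNat⟩

theorem sim_toSt {M kx : ℕ} {rs : RAMState w} (h : ∀ k < kx, (rs.reg (k + 1)).toNat = k * M) :
    Sim M kx rs (rs.toSt M) :=
  ⟨fun _ => rfl, h, fun _ _ _ _ => rfl⟩

theorem bases_spec {M : ℕ} (hM : 10 * M ≤ 2 ^ w) {rs : RAMState w} {o : ℕ} (hpc : rs.pc = o)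
    (h1 : rs.reg 1 = 0) (h28 : (rs.reg 28).toNat = M) (hc : CodeAt P o bases) :
    ∃ rs', (step P)^[9] rs = rs' ∧ rs'.pc = o + 9 ∧
      (∀ k < 10, (rs'.reg (k + 1)).toNat = k * M) ∧
      (∀ r, rs'.reg (r + 20) = rs.reg (r + 20)) ∧ rs'.mem = rs.mem := by
  obtain ⟨e1, e2⟩ := iterate_step_of_straight (by simp [bases, exec, setReg]) hpc hc
  refine ⟨_, e1, e2, ?_, ?_, ?_⟩
  · have hx : rs.reg 28 = BitVec.ofNat w M := by rw [← h28]; simp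
    intro k hk
    interval_cases k <;>
      simp [bases, exec, setReg, hx, ← BitVec.ofNat_add, h1] <;>
      rw [Nat.mod_eq_of_lt (by omega)] <;> omega
  · intro r
    simp [bases, exec, setReg]
  · simp [bases, exec, setReg]

end RAMState

/-- The initial memory holds the parse. Its lengths fit into words since they sum up to at most
`N`. -/
theorem isInput_init {w : ℕ} {p : List LZTriple} (hw : 3 * p.length ≤ 2 ^ w)
    (h1 : lzLength p ≤ 2 ^ w) (h2 : ∀ q ∈ p, q.start < 2 ^ w ∧ q.next < 2 ^ w) (M : ℕ) :
    IsInput p fun i => ((RAMState.init w p).mem (BitVec.ofNat w (0 * M + i))).toNat := by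
  have key : ∀ (p : List LZTriple) (i : ℕ) (h : i < p.length),
      (p.flatMap fun q => [q.start, q.len, q.next]).getD (3 * i) 0 = p[i].start ∧
      (p.flatMap fun q => [q.start, q.len, q.next]).getD (3 * i + 1) 0 = p[i].len ∧
      (p.flatMap fun q => [q.start, q.len, q.next]).getD (3 * i + 2) 0 = p[i].next := by
    intro p
    induction p with
    | nil => intro i h; simp at h
    | cons q p ih =>
      intro i h
      cases i with
      | zero => simp
      | succ i =>
        have := ih i (by simpa using h)
        simpa [Nat.mul_add, List.flatMap_cons] using this
  intro i hi
  obtain ⟨k1, k2, k3⟩ := key p i hi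
  have hlen : p[i].len < 2 ^ w := by
    have := lzLength_take_succ hi
    have := lzLength_take_le p (i + 1)
    omega
  obtain ⟨hs, hn⟩ := h2 p[i] (List.getElem_mem hi)
  simp only [RAMState.init, BitVec.toNat_ofNat, Nat.zero_mul, Nat.zero_add]
  rw [Nat.mod_eq_of_lt (show 3 * i < 2 ^ w by omega),
    Nat.mod_eq_of_lt (show 3 * i + 1 < 2 ^ w by omega),
    Nat.mod_eq_of_lt (show 3 * i + 2 < 2 ^ w by omega), k1, k2, k3]
  exact ⟨Nat.mod_eq_of_lt hs, Nat.mod_eq_of_lt hlen, Nat.mod_eq_of_lt hn⟩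

/-- What the program achieves, in terms of the final state of the RAM. -/
theorem program_spec {w : ℕ} {p : List LZTriple} {t : List ℕ} (hp0 : p ≠ []) (hp : IsLZParse p t)
    (hw : 65536 * t.length ≤ 2 ^ w) (hin : ∀ q ∈ p, q.start < 2 ^ w ∧ q.next < 2 ^ w) {n N B E : ℕ}
    (hn : n = p.length) (hN : N = t.length) (hB : B = N / n + 1)
    (hE : E = n * (Nat.log 2 B + 1)) :
    ∃ (T : ℕ) (rs : RAMState w) (s : St) (cx : Cx) (H : List Tr) (U : Tr),
      (RAMState.step program)^[T] (RAMState.init w p) = rs ∧ rs.Halted program ∧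
      HInv cx H s ∧ U.toList = t ∧ H[(rs.reg 2).toNat]? = some U ∧
      (rs.reg 1).toNat = H.length ∧ (rs.reg 0).toNat = cx.M ∧ 3 * H.length ≤ cx.M ∧
      2 * cx.M ≤ 2 ^ w ∧
      (∀ i < cx.M, (rs.mem (BitVec.ofNat w (cx.M + i))).toNat = s.arr 1 i) ∧
      E ≤ H.length ∧ H.length ≤ 400 * E ∧ T ≤ 90100 * E := by
  have hlz := hp.length_eq
  have hpl := length_le_lzLength p
  have hn0 := List.length_pos_iff.2 hp0
  have hnE : n ≤ E := by rw [hE]; exact Nat.le_mul_of_pos_right _ (Nat.succ_pos _)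
  have hcode : CodeAt program 0 program := fun i hi => by
    rw [Nat.zero_add, List.getElem?_eq_getElem hi]
  have c0 := hcode.head
  have c1 : CodeAt program 1 (count.comp 1) := hcode.tail.left
  have c2 := hcode.tail.right
  rw [Cmd.length_comp] at c2
  have c3 := c2.left
  have c4 := c2.right
  have c5 := c4.left
  have c6 := c4.right
  rw [Cmd.length_comp] at c6
  simp only [show bases.length = 9 from rfl, Nat.zero_add] at c3 c4 c5 c6
  rw [show 1 + count.len + 9 = 10 + count.len by omega] at c5 c6
  -- the number of triples
  set rs₀ := RAMState.init w p with hrs₀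
  have s1 := RAMState.step_of_eq (rs := rs₀) rfl c0
  set rs₁ := rs₀.exec (.move 20 0) with hrs₁
  have p1 : rs₁.pc = 1 := rfl
  -- the length of the text
  have q1 : Sim (3 * p.length) 1 rs₁ (rs₁.toSt (3 * p.length)) := RAMState.sim_toSt (by
    intro k hk
    obtain rfl : k = 0 := by omega
    simp [hrs₁, hrs₀, RAMState.init, RAMState.exec, RAMState.setReg])
  have hin₁ : IsInput p ((rs₁.toSt (3 * p.length)).arr 0) :=
    isInput_init (by omega) (by omega) hin _
  obtain ⟨k₁, s₁, x1, y0, y1, y2, y3, y4⟩ := count_spec (W := 2 ^ w) (by omega) hp0 hin₁ (by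
    simp [RAMState.toSt, hrs₁, hrs₀, RAMState.init, RAMState.exec, RAMState.setReg]
    exact Nat.mod_eq_of_lt (by omega))
  obtain ⟨rs₂, s2, p2, q2⟩ := x1.simulates (by omega) (by norm_num) p1 c1 q1
  -- the base addresses
  obtain ⟨rs₃, s3, p3, z1, z2, z3⟩ := RAMState.bases_spec (M := 4096 * N) (by omega) p2 (by
    have := q2.base 0 (by norm_num)
    exact BitVec.eq_of_toNat_eq (by simpa using this)) (by
    have := q2.reg 8
    rw [y2] at this
    rw [hN, hlz]; exact this) c3
  have q3 := RAMState.sim_toSt z1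
  have r3 : ∀ r, (rs₃.toSt (4096 * N)).reg r = s₁.reg r := fun r => by
    have := q2.reg r
    rw [← z2] at this
    exact this
  have hin₃ : IsInput p ((rs₃.toSt (4096 * N)).arr 0) := by
    rw [← y3] at hin₁
    have e : ∀ i < 3 * p.length, (rs₃.toSt (4096 * N)).arr 0 i = s₁.arr 0 i := fun i hi => by
      have := q2.mem 0 (by norm_num) i hi
      rw [← z3, Nat.zero_mul] at this
      rw [← this]
      simp [RAMState.toSt]
    intro i hi
    rw [e _ (by omega), e _ (by omega), e _ (by omega)]
    exact hin₁ i hi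
  -- the construction
  obtain ⟨k₂, s₂, x2, cx, H, U, u1, u2, u3, u4, u5, u6, u7, u8⟩ := build_spec (W := 2 ^ w) hp hp0 hn
    hN (by rw [r3, y0, hn]) (by rw [r3, y1, hN, hlz]) hin₃ hB hE (by omega)
  obtain ⟨rs₄, s4, p4, q4⟩ := x2.simulates (by omega) (by norm_num)
    (by rw [p3]; omega) c5 q3
  obtain ⟨s5, p5⟩ := RAMState.iterate_step_of_straight (by
    simp [results, RAMState.exec, RAMState.setReg]) p4 c6
  have b2 := q4.base 1 (by norm_num)
  have hm := q4.mem 1 (by norm_num)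
  have g0 := q4.reg 0
  have g41 := q4.reg 41
  rw [Nat.one_mul] at b2
  rw [← u1] at b2 u5
  refine ⟨3 + (k₂ + (9 + (k₁ + 1))), results.foldl RAMState.exec rs₄, s₂, cx, H, U, ?_, ?_, u2, u4, ?_, ?_, ?_,
    u5, by omega, ?_, u6, u7, by omega⟩
  · rw [Function.iterate_add_apply, Function.iterate_add_apply, Function.iterate_add_apply,
      Function.iterate_add_apply, Function.iterate_one, s1, s2, s3, s4]
    exact s5
  · show program.length ≤ _
    rw [p5, length_program, show results.length = 3 from rfl]; omega
  · rw [← u3]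
    congr 1
  · rw [← u2.cnt]
    simpa [results, RAMState.exec, RAMState.setReg, Function.update_apply] using g0
  · simpa [results, RAMState.exec, RAMState.setReg, Function.update_apply] using b2
  · intro i hi
    rw [← hm i (by omega), ← u1, Nat.one_mul]
    simp [results, RAMState.exec, RAMState.setReg]


/-! ### The straight-line program -/

/-- The right side of the production in the `i`-th cell of the output. -/
def ruleAt (a : ℕ → ℕ) (i : ℕ) : SLPRule :=
  if a (3 * i) = 0 then .letter (a (3 * i + 1)) else .pair (a (3 * i + 1)) (a (3 * i + 2))

theorem ruleAt_leaf {cx : Cx} {H : List Tr} {s : St} (hI : HInv cx H s) {i x : ℕ}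
    (hi : H[i]? = some (.leaf x)) : ruleAt (s.arr 1) i = .letter x ∧
      s.arr 1 (3 * i) = 0 ∧ s.arr 1 (3 * i + 1) = x := by
  obtain ⟨h1, h2⟩ := (hI.cell i _ hi).leaf x rfl
  exact ⟨by rw [ruleAt, if_pos h1, h2], h1, h2⟩

theorem ruleAt_node {cx : Cx} {H : List Tr} {s : St} (hI : HInv cx H s) {i : ℕ} {l r : Tr}
    (hi : H[i]? = some (.node l r)) : ∃ j k, ruleAt (s.arr 1) i = .pair j k ∧
      s.arr 1 (3 * i) = 1 ∧ s.arr 1 (3 * i + 1) = j ∧ s.arr 1 (3 * i + 2) = k ∧ j < i ∧ k < i ∧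
      H[j]? = some l ∧ H[k]? = some r := by
  obtain ⟨h1, h2, h3, h4, h5, h6, h7⟩ := (hI.cell i _ hi).node l r rfl
  exact ⟨_, _, by rw [ruleAt, if_neg (by omega)], h1, rfl, rfl, by omega, by omega, by rwa [h2],
    by rwa [h3]⟩

theorem exists_getElem?_of_rule {H : List Tr} {a : ℕ → ℕ} {i : ℕ} {r : SLPRule}
    (h : ((List.range H.length).map (ruleAt a))[i]? = some r) :
    ruleAt a i = r ∧ ∃ T, H[i]? = some T := by
  rw [List.getElem?_map] at h
  by_cases hi : i < H.length
  · rw [List.getElem?_range hi] at h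
    exact ⟨by simpa using h, _, List.getElem?_eq_getElem hi⟩
  · rw [List.getElem?_eq_none (by simpa using hi)] at h
    simp at h

/-- The straight-line program whose nonterminals have the derivation trees `H`. -/
def slp {cx : Cx} {H : List Tr} {s : St} (hI : HInv cx H s) {root : ℕ} (hr : root < H.length) :
    SLP where
  rules := (List.range H.length).map (ruleAt (s.arr 1))
  start := root
  start_lt := by simpa using hr
  lt_of_pair i j k h := by
    obtain ⟨h1, T, hT⟩ := exists_getElem?_of_rule h
    cases T with
    | leaf x => rw [(ruleAt_leaf hI hT).1] at h1; cases h1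
    | node l r =>
      obtain ⟨j', k', e1, -, -, -, e2, e3, -⟩ := ruleAt_node hI hT
      rw [e1] at h1; cases h1
      exact ⟨e2, e3⟩

section

variable {cx : Cx} {H : List Tr} {s : St} (hI : HInv cx H s) {root : ℕ} (hr : root < H.length)

theorem size_slp : (slp hI hr).size = H.length := by simp [slp, SLP.size]

theorem derives_slp {T : Tr} : ∀ {i : ℕ}, H[i]? = some T → (slp hI hr).Derives i T.toList := by
  have hrule : ∀ {i : ℕ} {T : Tr}, H[i]? = some T →
      (slp hI hr).rules[i]? = some (ruleAt (s.arr 1) i) := by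
    intro i T hi
    have := (List.getElem?_eq_some_iff.1 hi).1
    simp [slp, this]
  induction T with
  | leaf x =>
    intro i hi
    exact .letter (by rw [hrule hi, (ruleAt_leaf hI hi).1])
  | node l r ihl ihr =>
    intro i hi
    obtain ⟨j, k, e1, -, -, -, -, -, e2, e3⟩ := ruleAt_node hI hi
    exact .pair (by rw [hrule hi, e1]) (ihl e2) (ihr e3)

theorem isBalanced_slp {α : ℝ} (hα₀ : 0 < α) (hα₁ : α ≤ 1 - Real.sqrt 2 / 2) :
    (slp hI hr).IsBalanced α := by
  intro i j k u v h hu hv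
  obtain ⟨h1, T, hT⟩ := exists_getElem?_of_rule h
  cases T with
  | leaf x => rw [(ruleAt_leaf hI hT).1] at h1; cases h1
  | node l r =>
    obtain ⟨j', k', e1, -, -, -, -, -, e2, e3⟩ := ruleAt_node hI hT
    rw [e1] at h1; cases h1
    rw [hu.unique (derives_slp hI hr e2), hv.unique (derives_slp hI hr e3), length_toList,
      length_toList]
    obtain ⟨-, -, n1, n2⟩ := (hI.cell i _ hT).bal
    have hl : (0 : ℝ) < l.size := by exact_mod_cast l.size_pos
    have hr : (0 : ℝ) < r.size := by exact_mod_cast r.size_pos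
    -- `α ≤ 1 / (2 + √2)` means that `(1 - α) / α ≥ 1 + √2`
    have hρ : rho * α ≤ 1 - α := by
      have h2 := Real.mul_self_sqrt (show (0 : ℝ) ≤ 2 by norm_num)
      have h3 := Real.sqrt_nonneg 2
      unfold rho; nlinarith
    have hα : 0 < 1 - α := by
      have := rho_gt
      nlinarith
    constructor
    · rw [div_le_div_iff₀ hα hr]
      nlinarith
    · rw [div_le_div_iff₀ hr hα₀]
      nlinarith

theorem outputs_slp {w : ℕ} {rs : RAMState w} (h0 : (rs.reg 0).toNat = cx.M)
    (h1 : (rs.reg 1).toNat = H.length) (h2 : (rs.reg 2).toNat = root)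
    (hcap : 3 * H.length ≤ cx.M) (hw : 2 * cx.M ≤ 2 ^ w)
    (hm : ∀ i < cx.M, (rs.mem (BitVec.ofNat w (cx.M + i))).toNat = s.arr 1 i) :
    rs.Outputs (slp hI hr) := by
  refine ⟨by rw [size_slp, h0]; omega, by rw [size_slp, h1], h2, fun i r h => ?_⟩
  obtain ⟨e1, T, hT⟩ := exists_getElem?_of_rule h
  have hi := (List.getElem?_eq_some_iff.1 hT).1
  have hm' : ∀ x < cx.M, (rs.mem (rs.reg 0 + BitVec.ofNat w x)).toNat = s.arr 1 x := fun x hx => by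
    have : rs.reg 0 = BitVec.ofNat w cx.M := by rw [← h0]; simp
    rw [this, ← BitVec.ofNat_add, hm x hx]
  cases T with
  | leaf x =>
    obtain ⟨d1, d2, d3⟩ := ruleAt_leaf hI hT
    rw [d1] at e1; subst e1
    exact ⟨by rw [hm' _ (by omega), d2], by rw [hm' _ (by omega), d3]⟩
  | node l r =>
    obtain ⟨j, k, d1, d2, d3, d4, -⟩ := ruleAt_node hI hT
    rw [d1] at e1; subst e1
    exact ⟨by rw [hm' _ (by omega), d2], by rw [hm' _ (by omega), d3],
      by rw [hm' _ (by omega), d4]⟩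

end

/-- `⌊log₂ (⌊N / n⌋ + 1)⌋ ≤ 1 + 2 log (N / n)`, since `⌊N / n⌋ + 1 ≤ 2 N / n`. -/
theorem log_bound_real {n N : ℕ} (hn : 1 ≤ n) (hN : n ≤ N) :
    ((n * (Nat.log 2 (N / n + 1) + 1) : ℕ) : ℝ) ≤ 2 * (n * (1 + Real.log ((N : ℝ) / n))) := by
  have hn0 : (0 : ℝ) < n := by exact_mod_cast hn
  have hx : 1 ≤ (N : ℝ) / n := by
    rw [one_le_div hn0]; exact_mod_cast hN
  have h1 : ((N / n : ℕ) : ℝ) ≤ (N : ℝ) / n := Nat.cast_div_le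
  have h2 : ((2 ^ Nat.log 2 (N / n + 1) : ℕ) : ℝ) ≤ ((N / n + 1 : ℕ) : ℝ) := by
    exact_mod_cast Nat.pow_log_le_self 2 (Nat.succ_ne_zero _)
  have h3 : (2 : ℝ) ^ Nat.log 2 (N / n + 1) ≤ 2 * ((N : ℝ) / n) := by
    push_cast at h2 ⊢
    linarith
  have h4 := Real.log_le_log (by positivity) h3
  rw [Real.log_pow, Real.log_mul (by norm_num) (by positivity)] at h4
  have h5 := Real.log_two_gt_d9
  have h6 := Real.log_nonneg hx
  have h7 : (Nat.log 2 (N / n + 1) : ℝ) ≤ 1 + 2 * Real.log ((N : ℝ) / n) := by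
    by_contra hc
    push Not at hc
    nlinarith
  push_cast
  nlinarith

theorem mainTheorem6 (α : ℝ) (hα₀ : 0 < α) (hα₁ : α ≤ 1 - Real.sqrt 2 / 2) :
    ∃ (P : RAMProgram) (C : ℝ) (K : ℕ),
      ∀ (w : ℕ) (p : List LZTriple) (t : List ℕ),
        p ≠ [] → IsLZParse p t →
        K * t.length ≤ 2 ^ w → (∀ q ∈ p, q.start < 2 ^ w ∧ q.next < 2 ^ w) →
        ∃ (T : ℕ) (G : SLP),
          ((RAMState.step P)^[T] (RAMState.init w p)).Halted P ∧
          ((RAMState.step P)^[T] (RAMState.init w p)).Outputs G ∧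
          G.Derives G.start t ∧
          G.IsBalanced α ∧
          (G.size : ℝ) ≤ C * ((p.length : ℝ) * (1 + Real.log ((t.length : ℝ) / (p.length : ℝ)))) ∧
          (T : ℝ) ≤ C * (G.size : ℝ) := by
  refine ⟨program, 90100, 65536, fun w p t hp0 hp hw hin => ?_⟩
  obtain ⟨T, rs, s, cx, H, U, h1, h2, hI, hU, hroot, o1, o0, hcap, hM, hm, hE1, hE2, hT⟩ :=
    program_spec hp0 hp hw hin rfl rfl rfl rfl
  have hr := (List.getElem?_eq_some_iff.1 hroot).1
  have hn : 1 ≤ p.length := List.length_pos_iff.2 hp0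
  have hN : p.length ≤ t.length := by rw [hp.length_eq]; exact length_le_lzLength p
  have hb := log_bound_real hn hN
  refine ⟨T, slp hI hr, by rwa [h1], by rw [h1]; exact outputs_slp hI hr o0 o1 rfl hcap hM hm,
    by rw [← hU]; exact derives_slp hI hr hroot, isBalanced_slp hI hr hα₀ hα₁, ?_, ?_⟩
  · rw [size_slp]
    have : (H.length : ℝ) ≤
        400 * ((p.length * (Nat.log 2 (t.length / p.length + 1) + 1) : ℕ) : ℝ) := by
      exact_mod_cast hE2
    have h0 : (0 : ℝ) ≤ ((p.length * (Nat.log 2 (t.length / p.length + 1) + 1) : ℕ) : ℝ) :=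
      Nat.cast_nonneg _
    linarith
  · rw [size_slp]
    have : T ≤ 90100 * H.length := hT.trans (Nat.mul_le_mul_left _ hE1)
    exact_mod_cast this
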